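/- **Setting.** Let $k\ge 2$ and let indices $i$ run over $\mathbb Z/k$. Let $X_i$ be smooth 4-manifolds (without boundary), each containing smoothly embedded closed connected oriented surfaces $S_i,T_i$ of genus $g(S_i),g(T_i)$ and self-intersection $m_i,n_i$, meeting transversely in a single point $x_i$, with $g(T_i)=g(S_{i+1})$ for all $i$. Fix tubular neighbourhoods adapted at $x_i$: a chart $(w_1,w_2)$ at $x_i$ onto $\{|w_1|<3,|w_2|<3\}\subset\mathbb C^2$ with $S_i=\{w_2=0\}$, $T_i=\{w_1=0\}$; put $S_i''=\{w_2=0,|w_1|\le 2\}$, $T_i''=\{w_1=0,|w_2|\le2\}$, $S_i'=\overline{S_i\setminus S_i''}$, $T_i'=\overline{T_i\setminus T_i''}$. The tubular neighbourhood $N(S_i)$ is the union of $\{|w_1|\le 2,|w_2|\le 1\}\cong S_i''\times D^2$ and a trivialized part $S_i'\times D^2$, glued by the clutching function $w_2=(w_1/|w_1|)^{m_i}z$, where $z$ is the fibre coordinate over $S_i'$; likewise $N(T_i)=T_i''\times D^2\cup T_i'\times D^2$ with $w_1=(w_2/|w_2|)^{n_i}z$. (So $m_i,n_i$ are the Euler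 numbers of the normal bundles. The trivializations are given over slightly larger open sets, with fibres of radius $3$.) All punctured surfaces $S_i'$, $T_i'$ of the same genus are identified with the same standard model, in $\mathbb R^3$, which carries a reflection $r$ restricting to the reflection $w\mapsto\bar w$ of its boundary circle (as coordinatized by $w_1$, resp. $w_2$). Let $N_i=\{(\log^+|w_1|)^2+(\log^+|w_2|)^2\le(\log 2)^2\}$, a 4-ball around $x_i$, let $P_i=X_i\setminus \mathrm{int}\,(N_i\cup N(S_i)\cup N(T_i))$, and let $V_i=\partial N_i\cap P_i\cong T^2\times I$, fibred by the tori $|w_1|=\text{const}$. A *$k$-fold sum* of the $(X_i;S_i,T_i)$ is a smooth 4-manifold $Y$ without boundary that is the union of smoothly embedded copies of the $P_i$ and of $T^2\times D^2$, such that * the pieces $P_i$ are glued to each other exactly along the faces $T_i'\times S^1\cong S_{i+1}'\times S^1$ of their boundaries, for each $i$ either by $(u,z)\mapsto(r(u),z)$ or, after composing with the reflection and reversing the circle fibre, by $(u,z)\mapsto(u,\bar z)$; * the interior $T^2\times\mathrm{int}\,D^2$ is disjoint from the $P_i$, the boundary $T^2\times\partial D^2$ is identified with $\bigcup_iV_i$,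 and the tori $T^2\times\{pt\}$, $pt\in\partial D^2$, are identified with the torus fibres of the $V_i$. For integers $c_1,\dots,c_p$ let $[c_1,\dots,c_p]=c_1-1/(c_2-1/(\cdots-1/c_p)\cdots)\in\mathbb Q\cup\{\infty\}$, computed with $1/0=\infty$, $1/\infty=0$ and $c-\infty=\infty$ (in particular, $[c_1,\dots,c_{p-1},0]=[c_1,\dots,c_{p-2}]$, the empty fraction being $\infty$). The *cyclic continued fractions* of a cyclic sequence $(a_1,\dots,a_k)$ are the $k$ numbers $[a_j,a_{j+1},\dots,a_{j+k-2}]$, $j\in\mathbb Z/k$. **Proposition.** Set $a_i=n_i+m_{i+1}$ (indices mod $k$). If each of the $k$ cyclic continued fractions of $(a_1,\dots,a_k)$ is $0$, then a $k$-fold sum $Y$ of the $(X_i;S_i,T_i)$ exists, Hausdorff and second countable if the $X_i$ are, and compact if all $X_i$ are compact (so that $Y$ is a closed 4-manifold if the $X_i$ are closed). Moreover all gluings except possibly one, that of $T_k'\times S^1$ to $S_1'\times S^1$, can be taken of the first form $(u,z)\mapsto(r(u),z)$. -/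

import Mathlib

open scoped Manifold ContDiff
open Set

universe u

/-! ### Continued fractions -/

/-- `c - 1/x` on the rational projective line, with `1/0 = ∞` and `1/∞ = 0`. -/
def negCFStep (c : ℤ) : OnePoint ℚ → OnePoint ℚ
  | none => OnePoint.some (c : ℚ)
  | some x => if x = 0 then OnePoint.infty else OnePoint.some ((c : ℚ) - 1 / x)

/-- The continued fraction `[c₁, …, c_p] = c₁ - 1/(c₂ - 1/(⋯ - 1/c_p))`, with values in `ℚ ∪ {∞}`.
The empty continued fraction is `∞`, so that `[c] = c`. -/
def negCF : List ℤ → OnePoint ℚ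
  | [] => OnePoint.infty
  | c :: l => negCFStep c (negCF l)

/-- The convention `[c₁, …, c_p] = [c₁, …, c_{p-2}]` for `c_p = 0`. -/
theorem negCF_append_zero (l : List ℤ) (c : ℤ) : negCF (l ++ [c, 0]) = negCF l := by
  induction l with
  | nil =>
    change (if ((0 : ℤ) : ℚ) = 0 then OnePoint.infty
      else OnePoint.some ((c : ℚ) - 1 / ((0 : ℤ) : ℚ))) = OnePoint.infty
    exact if_pos (Int.cast_zero (R := ℚ))
  | cons a l ih => simp [negCF, ih]

/-- The cyclic continued fraction `[a_j, a_{j+1}, …, a_{j+k-2}]` (indices mod `k`) of the cyclic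
sequence `a`; it has `k - 1` entries. -/
def cyclicCF (k : ℕ) (a : ZMod k → ℤ) (j : ZMod k) : OnePoint ℚ :=
  negCF (List.ofFn fun t : Fin (k - 1) => a (j + ((t : ℕ) : ZMod k)))

/-! ### The standard closed surface of genus `g` and its punctured version

Points of `ℝ³` are written `(x, y + i z) : ℝ × ℂ`. -/

/-- The standard closed oriented surface of genus `g` in `ℝ³`: the smooth level set
`z² = (R² - x² - y²) ∏_{j < g} ((x - c_j)² + y² - 1)`, `R = 3g + 10`, `c_j = 3(j+1)`, i.e. the
double of a round disc of radius `R` with `g` disjoint round holes of radius `1`.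
In the region `x < 0`, `y² + z² < 9` the function `y + i z` is a coordinate on it, mapping that
region diffeomorphically onto the disc of radius `3`. -/
def genusSurface (g : ℕ) : Set (ℝ × ℂ) :=
  {u | u.2.im ^ 2 =
    ((3 * (g : ℝ) + 10) ^ 2 - u.1 ^ 2 - u.2.re ^ 2) *
      ∏ j ∈ Finset.range g, ((u.1 - 3 * ((j : ℝ) + 1)) ^ 2 + u.2.re ^ 2 - 1)}

/-- The surface of genus `g` with the closed coordinate disc `|y + i z| ≤ 1` removed. -/
def openPunctured (g : ℕ) : Set (ℝ × ℂ) :=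
  {u | u ∈ genusSurface g ∧ ¬ (u.1 < 0 ∧ ‖u.2‖ ≤ 1)}

/-- The compact punctured surface of genus `g`: the open coordinate disc `|y + i z| < 2` is removed.
Its boundary is the circle `x < 0`, `|y + i z| = 2`. -/
def punctured (g : ℕ) : Set (ℝ × ℂ) :=
  {u | u ∈ genusSurface g ∧ ¬ (u.1 < 0 ∧ ‖u.2‖ < 2)}

/-- The reflection `(x, y, z) ↦ (x, y, -z)`. It preserves `genusSurface g` and the coordinate disc,
reverses the orientation of the surface, and restricts to a reflection of the boundary circle of
`punctured g`. -/
def reflect (u : ℝ × ℂ) : ℝ × ℂ := (u.1, (starRingEnd ℂ) u.2)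

/-! ### Pairs of surfaces with their tubular neighbourhoods -/

/-- Let `U` be the domain of a coordinate chart `(b, f)` of a `4`-manifold `X` around a point of a
surface `S` which is `{f = 0}` in the chart, so that `b` is a coordinate on the disc
`S'' = S ∩ {|b| ≤ 2}` and `f` is a fibre coordinate of the tubular neighbourhood over it.
This structure is the part of a tubular neighbourhood of `S` lying over the punctured
surface `S' = S \ S''` of genus `g`, with a trivialization `(base, fib)` onto
`(punctured surface) × D²` (extended over a slightly larger open set).
The two parts are glued over the overlap by the clutching function `f = (b/|b|)^e • fib`,
that is, the normal bundle of `S` has Euler number (self-intersection number of `S`) `e`. -/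
structure TubeOverPunctured (X : Type*) [TopologicalSpace X]
    [ChartedSpace (EuclideanSpace ℝ (Fin 4)) X] (g : ℕ) (e : ℤ) (U : Set X) (b f : X → ℂ) where
  dom : Set X
  isOpen_dom : IsOpen dom
  base : X → ℝ × ℂ
  fib : X → ℂ
  smooth : ContMDiffOn (𝓡 4) 𝓘(ℝ, (ℝ × ℂ) × ℂ) ∞ (fun p => (base p, fib p)) dom
  immersive : ∀ p ∈ dom, Function.Injective
    (mfderiv (𝓡 4) 𝓘(ℝ, (ℝ × ℂ) × ℂ) (fun p => (base p, fib p)) p)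
  injOn : InjOn (fun p => (base p, fib p)) dom
  image_eq : (fun p => (base p, fib p)) '' dom = {q | q.1 ∈ openPunctured g ∧ ‖q.2‖ < 3}
  mem_dom_iff : ∀ p ∈ U, p ∈ dom ↔ 1 < ‖b p‖
  mem_chart_iff : ∀ p ∈ dom, p ∈ U ↔ (base p).1 < 0 ∧ ‖(base p).2‖ < 3
  base_eq : ∀ p ∈ dom ∩ U, (base p).2 = b p
  clutching : ∀ p ∈ dom ∩ U, f p = (b p / (‖b p‖ : ℂ)) ^ e * fib p

/-- Closed embedded surfaces `S`, `T` of genus `g`, `h` and self-intersection `m`, `n` in the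
`4`-manifold `X`, meeting transversely in a single point `x`, together with tubular neighbourhoods
of them adapted to each other near `x`:
a chart `(w₁, w₂)` around `x` onto the bidisc of radius `3`, in which `S = {w₂ = 0}` and
`T = {w₁ = 0}`, and the trivialized tubular neighbourhoods over the punctured surfaces. -/
structure SurfacePair (X : Type*) [TopologicalSpace X]
    [ChartedSpace (EuclideanSpace ℝ (Fin 4)) X] (S T : Set X) (g h : ℕ) (m n : ℤ) where
  chart : Set X
  isOpen_chart : IsOpen chart
  w₁ : X → ℂ
  w₂ : X → ℂ
  smooth : ContMDiffOn (𝓡 4) 𝓘(ℝ, ℂ × ℂ) ∞ (fun p => (w₁ p, w₂ p)) chart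
  immersive : ∀ p ∈ chart, Function.Injective
    (mfderiv (𝓡 4) 𝓘(ℝ, ℂ × ℂ) (fun p => (w₁ p, w₂ p)) p)
  injOn : InjOn (fun p => (w₁ p, w₂ p)) chart
  image_eq : (fun p => (w₁ p, w₂ p)) '' chart = {q | ‖q.1‖ < 3 ∧ ‖q.2‖ < 3}
  tubeS : TubeOverPunctured X g m chart w₁ w₂
  tubeT : TubeOverPunctured X h n chart w₂ w₁
  inter_subset : tubeS.dom ∩ tubeT.dom ⊆ chart
  S_eq : S = {p | p ∈ tubeS.dom ∧ tubeS.fib p = 0} ∪ {p | p ∈ chart ∧ w₂ p = 0}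
  T_eq : T = {p | p ∈ tubeT.dom ∧ tubeT.fib p = 0} ∪ {p | p ∈ chart ∧ w₁ p = 0}

namespace SurfacePair

variable {X : Type*} [TopologicalSpace X] [ChartedSpace (EuclideanSpace ℝ (Fin 4)) X]
  {S T : Set X} {g h : ℕ} {m n : ℤ}

/-- The interior of the tubular neighbourhood `N(S)` (the unit disc bundle). -/
def nbhdS (P : SurfacePair X S T g h m n) : Set X :=
  {p | p ∈ P.tubeS.dom ∧ ‖P.tubeS.fib p‖ < 1} ∪ {p | p ∈ P.chart ∧ ‖P.w₂ p‖ < 1}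

/-- The interior of the tubular neighbourhood `N(T)` (the unit disc bundle). -/
def nbhdT (P : SurfacePair X S T g h m n) : Set X :=
  {p | p ∈ P.tubeT.dom ∧ ‖P.tubeT.fib p‖ < 1} ∪ {p | p ∈ P.chart ∧ ‖P.w₁ p‖ < 1}

/-- An open `4`-ball around the intersection point, not contained in `N(S) ∪ N(T)`, which meets `S`
and `T` in the discs of radius `2` and whose boundary meets those of `N(S)` and `N(T)`
orthogonally (in logarithmic coordinates). -/
def ball (P : SurfacePair X S T g h m n) : Set X :=
  {p | p ∈ P.chart ∧ Real.posLog ‖P.w₁ p‖ ^ 2 + Real.posLog ‖P.w₂ p‖ ^ 2 < Real.log 2 ^ 2}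

/-- The piece `X \ (N ∪ N(S) ∪ N(T))`, a closed domain with corners in `X`. -/
def piece (P : SurfacePair X S T g h m n) : Set X :=
  (P.ball ∪ P.nbhdS ∪ P.nbhdT)ᶜ

/-- The part `S' × S¹` of the boundary of the piece. -/
def faceS (P : SurfacePair X S T g h m n) : Set X :=
  {p | p ∈ P.tubeS.dom ∧ P.tubeS.base p ∈ punctured g ∧ ‖P.tubeS.fib p‖ = 1}

/-- The part `T' × S¹` of the boundary of the piece. -/
def faceT (P : SurfacePair X S T g h m n) : Set X :=
  {p | p ∈ P.tubeT.dom ∧ P.tubeT.base p ∈ punctured h ∧ ‖P.tubeT.fib p‖ = 1}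

/-- The part `V = ∂N \ int (N(S) ∪ N(T)) ≅ T² × I` of the boundary of the piece; its torus fibres
are the level sets of `|w₁|`. -/
def hopf (P : SurfacePair X S T g h m n) : Set X :=
  {p | p ∈ P.chart ∧ 1 ≤ ‖P.w₁ p‖ ∧ 1 ≤ ‖P.w₂ p‖ ∧
    Real.log ‖P.w₁ p‖ ^ 2 + Real.log ‖P.w₂ p‖ ^ 2 = Real.log 2 ^ 2}

end SurfacePair

/-! ### `k`-fold sums -/

section KFoldSum

variable {k : ℕ} {X : ZMod k → Type*} [∀ i, TopologicalSpace (X i)]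
  [∀ i, ChartedSpace (EuclideanSpace ℝ (Fin 4)) (X i)]
  {S T : ∀ i, Set (X i)} {gS gT : ZMod k → ℕ} {m n : ZMod k → ℤ}

/-- The gluing of `T'_i × S¹` to `S'_{i+1} × S¹`. If `flip i = false`, it preserves the
`S¹`-coordinate and reverses the orientation of the punctured surface. If `flip i = true`, it is
precomposed with the reflection of the punctured surface and the `S¹`-coordinate is reversed. -/
inductive Glued (P : ∀ i, SurfacePair (X i) (S i) (T i) (gS i) (gT i) (m i) (n i))
    (flip : ZMod k → Bool) : (Σ i, X i) → (Σ i, X i) → Prop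
  | straight (i : ZMod k) (p : X i) (q : X (i + 1)) (hp : p ∈ (P i).faceT)
      (hq : q ∈ (P (i + 1)).faceS) (hflip : flip i = false)
      (hbase : (P (i + 1)).tubeS.base q = reflect ((P i).tubeT.base p))
      (hfib : (P (i + 1)).tubeS.fib q = (P i).tubeT.fib p) :
      Glued P flip ⟨i, p⟩ ⟨i + 1, q⟩
  | flipped (i : ZMod k) (p : X i) (q : X (i + 1)) (hp : p ∈ (P i).faceT)
      (hq : q ∈ (P (i + 1)).faceS) (hflip : flip i = true)
      (hbase : (P (i + 1)).tubeS.base q = (P i).tubeT.base p)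
      (hfib : (P (i + 1)).tubeS.fib q = (starRingEnd ℂ) ((P i).tubeT.fib p)) :
      Glued P flip ⟨i, p⟩ ⟨i + 1, q⟩

/-- `Y` is a `k`-fold sum of the `(X_i; S_i, T_i)`, with gluings as prescribed by `flip`:
`Y` is the union of the pieces `X_i \ (N_i ∪ N(S_i) ∪ N(T_i))`, glued to each other exactly along
their faces `T'_i × S¹ = S'_{i+1} × S¹`, and of a copy of `T² × D²`, glued to them exactly along
`T² × ∂D² = ⋃ V_i` by a map which is fibrewise with respect to the torus fibrations `V_i → I`.
All inclusions of pieces are smooth codimension-zero embeddings: they are closed embeddings and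
extend to local diffeomorphisms near the piece. -/
structure IsKFoldSum (P : ∀ i, SurfacePair (X i) (S i) (T i) (gS i) (gT i) (m i) (n i))
    (flip : ZMod k → Bool) {Y : Type*} [TopologicalSpace Y]
    [ChartedSpace (EuclideanSpace ℝ (Fin 4)) Y]
    (j : ∀ i, X i → Y) (c : (Circle × Circle) × ℂ → Y) : Prop where
  localDiffeo : ∀ i, IsLocalDiffeomorphOn (𝓡 4) (𝓡 4) ∞ (j i) (P i).piece
  closedEmbedding : ∀ i, Topology.IsClosedEmbedding ((P i).piece.domRestrict (j i))
  eq_iff : ∀ a b : Σ i, X i, a.2 ∈ (P a.1).piece → b.2 ∈ (P b.1).piece →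
    (j a.1 a.2 = j b.1 b.2 ↔ a = b ∨ Glued P flip a b ∨ Glued P flip b a)
  localDiffeo_core : IsLocalDiffeomorphOn (((𝓡 1).prod (𝓡 1)).prod 𝓘(ℝ, ℂ)) (𝓡 4) ∞ c
    (univ ×ˢ Metric.closedBall 0 1)
  injOn_core : InjOn c (univ ×ˢ Metric.closedBall 0 1)
  core_interior_disjoint : ∀ i,
    Disjoint (c '' (univ ×ˢ Metric.ball 0 1)) (j i '' (P i).piece)
  core_boundary : c '' (univ ×ˢ Metric.sphere 0 1) = ⋃ i, j i '' (P i).hopf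
  core_fibrewise : ∀ i, ∀ p ∈ (P i).hopf, ∀ (t : Circle × Circle), ∀ ζ ∈ Metric.sphere (0 : ℂ) 1,
    c (t, ζ) = j i p →
      (fun s => c (s, ζ)) '' univ = j i '' {q | q ∈ (P i).hopf ∧ ‖(P i).w₁ q‖ = ‖(P i).w₁ p‖}
  cover : (⋃ i, j i '' (P i).piece) ∪ c '' (univ ×ˢ Metric.closedBall 0 1) = univ

end KFoldSum

/-! ### Gluing manifolds along open subsets -/

/-! Glue the faces cyclically. What remains of the boundary is a torus bundle over a circle,
composed of the `V_i`. Passing from `V_i` to `V_{i+1}` changes the two angular coordinates by an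
integral matrix. Since the two clutching functions compose, this matrix depends only on `a_i = n_i +
m_{i+1}` and, up to sign, is the inverse of `cfMatrix (a i)`. Products of these matrices compute
continued fractions, and the vanishing of the cyclic ones forces the monodromy to be `1` or `-1`.
Switching the gluing at `0` to its flipped form changes the sign of one matrix. So the bundle can be
made trivial and filled with `T² × D²` (`cfProd_eq_inv_or_neg`, `exists_torus_transport`).

To obtain a smooth structure without manifolds with corners, each piece is enlarged to an open set
`thick`, and open sets are glued along open overlaps (`SmoothGluing`). The face gluings extend to
the tubes by inverting the radius of the fibre (`faceMap`), so that inside and outside of the unit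
circle bundle are exchanged. In the logarithmic coordinates `(log|w₁|, log|w₂|)` near a corner this
extension is a rotation by `-π/2` (`FaceMatch.coords`, `level_rotate`). The corner of a piece is a
quarter plane there; the power map with exponent `4/k` turns it into a sector of angle `2π/k`, and
`k` such sectors, rotated by roots of unity, surround the origin of a disc. This gives a map
`coreMap` from a neighbourhood of each `V_i` to `T² × ℂ` which respects the face gluings
(`coreMap_succ`) and makes no further identifications (`level_of_coreMap_eq`).

The identifications then form an equivalence relation (`SumData.Rel.trans`) with smooth transition
maps (`SumData.gluing`). All overlaps are controlled by compact collars. This yields the Hausdorff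
property and closedness of the embedded pieces (`FaceMatch.of_frequently`, `isClosed_image_proj`).
The sum is covered by the pieces and the compact core, whence compactness and second countability.
-/

open Filter Topology in
/-- A cover of a set `Y` by injective images of open subsets of manifolds, with smooth changes of
parametrization. -/
structure SmoothGluing (E : Type*) [NormedAddCommGroup E] [NormedSpace ℝ E] {ι : Type*}
    (M : ι → Type*) [∀ a, TopologicalSpace (M a)] [∀ a, ChartedSpace E (M a)] (Y : Type*) where
  toFun : ∀ a, M a → Y
  dom : ∀ a, Set (M a)
  isOpen_dom : ∀ a, IsOpen (dom a)
  injOn : ∀ a, InjOn (toFun a) (dom a)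
  cover : ∀ y, ∃ a, ∃ m ∈ dom a, toFun a m = y
  compat : ∀ a b, ∀ m ∈ dom a, ∀ m' ∈ dom b, toFun a m = toFun b m' →
    ∃ φ : M a → M b, ContMDiffAt 𝓘(ℝ, E) 𝓘(ℝ, E) ∞ φ m ∧ φ m = m' ∧
      ∀ᶠ x in 𝓝 m, toFun b (φ x) = toFun a x

namespace SmoothGluing

open Filter Topology

variable {E : Type*} [NormedAddCommGroup E] [NormedSpace ℝ E] {ι : Type*}
    {M : ι → Type*} [∀ a, TopologicalSpace (M a)] [∀ a, ChartedSpace E (M a)] {Y : Type*}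

/-- The topology for which the parametrizations are open embeddings. -/
abbrev topology (G : SmoothGluing E M Y) : TopologicalSpace Y where
  IsOpen V := ∀ a, IsOpen (G.dom a ∩ G.toFun a ⁻¹' V)
  isOpen_univ a := by simpa using G.isOpen_dom a
  isOpen_inter V W hV hW a := by
    have := (hV a).inter (hW a)
    rwa [← inter_inter_distrib_left, ← preimage_inter] at this
  isOpen_sUnion s hs a := by
    rw [preimage_sUnion, inter_iUnion₂]
    exact isOpen_biUnion fun V hV => hs V hV a

theorem continuousOn (G : SmoothGluing E M Y) (a : ι) :
    @ContinuousOn _ _ _ G.topology (G.toFun a) (G.dom a) := by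
  let _ := G.topology
  exact (continuousOn_open_iff (G.isOpen_dom a)).2 fun t ht => ht a

/-- The lift `φ` supplied by `compat` is continuous and sends the given point into `V`, so it sends
a whole neighbourhood there; this neighbourhood lies in the preimage of the image of `V`. -/
theorem isOpen_image (G : SmoothGluing E M Y) {a : ι} {V : Set (M a)} (hV : IsOpen V)
    (hVU : V ⊆ G.dom a) : IsOpen[G.topology] (G.toFun a '' V) := by
  intro b
  rw [isOpen_iff_mem_nhds]
  rintro m' ⟨hm', m, hm, hmm⟩
  obtain ⟨φ, hφ, hφm, hev⟩ := G.compat b a m' hm' m (hVU hm) hmm.symm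
  filter_upwards [hev, (G.isOpen_dom b).mem_nhds hm',
    hφ.continuousAt.preimage_mem_nhds (hV.mem_nhds (hφm ▸ hm))] with x hx hxd hxV
  exact ⟨hxd, φ x, hxV, hx⟩

/-- The parametrization as a partial homeomorphism. -/
noncomputable def param (G : SmoothGluing E M Y) (a : ι) (m : M a) :
    @OpenPartialHomeomorph (M a) Y _ G.topology :=
  let _ := G.topology
  have : Nonempty (M a) := ⟨m⟩
  OpenPartialHomeomorph.ofContinuousOpenRestrict ((G.injOn a).toPartialEquiv (G.toFun a) (G.dom a))
    (G.continuousOn a)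
    (by
      intro V hV
      obtain ⟨W, hW, rfl⟩ := isOpen_induced_iff.1 hV
      have := G.isOpen_image (a := a) (hW.inter (G.isOpen_dom a)) inter_subset_right
      convert this using 1
      ext y
      constructor
      · rintro ⟨x, hx, rfl⟩
        exact ⟨x, ⟨hx, x.2⟩, rfl⟩
      · rintro ⟨x, ⟨hx, hd⟩, rfl⟩
        exact ⟨⟨x, hd⟩, hx, rfl⟩)
    (G.isOpen_dom a)

theorem mem_param_chart_source (G : SmoothGluing E M Y) {a : ι} {m : M a} (hm : m ∈ G.dom a)
    {y : Y} (hy : G.toFun a m = y) :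
    let _ := G.topology
    y ∈ ((G.param a m).symm ≫ₕ chartAt E m).source := by
  intro _
  subst hy
  have hms : m ∈ (G.param a m).source := hm
  refine ⟨(G.param a m).map_source hms, ?_⟩
  have := (G.param a m).left_inv hms
  change (G.param a m).symm (G.param a m m) ∈ (chartAt E m).source
  rw [this]
  exact mem_chart_source E m

/-- The charted space structure given by the charts of the parametrizing manifolds. -/
noncomputable abbrev chartedSpace (G : SmoothGluing E M Y) :
    @ChartedSpace E _ Y G.topology :=
  let _ := G.topology
  { atlas := {e | ∃ a, ∃ m ∈ G.dom a, e = (G.param a m).symm ≫ₕ chartAt E m}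
    chartAt := fun y => (G.param (G.cover y).choose (G.cover y).choose_spec.choose).symm ≫ₕ
      chartAt E (G.cover y).choose_spec.choose
    mem_chart_source := fun y =>
      G.mem_param_chart_source (G.cover y).choose_spec.choose_spec.1
        (G.cover y).choose_spec.choose_spec.2
    chart_mem_atlas := fun y =>
      ⟨_, _, (G.cover y).choose_spec.choose_spec.1, rfl⟩ }

/-- By injectivity of the second parametrization, a transition map agrees near each point with the
smooth lift `φ` from `compat`, read in charts. -/
theorem isManifold (G : SmoothGluing E M Y) [∀ a, IsManifold 𝓘(ℝ, E) ∞ (M a)] :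
    @IsManifold _ _ _ _ _ _ _ 𝓘(ℝ, E) ∞ Y G.topology G.chartedSpace := by
  let _ := G.topology
  let _ := G.chartedSpace
  refine isManifold_of_contDiffOn 𝓘(ℝ, E) ∞ Y ?_
  rintro _ _ ⟨a, m, hm, rfl⟩ ⟨b, m', hm', rfl⟩
  simp only [modelWithCornersSelf_coe, modelWithCornersSelf_coe_symm, CompTriple.comp_eq,
    preimage_id_eq, id_eq, range_id, inter_univ]
  intro x hx
  simp only [OpenPartialHomeomorph.trans_source, OpenPartialHomeomorph.symm_source,
    OpenPartialHomeomorph.trans_symm_eq_symm_trans_symm, OpenPartialHomeomorph.symm_symm,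
    mem_inter_iff, mem_preimage, OpenPartialHomeomorph.coe_trans, Function.comp_apply] at hx
  obtain ⟨⟨hxt, hxd⟩, hxt', hxs'⟩ := hx
  refine ContDiffAt.contDiffWithinAt ?_
  set p := (chartAt E m).symm x with hp
  have hpq : G.toFun a p = G.toFun b ((G.param b m').symm (G.param a m p)) :=
    ((G.param b m').right_inv hxt').symm
  obtain ⟨φ, hφ, hφp, hev⟩ := G.compat a b p hxd _ ((G.param b m').map_target hxt') hpq
  have h1 : ContMDiffAt 𝓘(ℝ, E) 𝓘(ℝ, E) ∞ (chartAt E m).symm x :=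
    (contMDiffOn_chart_symm).contMDiffAt ((chartAt E m).open_target.mem_nhds hxt)
  have h2 : ContMDiffAt 𝓘(ℝ, E) 𝓘(ℝ, E) ∞ (chartAt E m') (φ p) :=
    contMDiffOn_chart.contMDiffAt ((chartAt E m').open_source.mem_nhds (hφp ▸ hxs'))
  have h3 := (ContMDiffAt.comp x (h2.comp p hφ) h1).contDiffAt
  refine h3.congr_of_eventuallyEq ?_
  have hφd : ∀ᶠ z in 𝓝 p, φ z ∈ G.dom b := hφ.continuousAt.preimage_mem_nhds
    ((G.isOpen_dom b).mem_nhds (hφp ▸ (G.param b m').map_target hxt'))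
  filter_upwards [h1.continuousAt.eventually hev, h1.continuousAt.eventually hφd] with z hz hzd
  simp only [Function.comp_apply, OpenPartialHomeomorph.coe_trans,
    OpenPartialHomeomorph.trans_symm_eq_symm_trans_symm, OpenPartialHomeomorph.symm_symm]
  congr 1
  have : G.param a m ((chartAt E m).symm z) = G.param b m' (φ ((chartAt E m).symm z)) := hz.symm
  rw [this, (G.param b m').left_inv hzd]
  rfl

theorem isLocalDiffeomorphAt (G : SmoothGluing E M Y) [∀ a, IsManifold 𝓘(ℝ, E) ∞ (M a)]
    {a : ι} {m : M a} (hm : m ∈ G.dom a) :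
    @IsLocalDiffeomorphAt _ _ _ _ _ _ _ _ _ _ _ _ 𝓘(ℝ, E) 𝓘(ℝ, E) _ _ _ _ G.topology G.chartedSpace
      ∞ (G.toFun a) m := by
  let _ := G.topology
  let _ := G.chartedSpace
  have := G.isManifold
  set e := (G.param a m).symm ≫ₕ chartAt E m with he
  have hmax : e ∈ IsManifold.maximalAtlas 𝓘(ℝ, E) ∞ Y :=
    IsManifold.subset_maximalAtlas ⟨a, m, hm, rfl⟩
  have hs : ∀ x ∈ G.dom a ∩ (chartAt E m).source, chartAt E m x ∈ e.target := by
    rintro x ⟨hx, hxc⟩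
    simp only [he, OpenPartialHomeomorph.trans_target, OpenPartialHomeomorph.symm_target]
    refine ⟨(chartAt E m).map_source hxc, ?_⟩
    rw [mem_preimage, (chartAt E m).left_inv hxc]
    exact hx
  let Φ := (G.param a m).restrOpen _ (chartAt E m).open_source
  refine ⟨{ Φ with
      contMDiffOn_toFun := ?_
      contMDiffOn_invFun := ?_ }, ⟨hm, mem_chart_source E m⟩, fun x _ => rfl⟩
  · have h1 : ContMDiffOn 𝓘(ℝ, E) 𝓘(ℝ, E) ∞ (e.symm ∘ chartAt E m)
        (G.dom a ∩ (chartAt E m).source) :=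
      (contMDiffOn_symm_of_mem_maximalAtlas hmax).comp (contMDiffOn_chart.mono inter_subset_right) hs
    refine h1.congr ?_
    rintro x ⟨hx, hxc⟩
    simp only [he, OpenPartialHomeomorph.trans_symm_eq_symm_trans_symm,
      OpenPartialHomeomorph.symm_symm, Function.comp_apply, OpenPartialHomeomorph.coe_trans]
    rw [(chartAt E m).left_inv hxc]
    rfl
  · have h1 : ContMDiffOn 𝓘(ℝ, E) 𝓘(ℝ, E) ∞ ((chartAt E m).symm ∘ e) e.source :=
      (contMDiffOn_chart_symm).comp (contMDiffOn_of_mem_maximalAtlas hmax)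
        fun y hy => (chartAt E m).map_source hy.2
    have ht : Φ.target ⊆ e.source := by
      intro y hy
      have := Φ.map_target hy
      have hy' : Φ (Φ.symm y) = y := Φ.right_inv hy
      rw [← hy']
      refine ⟨(G.param a m).map_source this.1, ?_⟩
      have h2 : (G.param a m).symm (Φ (Φ.symm y)) = Φ.symm y := (G.param a m).left_inv this.1
      change (G.param a m).symm (Φ (Φ.symm y)) ∈ (chartAt E m).source
      rw [h2]
      exact this.2
    refine (h1.mono ht).congr ?_
    intro y hy
    have : (G.param a m).symm y ∈ (chartAt E m).source := (ht hy).2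
    exact ((chartAt E m).left_inv this).symm

theorem map_nhds_eq (G : SmoothGluing E M Y) {a : ι} {m : M a} (hm : m ∈ G.dom a) :
    map (G.toFun a) (𝓝 m) = @nhds Y G.topology (G.toFun a m) :=
  let _ := G.topology
  (G.param a m).map_nhds_eq hm

/-- The glued space is Hausdorff if the gluing relations are closed. -/
theorem t2Space (G : SmoothGluing E M Y)
    (h : ∀ a b, ∀ m ∈ G.dom a, ∀ m' ∈ G.dom b,
      (∃ᶠ x in 𝓝 m ×ˢ 𝓝 m', x.1 ∈ G.dom a ∧ x.2 ∈ G.dom b ∧ G.toFun a x.1 = G.toFun b x.2) →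
      G.toFun a m = G.toFun b m') : @T2Space Y G.topology := by
  let _ := G.topology
  refine ⟨fun y y' hne => ?_⟩
  obtain ⟨a, m, hm, rfl⟩ := G.cover y
  obtain ⟨b, m', hm', rfl⟩ := G.cover y'
  have h1 := mt (h a b m hm m' hm') hne
  rw [not_frequently] at h1
  obtain ⟨s, hs, t, ht, hst⟩ := eventually_prod_iff.1 h1
  obtain ⟨V, hV, hVo, hmV⟩ := mem_nhds_iff.1 hs
  obtain ⟨W, hW, hWo, hmW⟩ := mem_nhds_iff.1 ht
  refine ⟨G.toFun a '' (V ∩ G.dom a), G.toFun b '' (W ∩ G.dom b),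
    G.isOpen_image (hVo.inter (G.isOpen_dom a)) inter_subset_right,
    G.isOpen_image (hWo.inter (G.isOpen_dom b)) inter_subset_right,
    ⟨m, ⟨hmV, hm⟩, rfl⟩, ⟨m', ⟨hmW, hm'⟩, rfl⟩, ?_⟩
  rw [Set.disjoint_left]
  rintro _ ⟨x, ⟨hxV, hxd⟩, rfl⟩ ⟨x', ⟨hxW, hxd'⟩, hxx⟩
  exact hst (hV hxV) (hW hxW) ⟨hxd, hxd', hxx.symm⟩

end SmoothGluing
/-! ### Local inverses of immersions -/

section LocalInverse

open Filter Topology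

variable {E V : Type*} [NormedAddCommGroup E] [NormedSpace ℝ E] [FiniteDimensional ℝ E]
  [NormedAddCommGroup V] [NormedSpace ℝ V] [FiniteDimensional ℝ V]

theorem ContDiffAt.exists_local_inverse {ψ : E → V} {x : E} (hψ : ContDiffAt ℝ ∞ ψ x)
    (hinj : Function.Injective (fderiv ℝ ψ x)) (hdim : Module.finrank ℝ E = Module.finrank ℝ V) :
    ∃ g : V → E, ContDiffAt ℝ ∞ g (ψ x) ∧ g (ψ x) = x ∧ (∀ᶠ y in 𝓝 (ψ x), ψ (g y) = y) ∧
      ∀ᶠ z in 𝓝 x, g (ψ z) = z := by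
  have : CompleteSpace E := FiniteDimensional.complete ℝ E
  let e : E ≃L[ℝ] V :=
    (LinearEquiv.ofInjectiveOfFinrankEq (fderiv ℝ ψ x).toLinearMap hinj hdim).toContinuousLinearEquiv
  have hd : HasFDerivAt ψ (e : E →L[ℝ] V) x :=
    (hψ.differentiableAt (by simp)).hasFDerivAt.congr_fderiv (by ext v; rfl)
  have hs : HasStrictFDerivAt ψ (e : E →L[ℝ] V) x := hψ.hasStrictFDerivAt' hd (by simp)
  exact ⟨hψ.localInverse hd (by simp), hψ.to_localInverse hd (by simp),
    hs.localInverse_apply_image, hs.eventually_right_inverse, hs.eventually_left_inverse⟩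

/-- Let `ℓ` be a left inverse of the derivative of `ψ`. Then `ℓ ∘ ψ` has a local inverse `k`, and
`(ℓ, F)` is locally injective on `V`, since the kernel of `dF` is exactly the image of `dψ`. On `F =
0` the points `ψ (k (ℓ y))` and `y` have the same image under `(ℓ, F)`, so `k ∘ ℓ` is the required
smooth inverse. -/
theorem ContDiffAt.exists_local_inverse_levelSet {ψ : E → V} {x : E} (hψ : ContDiffAt ℝ ∞ ψ x)
    (hinj : Function.Injective (fderiv ℝ ψ x))
    (hdim : Module.finrank ℝ E + 1 = Module.finrank ℝ V) {F : V → ℝ}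
    (hF : ContDiffAt ℝ ∞ F (ψ x)) (hF' : fderiv ℝ F (ψ x) ≠ 0) (hFψ : ∀ᶠ z in 𝓝 x, F (ψ z) = 0) :
    ∃ g : V → E, ContDiffAt ℝ ∞ g (ψ x) ∧ g (ψ x) = x ∧
      ∀ᶠ y in 𝓝 (ψ x), F y = 0 → ψ (g y) = y := by
  obtain ⟨l, hl⟩ := LinearMap.exists_leftInverse_of_injective (fderiv ℝ ψ x).toLinearMap
    (LinearMap.ker_eq_bot.2 hinj)
  set ℓ : V →L[ℝ] E := l.toContinuousLinearMap with hℓ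
  have hℓψ : ∀ a, ℓ (fderiv ℝ ψ x a) = a := fun a => LinearMap.congr_fun hl a
  have hψd := (hψ.differentiableAt (by simp)).hasFDerivAt
  have hFd := (hF.differentiableAt (by simp)).hasFDerivAt
  have hcomp : ∀ a, fderiv ℝ F (ψ x) (fderiv ℝ ψ x a) = 0 := by
    intro a
    have h1 : HasFDerivAt (fun z => F (ψ z)) _ x := hFd.comp x hψd
    have h2 : HasFDerivAt (fun z => F (ψ z)) (0 : E →L[ℝ] ℝ) x :=
      (hasFDerivAt_const (0 : ℝ) x).congr_of_eventuallyEq hFψ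
    exact congrArg (fun L : E →L[ℝ] ℝ => L a) (h1.unique h2)
  obtain ⟨v, hv⟩ : ∃ v, fderiv ℝ F (ψ x) v ≠ 0 := by
    by_contra! h
    exact hF' (ContinuousLinearMap.ext h)
  -- every vector is the sum of a tangent vector and a multiple of `v`
  have hspan : ∀ w, fderiv ℝ F (ψ x) w = 0 → ∃ a, fderiv ℝ ψ x a = w := by
    let T : E × ℝ →ₗ[ℝ] V := (fderiv ℝ ψ x).toLinearMap.coprod (LinearMap.toSpanSingleton ℝ V v)
    have hT : ∀ p, T p = fderiv ℝ ψ x p.1 + p.2 • v := fun p => rfl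
    have hTinj : Function.Injective T := by
      rw [injective_iff_map_eq_zero]
      rintro ⟨a, τ⟩ h
      rw [hT] at h
      have h1 := congrArg (fderiv ℝ F (ψ x)) h
      simp only [map_add, hcomp, map_smul, zero_add, map_zero, smul_eq_mul, mul_eq_zero, hv,
        or_false] at h1
      simp only [h1, zero_smul, add_zero] at h
      rw [Prod.mk_eq_zero]
      exact ⟨hinj (by rw [h, map_zero]), h1⟩
    have hTsurj : Function.Surjective T :=
      (LinearMap.injective_iff_surjective_of_finrank_eq_finrank (by simpa using hdim)).1 hTinj
    intro w hw
    obtain ⟨⟨a, τ⟩, rfl⟩ := hTsurj w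
    rw [hT] at hw ⊢
    simp only [map_add, hcomp, map_smul, zero_add, smul_eq_mul, mul_eq_zero, hv, or_false] at hw
    exact ⟨a, by simp [hw]⟩
  have hΦ : ContDiffAt ℝ ∞ (fun y => (ℓ y, F y)) (ψ x) := ℓ.contDiff.contDiffAt.prodMk hF
  have hΦd : fderiv ℝ (fun y => (ℓ y, F y)) (ψ x) = ℓ.prod (fderiv ℝ F (ψ x)) :=
    (ℓ.hasFDerivAt.prodMk hFd).fderiv
  obtain ⟨h, hh, -, -, hleft⟩ := hΦ.exists_local_inverse (by
    rw [hΦd, injective_iff_map_eq_zero]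
    intro w hw
    rw [ContinuousLinearMap.prod_apply, Prod.mk_eq_zero] at hw
    obtain ⟨a, rfl⟩ := hspan w hw.2
    rw [hℓψ] at hw
    simp [hw.1]) (by simpa using hdim.symm)
  have hℓψs : ContDiffAt ℝ ∞ (fun z => ℓ (ψ z)) x := ℓ.contDiff.contDiffAt.comp x hψ
  obtain ⟨k, hk, hkx, hkr, -⟩ := hℓψs.exists_local_inverse (by
    have : fderiv ℝ (fun z => ℓ (ψ z)) x = ℓ.comp (fderiv ℝ ψ x) :=
      (ℓ.hasFDerivAt.comp x hψd).fderiv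
    rw [this]
    intro a b hab
    simpa [hℓψ] using hab) rfl
  have hg : ContDiffAt ℝ ∞ (fun y => k (ℓ y)) (ψ x) := hk.comp (ψ x) ℓ.contDiff.contDiffAt
  refine ⟨fun y => k (ℓ y), hg, hkx, ?_⟩
  have hgt : Tendsto (fun y => k (ℓ y)) (𝓝 (ψ x)) (𝓝 x) := by
    have := hg.continuousAt
    rwa [ContinuousAt, hkx] at this
  have hψgt : Tendsto (fun y => ψ (k (ℓ y))) (𝓝 (ψ x)) (𝓝 (ψ x)) := hψ.continuousAt.tendsto.comp hgt
  filter_upwards [hleft, hψgt.eventually hleft, hgt.eventually hFψ,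
    (ℓ.continuous.tendsto (ψ x)).eventually hkr] with y h1 h2 h3 h4 hy
  rw [h3, h4] at h2
  rw [hy] at h1
  exact h2.symm.trans h1

variable {X : Type*} [TopologicalSpace X] [ChartedSpace E X] [IsManifold 𝓘(ℝ, E) ∞ X]

omit [FiniteDimensional ℝ E] [FiniteDimensional ℝ V] [IsManifold 𝓘(ℝ, E) ∞ X] in
theorem ContMDiffAt.contDiffAt_comp_extChartAt_symm {Ψ : X → V} {p : X}
    (hΨ : ContMDiffAt 𝓘(ℝ, E) 𝓘(ℝ, V) ∞ Ψ p) :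
    ContDiffAt ℝ ∞ (Ψ ∘ (extChartAt 𝓘(ℝ, E) p).symm) (extChartAt 𝓘(ℝ, E) p p) := by
  have h : ContDiffWithinAt ℝ ∞ (Ψ ∘ (extChartAt 𝓘(ℝ, E) p).symm) (range 𝓘(ℝ, E))
    (extChartAt 𝓘(ℝ, E) p p) := (contMDiffAt_iff.1 hΨ).2
  rwa [ModelWithCorners.range_eq_univ, contDiffWithinAt_univ] at h

omit [FiniteDimensional ℝ E] [FiniteDimensional ℝ V] [IsManifold 𝓘(ℝ, E) ∞ X] in
theorem ContMDiffAt.mfderiv_eq_fderiv_comp_extChartAt_symm {Ψ : X → V} {p : X}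
    (hΨ : ContMDiffAt 𝓘(ℝ, E) 𝓘(ℝ, V) ∞ Ψ p) :
    mfderiv 𝓘(ℝ, E) 𝓘(ℝ, V) Ψ p =
      fderiv ℝ (Ψ ∘ (extChartAt 𝓘(ℝ, E) p).symm) (extChartAt 𝓘(ℝ, E) p p) := by
  rw [(hΨ.mdifferentiableAt (by simp)).mfderiv]
  rw [ModelWithCorners.range_eq_univ, fderivWithin_univ]
  rfl

-- The predicate `C` lets one transfer to manifolds serve two cases: the trivial condition for equal
-- dimensions, and the equation `F y = 0` for hypersurfaces.
omit [FiniteDimensional ℝ E] [FiniteDimensional ℝ V] in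
theorem exists_contMDiffAt_of_comp_extChartAt_symm {Ψ : X → V} {p : X} {C : V → Prop}
    (h : ∃ g : V → E, ContDiffAt ℝ ∞ g (Ψ p) ∧ g (Ψ p) = extChartAt 𝓘(ℝ, E) p p ∧
      ∀ᶠ y in 𝓝 (Ψ p), C y → (Ψ ∘ (extChartAt 𝓘(ℝ, E) p).symm) (g y) = y) :
    ∃ g : V → X, ContMDiffAt 𝓘(ℝ, V) 𝓘(ℝ, E) ∞ g (Ψ p) ∧ g (Ψ p) = p ∧
      ∀ᶠ y in 𝓝 (Ψ p), C y → Ψ (g y) = y := by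
  obtain ⟨g, hg, hgp, hev⟩ := h
  refine ⟨(extChartAt 𝓘(ℝ, E) p).symm ∘ g, ?_, by simp [hgp], hev⟩
  refine ContMDiffAt.comp (Ψ p) ?_ hg.contMDiffAt
  rw [hgp]
  exact (contMDiffOn_extChartAt_symm p).contMDiffAt (extChartAt_target_mem_nhds p)

theorem ContMDiffAt.exists_local_inverse {Ψ : X → V} {p : X}
    (hΨ : ContMDiffAt 𝓘(ℝ, E) 𝓘(ℝ, V) ∞ Ψ p)
    (hinj : Function.Injective (mfderiv 𝓘(ℝ, E) 𝓘(ℝ, V) Ψ p))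
    (hdim : Module.finrank ℝ E = Module.finrank ℝ V) :
    ∃ g : V → X, ContMDiffAt 𝓘(ℝ, V) 𝓘(ℝ, E) ∞ g (Ψ p) ∧ g (Ψ p) = p ∧
      ∀ᶠ y in 𝓝 (Ψ p), Ψ (g y) = y := by
  rw [hΨ.mfderiv_eq_fderiv_comp_extChartAt_symm] at hinj
  have hp : (Ψ ∘ (extChartAt 𝓘(ℝ, E) p).symm) (extChartAt 𝓘(ℝ, E) p p) = Ψ p := by simp
  obtain ⟨g, h1, h2, h3, -⟩ := hΨ.contDiffAt_comp_extChartAt_symm.exists_local_inverse hinj hdim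
  rw [hp] at h1 h2 h3
  simpa using exists_contMDiffAt_of_comp_extChartAt_symm (C := fun _ => True)
    ⟨g, h1, h2, h3.mono fun y hy _ => hy⟩

theorem ContMDiffAt.exists_local_inverse_levelSet {Ψ : X → V} {p : X}
    (hΨ : ContMDiffAt 𝓘(ℝ, E) 𝓘(ℝ, V) ∞ Ψ p)
    (hinj : Function.Injective (mfderiv 𝓘(ℝ, E) 𝓘(ℝ, V) Ψ p))
    (hdim : Module.finrank ℝ E + 1 = Module.finrank ℝ V) {F : V → ℝ}
    (hF : ContDiffAt ℝ ∞ F (Ψ p)) (hF' : fderiv ℝ F (Ψ p) ≠ 0) (hFΨ : ∀ᶠ z in 𝓝 p, F (Ψ z) = 0) :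
    ∃ g : V → X, ContMDiffAt 𝓘(ℝ, V) 𝓘(ℝ, E) ∞ g (Ψ p) ∧ g (Ψ p) = p ∧
      ∀ᶠ y in 𝓝 (Ψ p), F y = 0 → Ψ (g y) = y := by
  rw [hΨ.mfderiv_eq_fderiv_comp_extChartAt_symm] at hinj
  have hp : (Ψ ∘ (extChartAt 𝓘(ℝ, E) p).symm) (extChartAt 𝓘(ℝ, E) p p) = Ψ p := by simp
  obtain ⟨g, h1, h2, h3⟩ := hΨ.contDiffAt_comp_extChartAt_symm.exists_local_inverse_levelSet
    hinj hdim (by rwa [hp]) (by rwa [hp]) (by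
      have hc : ContinuousAt (extChartAt 𝓘(ℝ, E) p).symm (extChartAt 𝓘(ℝ, E) p p) :=
        continuousAt_extChartAt_symm p
      rw [ContinuousAt, extChartAt_to_inv] at hc
      exact hc.eventually hFΨ)
  rw [hp] at h1 h2 h3
  exact exists_contMDiffAt_of_comp_extChartAt_symm ⟨g, h1, h2, h3⟩

end LocalInverse
/-! ### Continued fractions and the action of integral matrices on the torus -/

section Torus

open Matrix

/-- The monomial action of an integral matrix on the torus. -/
noncomputable def torusAct (N : Matrix (Fin 2) (Fin 2) ℤ) (x : Circle × Circle) : Circle × Circle :=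
  (x.1 ^ N 0 0 * x.2 ^ N 0 1, x.1 ^ N 1 0 * x.2 ^ N 1 1)

theorem torusAct_one (x : Circle × Circle) : torusAct 1 x = x := by
  simp [torusAct]

theorem torusAct_mul (N N' : Matrix (Fin 2) (Fin 2) ℤ) (x : Circle × Circle) :
    torusAct (N * N') x = torusAct N (torusAct N' x) := by
  simp only [torusAct, Matrix.mul_apply, Fin.sum_univ_two, mul_zpow, ← _root_.zpow_mul,
    _root_.zpow_add]
  ext1 <;> simp only [mul_comm, mul_left_comm, mul_assoc]

theorem contMDiff_zpow_circle (n : ℤ) : ContMDiff (𝓡 1) (𝓡 1) ∞ fun x : Circle => x ^ n := by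
  have : LieGroup (𝓡 1) ∞ Circle := inferInstance
  cases n with
  | ofNat n => simpa using contMDiff_pow (I := 𝓡 1) (n := ∞) (G := Circle) n
  | negSucc n =>
    simpa using (contMDiff_pow (I := 𝓡 1) (n := ∞) (G := Circle) (n + 1)).inv

theorem contMDiff_torusAct (N : Matrix (Fin 2) (Fin 2) ℤ) :
    ContMDiff ((𝓡 1).prod (𝓡 1)) ((𝓡 1).prod (𝓡 1)) ∞ (torusAct N) := by
  have : LieGroup (𝓡 1) ∞ Circle := inferInstance
  have h1 (n : ℤ) := (contMDiff_zpow_circle n).comp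
    (contMDiff_fst (I := 𝓡 1) (J := 𝓡 1) (M := Circle) (N := Circle) (n := ∞))
  have h2 (n : ℤ) := (contMDiff_zpow_circle n).comp
    (contMDiff_snd (I := 𝓡 1) (J := 𝓡 1) (M := Circle) (N := Circle) (n := ∞))
  exact ((h1 _).mul (h2 _)).prodMk ((h1 _).mul (h2 _))

/-- The matrix `(-c, 1; -1, 0)`, which acts on the projective line by `x ↦ c - 1/x`. -/
def cfMatrix (c : ℤ) : Matrix (Fin 2) (Fin 2) ℤ := !![-c, 1; -1, 0]

theorem det_prod_cfMatrix (l : List ℤ) : (l.map cfMatrix).prod.det = 1 := by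
  induction l with
  | nil => simp
  | cons c l ih => rw [List.map_cons, List.prod_cons, det_mul, ih]; simp [cfMatrix, det_fin_two_of]

/-- The first column `(p, q)` of the product represents the fraction `p/q`: multiplication by
`cfMatrix c` gives `(-c p + q, -p)`, of ratio `c - q/p`. The determinant `1` excludes `p = q = 0`.
-/
theorem negCF_eq_of_prod_cfMatrix (l : List ℤ) :
    (((l.map cfMatrix).prod 1 0 = 0 → negCF l = OnePoint.infty)) ∧
    ((l.map cfMatrix).prod 1 0 ≠ 0 →
      negCF l = OnePoint.some (((l.map cfMatrix).prod 0 0 : ℚ) / ((l.map cfMatrix).prod 1 0 : ℚ))) := by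
  induction l with
  | nil => simp [negCF]
  | cons c l ih =>
    set Q := (l.map cfMatrix).prod with hQ
    have h0 : (List.map cfMatrix (c :: l)).prod 0 0 = -c * Q 0 0 + Q 1 0 := by
      rw [List.map_cons, List.prod_cons, cfMatrix, ← hQ]
      simp [Matrix.mul_apply]
    have h1 : (List.map cfMatrix (c :: l)).prod 1 0 = -Q 0 0 := by
      rw [List.map_cons, List.prod_cons, cfMatrix, ← hQ]
      simp [Matrix.mul_apply]
    have hdet : Q 0 0 * Q 1 1 - Q 0 1 * Q 1 0 = 1 := by
      rw [← Matrix.det_fin_two]; exact det_prod_cfMatrix _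
    rw [h0, h1]
    by_cases hq : Q 1 0 = 0
    · have hp : Q 0 0 ≠ 0 := by
        intro hp
        rw [hq, hp] at hdet
        simp at hdet
      refine ⟨fun h => absurd (neg_eq_zero.1 h) hp, fun _ => ?_⟩
      have hp' : (Q 0 0 : ℚ) ≠ 0 := by exact_mod_cast hp
      have : negCF (c :: l) = OnePoint.some (c : ℚ) := by
        rw [negCF, ih.1 hq]; rfl
      rw [this, hq]
      congr 1
      push_cast
      field_simp
      ring
    · have hq' : (Q 1 0 : ℚ) ≠ 0 := by exact_mod_cast hq
      have hstep : negCF (c :: l) = if ((Q 0 0 : ℚ) / (Q 1 0 : ℚ)) = 0 then OnePoint.infty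
          else OnePoint.some ((c : ℚ) - 1 / ((Q 0 0 : ℚ) / (Q 1 0 : ℚ))) := by
        rw [negCF, ih.2 hq]; rfl
      rw [hstep]
      refine ⟨fun h => ?_, fun h => ?_⟩
      · rw [if_pos]
        rw [neg_eq_zero.1 h]; simp
      · have hp' : (Q 0 0 : ℚ) ≠ 0 := by
          intro h'
          exact h (by rw [neg_eq_zero]; exact_mod_cast h')
        rw [if_neg (div_ne_zero hp' hq')]
        congr 1
        push_cast
        field_simp
        ring

theorem prod_cfMatrix_of_negCF_eq_zero {l : List ℤ} (h : negCF l = ((0 : ℚ) : OnePoint ℚ)) :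
    (l.map cfMatrix).prod 0 0 = 0 := by
  obtain ⟨h1, h2⟩ := negCF_eq_of_prod_cfMatrix l
  by_cases hq : (l.map cfMatrix).prod 1 0 = 0
  · rw [h1 hq] at h
    exact absurd h (OnePoint.infty_ne_coe _)
  · rw [h2 hq] at h
    have hq' : ((l.map cfMatrix).prod 1 0 : ℚ) ≠ 0 := by exact_mod_cast hq
    have h3 := OnePoint.coe_injective h
    rw [div_eq_zero_iff, or_iff_left hq'] at h3
    exact_mod_cast h3

/-- The product of the matrices of the continued fraction of `a j, …, a (j + n - 1)`. -/
def cfProd {k : ℕ} (a : ZMod k → ℤ) (j : ZMod k) (n : ℕ) : Matrix (Fin 2) (Fin 2) ℤ :=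
  ((List.ofFn fun t : Fin n => a (j + ((t : ℕ) : ZMod k))).map cfMatrix).prod

theorem cfProd_succ {k : ℕ} (a : ZMod k → ℤ) (j : ZMod k) (n : ℕ) :
    cfProd a j (n + 1) = cfProd a j n * cfMatrix (a (j + n)) := by
  rw [cfProd, List.ofFn_succ', List.concat_eq_append, List.map_append, List.prod_append]
  simp [cfProd]

theorem cfProd_succ' {k : ℕ} (a : ZMod k → ℤ) (j : ZMod k) (n : ℕ) :
    cfProd a j (n + 1) = cfMatrix (a j) * cfProd a (j + 1) n := by
  simp [cfProd, List.ofFn_succ, add_comm, add_left_comm]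

/-- The two ways of splitting the full cyclic product, at its first and at its last factor, give the
relation `h1`. Its upper right entry, with the vanishing upper left entries, gives `Q 1 1 = a 0 * Q
0 1`, and the determinant gives `Q 0 1 = ±1`. -/
theorem cfProd_eq_inv_or_neg {k : ℕ} (a : ZMod k → ℤ)
    (hcf : ∀ i, cyclicCF k a i = ((0 : ℚ) : OnePoint ℚ)) :
    cfProd a 1 (k - 1) = !![0, -1; 1, -a 0] ∨
    cfProd a 1 (k - 1) = !![0, 1; -1, a 0] := by
  have h0 (j) : cfProd a j (k - 1) 0 0 = 0 := prod_cfMatrix_of_negCF_eq_zero (hcf j)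
  set Q := cfProd a 1 (k - 1) with hQ
  have h1 : cfMatrix (a 0) * Q = cfProd a 0 (k - 1) * cfMatrix (a (0 + ((k - 1 : ℕ) : ZMod k))) := by
    rw [← cfProd_succ, cfProd_succ', zero_add]
  have h2 : -a 0 * Q 0 1 + Q 1 1 = 0 := by
    have := congrArg (fun N : Matrix (Fin 2) (Fin 2) ℤ => N 0 1) h1
    simpa [cfMatrix, Matrix.mul_apply, h0] using this
  have hdet : Q 0 0 * Q 1 1 - Q 0 1 * Q 1 0 = 1 := by
    rw [← Matrix.det_fin_two]; exact det_prod_cfMatrix _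
  rw [show Q 0 0 = 0 from h0 1] at hdet
  have h3 : Q 0 1 * (-Q 1 0) = 1 := by linarith
  rcases Int.mul_eq_one_iff_eq_one_or_neg_one.1 h3 with ⟨h4, h5⟩ | ⟨h4, h5⟩
  · right
    rw [h4] at h2
    ext i j
    fin_cases i <;> fin_cases j
    · exact h0 1
    · exact h4
    · change Q 1 0 = -1; linarith
    · change Q 1 1 = a 0; linarith
  · left
    rw [h4] at h2
    ext i j
    fin_cases i <;> fin_cases j
    · exact h0 1
    · exact h4
    · change Q 1 0 = 1; linarith
    · change Q 1 1 = -a 0; linarith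

/-- The change of torus coordinates from `V_i` to `V_{i+1}`. -/
noncomputable def torusStep (c : ℤ) (b : Bool) (x : Circle × Circle) : Circle × Circle :=
  if b then (x.2, x.1⁻¹ * x.2 ^ c) else (x.2⁻¹, x.1 * x.2 ^ (-c))

/-- If all cyclic continued fractions vanish, then the torus bundle over the circle that is glued
from the `V_i` is trivial, after changing the sign of the gluing at `0` if necessary. -/
theorem exists_torus_transport {k : ℕ} (hk : 2 ≤ k) (a : ZMod k → ℤ)
    (hcf : ∀ i, cyclicCF k a i = ((0 : ℚ) : OnePoint ℚ)) :
    ∃ (flip : ZMod k → Bool) (N : ZMod k → Matrix (Fin 2) (Fin 2) ℤ),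
      (∀ i, i ≠ 0 → flip i = false) ∧
      (∀ i, (N i).det = 1) ∧
      ∀ i x, torusAct (N (i + 1)) (torusStep (a i) (flip i) x) = torusAct (N i) x := by
  have : NeZero k := ⟨by lia⟩
  have hstep (c : ℤ) (x) : torusStep c false x = torusAct !![0, -1; 1, -c] x := by
    simp [torusStep, torusAct]
  have hstep' (c : ℤ) (x) : torusStep c true x = torusAct !![0, 1; -1, c] x := by
    simp [torusStep, torusAct]
  -- The condition at `i ≠ 0` is the recursion `N (i + 1) = N i * cfMatrix (a i)`, because the
  -- matrix of `torusStep` is inverse to `cfMatrix`. Starting from `N 1 = 1` leaves the closing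
  -- condition at `0`.
  let N (i : ZMod k) := cfProd a 1 (i - 1).val
  have hN (i : ZMod k) (hi : i ≠ 0) (x) :
      torusAct (N (i + 1)) (torusStep (a i) false x) = torusAct (N i) x := by
    -- For `i ≠ 0` the representative of `i - 1` is below `k - 1`, so that adding `1` does not wrap
    -- around.
    have hv : (i + 1 - 1).val = (i - 1).val + 1 := by
      have hi' : i.val ≠ 0 := by rwa [Ne, ZMod.val_eq_zero]
      have h1 : (1 : ZMod k).val = 1 := by
        rw [ZMod.val_one_eq_one_mod, Nat.mod_eq_of_lt hk]
      rw [add_sub_cancel_right, ZMod.val_sub (by lia), h1]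
      lia
    have hc : (1 : ZMod k) + ((i - 1).val : ZMod k) = i := by
      rw [ZMod.natCast_zmod_val]; ring
    rw [hstep, ← torusAct_mul]
    congr 1
    simp only [N, hv, cfProd_succ, hc, cfMatrix]
    rw [Matrix.mul_assoc]
    have : !![-a i, 1; -1, 0] * !![0, -1; 1, -a i] = 1 := by
      ext s t
      fin_cases s <;> fin_cases t <;> simp
    rw [this, Matrix.mul_one]
  have h1 : N (0 + 1) = 1 := by simp [N, cfProd]
  have h0 : N 0 = cfProd a 1 (k - 1) := by
    have : ((0 : ZMod k) - 1).val = k - 1 := by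
      obtain ⟨n, rfl⟩ : ∃ n, k = n + 1 := ⟨k - 1, by lia⟩
      rw [zero_sub]
      exact ZMod.val_neg_one n
    simp only [N, this]
  -- At `0` the condition reads `N 0 =` matrix of the gluing at `0`. The two possible values of `N
  -- 0` differ by a sign, as do the straight and the flipped gluing matrices.
  rcases cfProd_eq_inv_or_neg a hcf with h | h
  · refine ⟨fun _ => false, N, fun _ _ => rfl, fun i => det_prod_cfMatrix _, fun i x => ?_⟩
    by_cases hi : i = 0
    · subst hi
      rw [h0, h, hstep, h1]
      exact torusAct_one _
    · exact hN i hi x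
  · refine ⟨fun i => decide (i = 0), N, fun i hi => by simp [hi], fun i => det_prod_cfMatrix _, fun i x => ?_⟩
    by_cases hi : i = 0
    · subst hi
      rw [h0, h, h1, ← hstep', torusAct_one]
      simp
    · simpa [hi] using hN i hi x

end Torus
/-! ### Change of model space -/

section Remodel

variable {H E' E M : Type*} [NormedAddCommGroup E'] [NormedSpace ℝ E'] [NormedAddCommGroup E]
  [NormedSpace ℝ E] [TopologicalSpace H] [TopologicalSpace M]

/-- A chart of `M`, as a chart of `ULift M` with values in the vector space `E`. -/
noncomputable def remodelChart (I : ModelWithCorners ℝ E' H) [I.Boundaryless] (L : E' ≃L[ℝ] E)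
    (c : OpenPartialHomeomorph M H) : OpenPartialHomeomorph (ULift.{u} M) E :=
  (Homeomorph.ulift.toOpenPartialHomeomorph ≫ₕ c) ≫ₕ
    (I.toHomeomorph.trans L.toHomeomorph).toOpenPartialHomeomorph

theorem remodelChart_apply (I : ModelWithCorners ℝ E' H) [I.Boundaryless] (L : E' ≃L[ℝ] E)
    (c : OpenPartialHomeomorph M H) (x : ULift.{u} M) :
    remodelChart I L c x = L (c.extend I x.down) := rfl

theorem remodelChart_symm_apply (I : ModelWithCorners ℝ E' H) [I.Boundaryless] (L : E' ≃L[ℝ] E)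
    (c : OpenPartialHomeomorph M H) (x : E) :
    (remodelChart.{u} I L c).symm x = ULift.up ((c.extend I).symm (L.symm x)) := rfl

theorem remodelChart_source (I : ModelWithCorners ℝ E' H) [I.Boundaryless] (L : E' ≃L[ℝ] E)
    (c : OpenPartialHomeomorph M H) :
    (remodelChart.{u} I L c).source = {x | x.down ∈ c.source} := by
  ext x
  simp [remodelChart]
  rfl

theorem remodelChart_target (I : ModelWithCorners ℝ E' H) [I.Boundaryless] (L : E' ≃L[ℝ] E)
    (c : OpenPartialHomeomorph M H) :
    (remodelChart.{u} I L c).target = {x | L.symm x ∈ (c.extend I).target} := by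
  ext x
  simp [remodelChart]
  exact fun _ => ⟨I.symm (L.symm x), I.right_inv (I.range_eq_univ ▸ mem_univ _)⟩

variable [ChartedSpace H M]

/-- The manifold `M` modelled on the vector space `E`. -/
noncomputable abbrev remodel (I : ModelWithCorners ℝ E' H) [I.Boundaryless] (L : E' ≃L[ℝ] E) :
    ChartedSpace E (ULift.{u} M) where
  atlas := {e | ∃ c ∈ atlas H M, e = remodelChart I L c}
  chartAt x := remodelChart I L (chartAt H x.down)
  mem_chart_source x := by
    rw [remodelChart_source]
    exact mem_chart_source H x.down
  chart_mem_atlas x := ⟨_, chart_mem_atlas H _, rfl⟩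

theorem isManifold_remodel (I : ModelWithCorners ℝ E' H) [I.Boundaryless] (L : E' ≃L[ℝ] E)
    [IsManifold I ∞ M] :
    @IsManifold _ _ _ _ _ _ _ 𝓘(ℝ, E) ∞ (ULift.{u} M) _ (remodel I L) := by
  let _ : ChartedSpace E (ULift.{u} M) := remodel I L
  refine isManifold_of_contDiffOn 𝓘(ℝ, E) ∞ _ ?_
  rintro _ _ ⟨c, hc, rfl⟩ ⟨c', hc', rfl⟩
  simp only [modelWithCornersSelf_coe, modelWithCornersSelf_coe_symm, CompTriple.comp_eq,
    preimage_id_eq, id_eq, range_id, inter_univ]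
  rw [← contMDiffOn_iff_contDiffOn]
  have h1 : ContMDiffOn 𝓘(ℝ, E') I ∞ (c.extend I).symm ((c.extend I).target) := by
    rw [OpenPartialHomeomorph.extend_target']
    exact contMDiffOn_extend_symm (IsManifold.subset_maximalAtlas hc)
  have h2 : ContMDiffOn I 𝓘(ℝ, E') ∞ (c'.extend I) c'.source :=
    c'.contMDiffOn_extend (IsManifold.subset_maximalAtlas hc')
  have h3 := L.contDiff.contMDiff.comp_contMDiffOn (h2.comp (h1.comp
    (L.symm.contDiff.contMDiff (n := ∞)).contMDiffOn
    (s := ((remodelChart.{u} I L c).symm ≫ₕ remodelChart I L c').source) ?_) ?_)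
  · exact h3
  · intro x hx
    have : x ∈ (remodelChart.{u} I L c).target := hx.1
    rw [remodelChart_target] at this
    exact this
  · intro x hx
    have := hx.2
    rw [mem_preimage, remodelChart_source] at this
    exact this

/-- Together with `contMDiff_remodel_up` this makes `ULift.up` a diffeomorphism, so that the core,
with its product model, can be glued to manifolds modelled on a single Euclidean space. -/
theorem contMDiff_remodel_down (I : ModelWithCorners ℝ E' H) [I.Boundaryless] (L : E' ≃L[ℝ] E)
    [IsManifold I ∞ M] :
    @ContMDiff _ _ _ _ _ _ _ 𝓘(ℝ, E) _ _ (remodel I L) _ _ _ _ _ I M _ _ ∞ ULift.down.{u} := by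
  let _ : ChartedSpace E (ULift.{u} M) := remodel I L
  have := isManifold_remodel.{u} (M := M) I L
  intro x
  set c := chartAt H x.down with hc
  have h1 : ContMDiffOn 𝓘(ℝ, E') I ∞ (c.extend I).symm ((c.extend I).target) := by
    rw [OpenPartialHomeomorph.extend_target']
    exact contMDiffOn_extend_symm (IsManifold.subset_maximalAtlas (chart_mem_atlas H _))
  have h2 : ContMDiffOn 𝓘(ℝ, E) 𝓘(ℝ, E) ∞ (remodelChart I L c) (remodelChart.{u} I L c).source :=
    contMDiffOn_of_mem_maximalAtlas (IsManifold.subset_maximalAtlas ⟨c, chart_mem_atlas H _, rfl⟩)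
  have h3 := h1.comp ((L.symm.contDiff.contMDiff (n := ∞)).comp_contMDiffOn h2) (by
    intro y hy
    have := (remodelChart.{u} I L c).map_source hy
    rw [remodelChart_target] at this
    exact this)
  refine (h3.contMDiffAt ((remodelChart.{u} I L c).open_source.mem_nhds ?_)).congr_of_eventuallyEq ?_
  · rw [remodelChart_source]; exact mem_chart_source H x.down
  · filter_upwards [(remodelChart.{u} I L c).open_source.mem_nhds
      (by rw [remodelChart_source]; exact mem_chart_source H x.down)] with y hy
    rw [remodelChart_source] at hy
    simp only [Function.comp_apply, remodelChart_apply, ContinuousLinearEquiv.symm_apply_apply]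
    rw [OpenPartialHomeomorph.extend_left_inv _ hy]

theorem contMDiff_remodel_up (I : ModelWithCorners ℝ E' H) [I.Boundaryless] (L : E' ≃L[ℝ] E)
    [IsManifold I ∞ M] :
    @ContMDiff _ _ _ _ _ _ _ I M _ _ _ _ _ _ _ 𝓘(ℝ, E) _ _ (remodel I L) ∞ ULift.up.{u} := by
  let _ : ChartedSpace E (ULift.{u} M) := remodel I L
  have := isManifold_remodel.{u} (M := M) I L
  intro x
  set c := chartAt H x with hc
  have h1 : ContMDiffOn I 𝓘(ℝ, E') ∞ (c.extend I) c.source :=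
    c.contMDiffOn_extend (IsManifold.subset_maximalAtlas (chart_mem_atlas H _))
  have h2 : ContMDiffOn 𝓘(ℝ, E) 𝓘(ℝ, E) ∞ (remodelChart I L c).symm
      (remodelChart.{u} I L c).target :=
    contMDiffOn_symm_of_mem_maximalAtlas
      (IsManifold.subset_maximalAtlas ⟨c, chart_mem_atlas H _, rfl⟩)
  have h3 := h2.comp ((L.contDiff.contMDiff (n := ∞)).comp_contMDiffOn h1) (by
    intro y hy
    have hy' : ULift.up.{u} y ∈ (remodelChart.{u} I L c).source := by
      rw [remodelChart_source]; exact hy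
    exact (remodelChart.{u} I L c).map_source hy')
  refine (h3.contMDiffAt (c.open_source.mem_nhds (mem_chart_source H x))).congr_of_eventuallyEq ?_
  filter_upwards [c.open_source.mem_nhds (mem_chart_source H x)] with y hy
  simp only [Function.comp_apply, remodelChart_symm_apply, ContinuousLinearEquiv.symm_apply_apply]
  rw [OpenPartialHomeomorph.extend_left_inv _ hy]

end Remodel
/-! ### The surface of genus `g` is a compact regular level set -/

section GenusSurface

open Filter Topology

/-- The defining function of `genusSurface g`. -/
noncomputable def genusFun (g : ℕ) (u : ℝ × ℂ) : ℝ :=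
  ((3 * (g : ℝ) + 10) ^ 2 - u.1 ^ 2 - u.2.re ^ 2) *
      ∏ j ∈ Finset.range g, ((u.1 - 3 * ((j : ℝ) + 1)) ^ 2 + u.2.re ^ 2 - 1) - u.2.im ^ 2

theorem mem_genusSurface_iff {g : ℕ} {u : ℝ × ℂ} : u ∈ genusSurface g ↔ genusFun g u = 0 := by
  rw [genusSurface, mem_ofPred_eq, genusFun, sub_eq_zero, eq_comm]

theorem contDiff_genusFun (g : ℕ) : ContDiff ℝ ∞ (genusFun g) := by
  have hre : ContDiff ℝ ∞ fun u : ℝ × ℂ => u.2.re := Complex.reCLM.contDiff.comp contDiff_snd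
  have him : ContDiff ℝ ∞ fun u : ℝ × ℂ => u.2.im := Complex.imCLM.contDiff.comp contDiff_snd
  refine (ContDiff.mul ?_ (contDiff_prod fun j _ => ?_)).sub (him.pow 2)
  · exact (contDiff_const.sub (contDiff_fst.pow 2)).sub (hre.pow 2)
  · exact (((contDiff_fst.sub contDiff_const).pow 2).add (hre.pow 2)).sub contDiff_const

/-- The hole around `c = 3(j+1) ≤ 3g` lies within distance `c + 1` of the origin, hence strictly
inside the disc of radius `3g + 10`. -/
theorem hole_pos_of_radius_le {g : ℕ} {x y : ℝ} (h : (3 * (g : ℝ) + 10) ^ 2 ≤ x ^ 2 + y ^ 2)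
    {j : ℕ} (hj : j < g) : 0 < (x - 3 * ((j : ℝ) + 1)) ^ 2 + y ^ 2 - 1 := by
  by_contra! hle
  have hj' : (j : ℝ) + 1 ≤ g := by exact_mod_cast hj
  have hj0 : (0 : ℝ) ≤ j := j.cast_nonneg
  set c := 3 * ((j : ℝ) + 1) with hc
  have h1 : x - c ≤ 1 := by nlinarith [sq_nonneg y]
  nlinarith

/-- Where `z ≠ 0` the derivative in the `z`-direction is `-2z`. Where `z = 0` exactly one factor of
the product vanishes, since the holes and the outer circle are disjoint, and this factor has nonzero
derivative in the direction away from its centre. -/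
theorem fderiv_genusFun_ne_zero {g : ℕ} {u : ℝ × ℂ} (hu : u ∈ genusSurface g) :
    fderiv ℝ (genusFun g) u ≠ 0 := by
  obtain ⟨x, w⟩ := u
  -- it suffices to find a line along which the derivative does not vanish
  suffices h : ∃ (v : ℝ × ℂ) (c : ℝ), c ≠ 0 ∧
      HasDerivAt (fun t : ℝ => genusFun g ((x, w) + t • v)) c 0 by
    obtain ⟨v, c, hc, hd⟩ := h
    intro h0
    have h1 : HasFDerivAt (genusFun g) (0 : ℝ × ℂ →L[ℝ] ℝ) ((x, w) + (0 : ℝ) • v) := by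
      rw [zero_smul, add_zero, ← h0]
      exact ((contDiff_genusFun g).differentiable (by simp) _).hasFDerivAt
    have h2 : HasDerivAt (fun t : ℝ => (x, w) + t • v) ((1 : ℝ) • v) 0 :=
      ((hasDerivAt_id (0 : ℝ)).smul_const v).const_add _
    have h3 : HasDerivAt (fun t : ℝ => genusFun g ((x, w) + t • v)) 0 0 := by
      simpa [Function.comp_def] using h1.comp_hasDerivAt (0 : ℝ) h2
    exact hc (hd.unique h3)
  have hre (t : ℝ) (v : ℝ × ℂ) : ((x, w) + t • v).2.re = w.re + t * v.2.re := by simp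
  have him (t : ℝ) (v : ℝ × ℂ) : ((x, w) + t • v).2.im = w.im + t * v.2.im := by simp
  have hx (t : ℝ) (v : ℝ × ℂ) : ((x, w) + t • v).1 = x + t * v.1 := by simp
  have hu' : genusFun g (x, w) = 0 := mem_genusSurface_iff.1 hu
  by_cases hz : w.im = 0
  · -- a vanishing factor `f` and the product `h` of the others
    have key (f h : ℝ × ℂ → ℝ) (hfh : ∀ u, genusFun g u = f u * h u - u.2.im ^ 2)
        (hh : ContDiff ℝ ∞ h) (v : ℝ × ℂ) (hv : v.2.im = 0) (c : ℝ) (hc : c ≠ 0)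
        (hf0 : f (x, w) = 0) (hf : HasDerivAt (fun t : ℝ => f ((x, w) + t • v)) c 0)
        (hh0 : h (x, w) ≠ 0) : ∃ (v : ℝ × ℂ) (c : ℝ), c ≠ 0 ∧
          HasDerivAt (fun t : ℝ => genusFun g ((x, w) + t • v)) c 0 := by
      have hl : ContDiff ℝ ∞ fun t : ℝ => h ((x, w) + t • v) :=
        hh.comp (contDiff_const.add (contDiff_id.smul contDiff_const))
      have hd := (hl.differentiable (by simp) 0).hasDerivAt
      refine ⟨v, c * h (x, w), mul_ne_zero hc hh0, ?_⟩
      refine ((hf.mul hd).congr_of_eventuallyEq (.of_forall fun t => ?_)).congr_deriv ?_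
      · rw [hfh, him, hz, hv]
        simp
      · simp [hf0]
    rw [genusFun] at hu'
    simp only [hz, ne_eq, OfNat.ofNat_ne_zero, not_false_eq_true, zero_pow, sub_zero] at hu'
    have hsmooth (s : Finset ℕ) : ContDiff ℝ ∞ fun u : ℝ × ℂ =>
        ∏ j ∈ s, ((u.1 - 3 * ((j : ℝ) + 1)) ^ 2 + u.2.re ^ 2 - 1) := by
      have hre : ContDiff ℝ ∞ fun u : ℝ × ℂ => u.2.re := Complex.reCLM.contDiff.comp contDiff_snd
      exact contDiff_prod fun j _ =>
        (((contDiff_fst.sub contDiff_const).pow 2).add (hre.pow 2)).sub contDiff_const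
    have hquad : ContDiff ℝ ∞ fun u : ℝ × ℂ => (3 * (g : ℝ) + 10) ^ 2 - u.1 ^ 2 - u.2.re ^ 2 := by
      have hre : ContDiff ℝ ∞ fun u : ℝ × ℂ => u.2.re := Complex.reCLM.contDiff.comp contDiff_snd
      exact (contDiff_const.sub (contDiff_fst.pow 2)).sub (hre.pow 2)
    have hlin (p q : ℝ) : HasDerivAt (fun t : ℝ => p + t * q) q 0 := by
      simpa using ((hasDerivAt_id (0 : ℝ)).mul_const q).const_add p
    rcases mul_eq_zero.1 hu' with hQ | hP
    -- On the outer circle: the radial direction from the origin, along which the quadratic factor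
    -- has derivative `-2R²`.
    · refine key (fun u => (3 * (g : ℝ) + 10) ^ 2 - u.1 ^ 2 - u.2.re ^ 2)
        (fun u => ∏ j ∈ Finset.range g, ((u.1 - 3 * ((j : ℝ) + 1)) ^ 2 + u.2.re ^ 2 - 1))
        (fun u => rfl) (hsmooth _) (x, (w.re : ℂ)) (by simp) (-2 * (3 * (g : ℝ) + 10) ^ 2)
        (by have : (0 : ℝ) ≤ g := g.cast_nonneg
            have : (3 * (g : ℝ) + 10) ^ 2 > 0 := by positivity
            linarith) hQ ?_ ?_
      · have := (((hlin x x).pow 2).const_sub ((3 * (g : ℝ) + 10) ^ 2)).sub ((hlin w.re w.re).pow 2)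
        refine (this.congr_of_eventuallyEq (.of_forall fun t => ?_)).congr_deriv ?_
        · simp
        · push_cast
          linear_combination 2 * hQ
      · refine Finset.prod_ne_zero_iff.2 fun j hj => (hole_pos_of_radius_le ?_
          (Finset.mem_range.1 hj)).ne'
        dsimp at hQ ⊢
        linarith
    · obtain ⟨i, hi, hi0⟩ := Finset.prod_eq_zero_iff.1 hP
      -- On the boundary of the hole `i`: the radial direction from its centre, along which the
      -- factor has derivative `2`, the radius being `1`.
      refine key (fun u => (u.1 - 3 * ((i : ℝ) + 1)) ^ 2 + u.2.re ^ 2 - 1)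
        (fun u => ((3 * (g : ℝ) + 10) ^ 2 - u.1 ^ 2 - u.2.re ^ 2) *
          ∏ j ∈ (Finset.range g).erase i, ((u.1 - 3 * ((j : ℝ) + 1)) ^ 2 + u.2.re ^ 2 - 1))
        (fun u => ?_) (hquad.mul (hsmooth _)) (x - 3 * ((i : ℝ) + 1), (w.re : ℂ)) (by simp) 2
        two_ne_zero hi0 ?_ ?_
      · rw [genusFun, ← Finset.mul_prod_erase _ _ hi]
        ring
      · have := ((((hlin x (x - 3 * ((i : ℝ) + 1))).sub_const (3 * ((i : ℝ) + 1))).pow 2).add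
          ((hlin w.re w.re).pow 2)).sub_const 1
        refine (this.congr_of_eventuallyEq (.of_forall fun t => ?_)).congr_deriv ?_
        · simp
        · push_cast
          linear_combination 2 * hi0
      · refine mul_ne_zero (fun hQ => ?_) (Finset.prod_ne_zero_iff.2 fun j hj hj0 => ?_)
        · refine (hole_pos_of_radius_le (x := x) (y := w.re) ?_ (Finset.mem_range.1 hi)).ne' hi0
          dsimp at hQ
          linarith
        -- A common point of two boundary circles would have `x` halfway between their centres, at
        -- distance `(3/2)|j - i|` from both, which exceeds the radius `1`.
        · have hij : j ≠ i := Finset.ne_of_mem_erase hj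
          dsimp at hi0 hj0
          have h1 : ((j : ℝ) - i) * (2 * x - 3 * (j + 1) - 3 * (i + 1)) = 0 := by
            linear_combination (1 / 3) * hi0 - (1 / 3) * hj0
          have h2 : ((j : ℝ) - i) ≠ 0 := sub_ne_zero.2 (by exact_mod_cast hij)
          have h3 := (mul_eq_zero.1 h1).resolve_left h2
          have h4 : ((j : ℝ) - i) ^ 2 ≤ 4 / 9 := by
            have : x = 3 / 2 * (j + 1) + 3 / 2 * (i + 1) := by linarith
            rw [this] at hi0
            nlinarith [sq_nonneg w.re]
          have h5 : (1 : ℤ) ≤ ((j : ℤ) - i) ^ 2 := by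
            have : ((j : ℤ) - i) ≠ 0 := sub_ne_zero.2 (by exact_mod_cast hij)
            have := pow_pos (abs_pos.2 this) 2
            rw [sq_abs] at this
            lia
          have h6 : (1 : ℝ) ≤ ((j : ℝ) - i) ^ 2 := by exact_mod_cast h5
          linarith
  · refine ⟨(0, Complex.I), -(2 * w.im), by simpa using hz, ?_⟩
    have h1 : HasDerivAt (fun t : ℝ => w.im + t) 1 0 := by
      simpa using (hasDerivAt_id (0 : ℝ)).const_add w.im
    have := (h1.pow 2).const_sub (((3 * (g : ℝ) + 10) ^ 2 - x ^ 2 - w.re ^ 2) *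
      ∏ j ∈ Finset.range g, ((x - 3 * ((j : ℝ) + 1)) ^ 2 + w.re ^ 2 - 1))
    refine (this.congr_of_eventuallyEq (.of_forall fun t => ?_)).congr_deriv ?_
    · simp only [genusFun, hre, him, hx]
      simp
    · simp

theorem reflect_mem_openPunctured {g : ℕ} {u : ℝ × ℂ} (hu : u ∈ openPunctured g) :
    reflect u ∈ openPunctured g := by
  simpa [openPunctured, genusSurface, reflect] using hu

theorem isClosed_genusSurface (g : ℕ) : IsClosed (genusSurface g) := by
  have : genusSurface g = genusFun g ⁻¹' {0} := by ext u; exact mem_genusSurface_iff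
  rw [this]
  exact isClosed_singleton.preimage (contDiff_genusFun g).continuous

/-- Outside the disc of radius `R` the right-hand side of the equation is negative, and so cannot be
a square. Over the enclosing box it is bounded, and this bounds `z`. -/
theorem isCompact_genusSurface (g : ℕ) : IsCompact (genusSurface g) := by
  set R : ℝ := 3 * (g : ℝ) + 10 with hR
  have hR0 : 0 ≤ R := by positivity
  let h (q : ℝ × ℝ) : ℝ := (R ^ 2 - q.1 ^ 2 - q.2 ^ 2) *
      ∏ j ∈ Finset.range g, ((q.1 - 3 * ((j : ℝ) + 1)) ^ 2 + q.2 ^ 2 - 1)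
  have hc : Continuous h := by fun_prop
  obtain ⟨C, hC⟩ := (isCompact_Icc (a := -R) (b := R)).prod (isCompact_Icc (a := -R) (b := R))
    |>.exists_bound_of_continuousOn hc.continuousOn
  have hsub : genusSurface g ⊆ Metric.closedBall 0 (R + (R + (C + 1))) := by
    rintro ⟨x, w⟩ hu
    have hu' : w.im ^ 2 = h (x, w.re) := hu
    have hxy : x ^ 2 + w.re ^ 2 ≤ R ^ 2 := by
      by_contra! hlt
      have hpos : 0 < ∏ j ∈ Finset.range g, ((x - 3 * ((j : ℝ) + 1)) ^ 2 + w.re ^ 2 - 1) :=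
        Finset.prod_pos fun j hj => hole_pos_of_radius_le hlt.le (Finset.mem_range.1 hj)
      have : h (x, w.re) < 0 := mul_neg_of_neg_of_pos (by dsimp; linarith) hpos
      nlinarith [sq_nonneg w.im]
    have hx : |x| ≤ R := abs_le_of_sq_le_sq (by nlinarith [sq_nonneg w.re]) hR0
    have hy : |w.re| ≤ R := abs_le_of_sq_le_sq (by nlinarith [sq_nonneg x]) hR0
    have hz := hC (x, w.re) ⟨abs_le.1 hx, abs_le.1 hy⟩
    rw [← hu', Real.norm_eq_abs, abs_of_nonneg (sq_nonneg _)] at hz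
    have hC0 : 0 ≤ C := (sq_nonneg _).trans hz
    have him : |w.im| ≤ C + 1 := abs_le_of_sq_le_sq (by nlinarith) (by linarith)
    rw [mem_closedBall_zero_iff, Prod.norm_def, Real.norm_eq_abs]
    refine max_le (by linarith) ((Complex.norm_le_abs_re_add_abs_im w).trans ?_)
    linarith
  exact (isCompact_closedBall _ _).of_isClosed_subset (isClosed_genusSurface g) hsub

/-- The surface of genus `g` with a coordinate disc of radius `r` removed is compact. -/
theorem isCompact_genusSurface_diff (g : ℕ) (r : ℝ) :
    IsCompact {u | u ∈ genusSurface g ∧ ¬ (u.1 < 0 ∧ ‖u.2‖ < r)} := by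
  refine (isCompact_genusSurface g).inter_right (isClosed_compl_iff.2 ?_)
  exact (isOpen_lt continuous_fst continuous_const).inter
    (isOpen_lt continuous_snd.norm continuous_const)

end GenusSurface

/-! ### Compactness of preimages -/

open Filter Topology in
-- By injectivity on `D` the inverse of `Ψ` on `C` coincides near each point with the continuous
-- `g`. The set is therefore a continuous image of `C`.
theorem isCompact_inter_preimage_of_exists_inverse {X V : Type*} [TopologicalSpace X]
    [TopologicalSpace V] {Ψ : X → V} {D : Set X} (hinj : InjOn Ψ D) {C : Set V} (hC : IsCompact C)
    (hCD : C ⊆ Ψ '' D)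
    (h : ∀ q ∈ D, Ψ q ∈ C → ∃ g : V → X, ContinuousAt g (Ψ q) ∧
      ∀ᶠ y in 𝓝 (Ψ q), y ∈ C → g y ∈ D ∧ Ψ (g y) = y) :
    IsCompact {p | p ∈ D ∧ Ψ p ∈ C} := by
  rcases C.eq_empty_or_nonempty with rfl | ⟨y₀, hy₀⟩
  · simp
  have : Nonempty X := ⟨(hCD hy₀).choose⟩
  have hinv (y) (hy : y ∈ C) : Function.invFunOn Ψ D y ∈ D ∧ Ψ (Function.invFunOn Ψ D y) = y :=
    ⟨Function.invFunOn_mem (hCD hy), Function.invFunOn_eq (hCD hy)⟩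
  have hcont : ContinuousOn (Function.invFunOn Ψ D) C := by
    intro y hy
    obtain ⟨hq, hqy⟩ := hinv y hy
    obtain ⟨g, hg, hev⟩ := h _ hq (hqy.symm ▸ hy)
    rw [hqy] at hg hev
    have heq (z) (hz : z ∈ C) (hgz : g z ∈ D ∧ Ψ (g z) = z) : Function.invFunOn Ψ D z = g z :=
      hinj (hinv z hz).1 hgz.1 ((hinv z hz).2.trans hgz.2.symm)
    refine hg.continuousWithinAt.congr_of_eventuallyEq ?_ (heq y hy (hev.self_of_nhds hy))
    filter_upwards [nhdsWithin_le_nhds hev, self_mem_nhdsWithin] with z hz hzC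
    exact heq z hzC (hz hzC)
  have := hC.image_of_continuousOn hcont
  convert this using 1
  ext p
  constructor
  · rintro ⟨hp, hpC⟩
    exact ⟨Ψ p, hpC, hinj (hinv _ hpC).1 hp (hinv _ hpC).2⟩
  · rintro ⟨y, hy, rfl⟩
    exact ⟨(hinv y hy).1, (hinv y hy).2.symm ▸ hy⟩
/-! ### Tubular neighbourhoods -/

namespace TubeOverPunctured

open Filter Topology

variable {X : Type*} [TopologicalSpace X] [ChartedSpace (EuclideanSpace ℝ (Fin 4)) X]
  {g : ℕ} {e : ℤ} {U : Set X} {b f : X → ℂ}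

/-- The trivialization of the tubular neighbourhood. -/
def emb (τ : TubeOverPunctured X g e U b f) (p : X) : (ℝ × ℂ) × ℂ := (τ.base p, τ.fib p)

theorem emb_mem (τ : TubeOverPunctured X g e U b f) {p : X} (hp : p ∈ τ.dom) :
    τ.base p ∈ openPunctured g ∧ ‖τ.fib p‖ < 3 :=
  τ.image_eq.subset (mem_image_of_mem _ hp)

theorem exists_mem (τ : TubeOverPunctured X g e U b f) {u : ℝ × ℂ} {z : ℂ}
    (hu : u ∈ openPunctured g) (hz : ‖z‖ < 3) : ∃ p ∈ τ.dom, τ.base p = u ∧ τ.fib p = z := by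
  obtain ⟨p, hp, h⟩ := τ.image_eq.superset (show (u, z) ∈ _ from ⟨hu, hz⟩)
  exact ⟨p, hp, congrArg Prod.fst h, congrArg Prod.snd h⟩

theorem contMDiffAt_emb (τ : TubeOverPunctured X g e U b f) {p : X} (hp : p ∈ τ.dom) :
    ContMDiffAt (𝓡 4) 𝓘(ℝ, (ℝ × ℂ) × ℂ) ∞ τ.emb p :=
  τ.smooth.contMDiffAt (τ.isOpen_dom.mem_nhds hp)

theorem continuousOn_fib (τ : TubeOverPunctured X g e U b f) : ContinuousOn τ.fib τ.dom :=
  continuous_snd.comp_continuousOn τ.smooth.continuousOn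

/-- The trivialization maps a `4`-manifold into a hypersurface of a `5`-dimensional space.
Regularity of the genus surface allows the level set version of the inverse function theorem. -/
theorem exists_inverse [IsManifold (𝓡 4) ∞ X] (τ : TubeOverPunctured X g e U b f) {q : X}
    (hq : q ∈ τ.dom) :
    ∃ G : (ℝ × ℂ) × ℂ → X, ContMDiffAt 𝓘(ℝ, (ℝ × ℂ) × ℂ) (𝓡 4) ∞ G (τ.emb q) ∧ G (τ.emb q) = q ∧
      ∀ᶠ y in 𝓝 (τ.emb q), y.1 ∈ genusSurface g → G y ∈ τ.dom ∧ τ.emb (G y) = y := by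
  have hF : ContDiff ℝ ∞ fun y : (ℝ × ℂ) × ℂ => genusFun g y.1 :=
    (contDiff_genusFun g).comp contDiff_fst
  have hF' : fderiv ℝ (fun y : (ℝ × ℂ) × ℂ => genusFun g y.1) (τ.emb q) ≠ 0 := by
    have hd : HasFDerivAt (genusFun g) (fderiv ℝ (genusFun g) (τ.emb q).1) (τ.emb q).1 :=
      ((contDiff_genusFun g).differentiable (by simp) _).hasFDerivAt
    have h1 : fderiv ℝ (fun y : (ℝ × ℂ) × ℂ => genusFun g y.1) (τ.emb q) =
      (fderiv ℝ (genusFun g) (τ.emb q).1).comp (ContinuousLinearMap.fst ℝ (ℝ × ℂ) ℂ) :=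
      (hd.comp (τ.emb q) hasFDerivAt_fst).fderiv
    rw [h1]
    intro h0
    refine fderiv_genusFun_ne_zero (τ.emb_mem hq).1.1 (ContinuousLinearMap.ext fun v => ?_)
    exact congrArg (fun T : (ℝ × ℂ) × ℂ →L[ℝ] ℝ => T (v, 0)) h0
  obtain ⟨G, hG, hGq, hev⟩ := (τ.contMDiffAt_emb hq).exists_local_inverse_levelSet
    (τ.immersive q hq) (by simp [Complex.finrank_real_complex]) hF.contDiffAt hF' (by
      filter_upwards [τ.isOpen_dom.mem_nhds hq] with z hz
      exact mem_genusSurface_iff.1 (τ.emb_mem hz).1.1)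
  refine ⟨G, hG, hGq, ?_⟩
  filter_upwards [hev, hG.continuousAt.preimage_mem_nhds
    (τ.isOpen_dom.mem_nhds (hGq.symm ▸ hq))] with y hy hyd hyg
  exact ⟨hyd, hy (mem_genusSurface_iff.1 hyg)⟩

/-- The conditions `r > 1` and `‖z‖ < 3` keep the compact set inside the image of the
trivialization, which is not closed. -/
theorem isCompact_preimage [IsManifold (𝓡 4) ∞ X] (τ : TubeOverPunctured X g e U b f)
    {r : ℝ} (hr : 1 < r) {Z : Set ℂ} (hZ : IsCompact Z) (hZ3 : ∀ z ∈ Z, ‖z‖ < 3) :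
    IsCompact {p | p ∈ τ.dom ∧ ¬ ((τ.base p).1 < 0 ∧ ‖(τ.base p).2‖ < r) ∧ τ.fib p ∈ Z} := by
  have hC := (isCompact_genusSurface_diff g r).prod hZ
  have := isCompact_inter_preimage_of_exists_inverse (Ψ := τ.emb) (D := τ.dom) τ.injOn hC ?_ ?_
  · convert this using 1
    ext p
    exact ⟨fun h => ⟨h.1, ⟨(τ.emb_mem h.1).1.1, h.2.1⟩, h.2.2⟩, fun h => ⟨h.1, h.2.1.2, h.2.2⟩⟩
  · rintro ⟨u, z⟩ ⟨hu, hz⟩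
    exact τ.image_eq.superset
      ⟨⟨hu.1, fun h => hu.2 ⟨h.1, h.2.trans_lt hr⟩⟩, hZ3 z hz⟩
  · intro q hq _
    obtain ⟨G, hG, -, hev⟩ := τ.exists_inverse hq
    exact ⟨G, hG.continuousAt, hev.mono fun y hy hyC => hy hyC.1.1⟩

theorem norm_eq (τ : TubeOverPunctured X g e U b f) {p : X} (hp : p ∈ τ.dom) (hpU : p ∈ U) :
    ‖f p‖ = ‖τ.fib p‖ := by
  have hb : (‖b p‖ : ℂ) ≠ 0 := by
    have := (τ.mem_dom_iff p hpU).1 hp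
    exact_mod_cast (by linarith : ‖b p‖ ≠ 0)
  rw [τ.clutching p ⟨hp, hpU⟩, norm_mul, norm_zpow, norm_div, Complex.norm_real, norm_norm, div_self
    (by exact_mod_cast hb), one_zpow, one_mul]

/-- The closed tubular neighbourhood of radius `r < 3`. -/
theorem isClosed_tube [IsManifold (𝓡 4) ∞ X] [T2Space X] (τ : TubeOverPunctured X g e U b f) {r : ℝ}
    (hr : r < 3) (hU : IsCompact {p | p ∈ U ∧ ‖b p‖ ≤ 2 ∧ ‖f p‖ ≤ r}) :
    IsClosed ({p | p ∈ τ.dom ∧ ‖τ.fib p‖ ≤ r} ∪ {p | p ∈ U ∧ ‖f p‖ ≤ r}) := by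
  -- The tube splits at the circle of radius `2` into two compact parts, one over the punctured
  -- surface and one in the chart.
  have h1 := τ.isCompact_preimage (r := 2) one_lt_two (isCompact_closedBall (0 : ℂ) r)
    fun z hz => (mem_closedBall_zero_iff.1 hz).trans_lt hr
  convert (h1.isClosed.union hU.isClosed) using 1
  ext p
  simp only [mem_union, mem_ofPred_eq, mem_closedBall_zero_iff]
  constructor
  · rintro (⟨hp, hf⟩ | ⟨hp, hf⟩)
    · by_cases hb : (τ.base p).1 < 0 ∧ ‖(τ.base p).2‖ < 2
      · have hpU := (τ.mem_chart_iff p hp).2 ⟨hb.1, by linarith [hb.2]⟩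
        refine Or.inr ⟨hpU, ?_, (τ.norm_eq hp hpU).trans_le hf⟩
        rw [← τ.base_eq p ⟨hp, hpU⟩]
        exact hb.2.le
      · exact Or.inl ⟨hp, hb, hf⟩
    · by_cases hb : ‖b p‖ ≤ 2
      · exact Or.inr ⟨hp, hb, hf⟩
      · have hpd := (τ.mem_dom_iff p hp).2 (by linarith)
        refine Or.inl ⟨hpd, ?_, (τ.norm_eq hpd hp).symm.trans_le hf⟩
        rw [τ.base_eq p ⟨hpd, hp⟩]
        exact fun h => hb h.2.le
  · rintro (⟨hp, -, hf⟩ | ⟨hp, -, hf⟩)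
    · exact Or.inl ⟨hp, hf⟩
    · exact Or.inr ⟨hp, hf⟩

theorem isOpen_tube (τ : TubeOverPunctured X g e U b f) (hU : IsOpen U) (hf : ContinuousOn f U)
    (r : ℝ) : IsOpen ({p | p ∈ τ.dom ∧ ‖τ.fib p‖ < r} ∪ {p | p ∈ U ∧ ‖f p‖ < r}) :=
  (τ.continuousOn_fib.norm.isOpen_inter_preimage τ.isOpen_dom isOpen_Iio).union
    (hf.norm.isOpen_inter_preimage hU isOpen_Iio)

end TubeOverPunctured

/-! ### Charts at the intersection points and thickened pieces. -/

namespace SurfacePair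

open Filter Topology

variable {X : Type*} [TopologicalSpace X] [ChartedSpace (EuclideanSpace ℝ (Fin 4)) X]
  {S T : Set X} {g h : ℕ} {m n : ℤ}

/-- The chart at the intersection point. -/
def coord (P : SurfacePair X S T g h m n) (p : X) : ℂ × ℂ := (P.w₁ p, P.w₂ p)

theorem coord_mem (P : SurfacePair X S T g h m n) {p : X} (hp : p ∈ P.chart) :
    ‖P.w₁ p‖ < 3 ∧ ‖P.w₂ p‖ < 3 :=
  P.image_eq.subset (mem_image_of_mem _ hp)

theorem exists_coord_eq (P : SurfacePair X S T g h m n) {w : ℂ × ℂ} (h1 : ‖w.1‖ < 3)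
    (h2 : ‖w.2‖ < 3) : ∃ p ∈ P.chart, P.coord p = w :=
  P.image_eq.superset ⟨h1, h2⟩

theorem contMDiffAt_coord (P : SurfacePair X S T g h m n) {p : X} (hp : p ∈ P.chart) :
    ContMDiffAt (𝓡 4) 𝓘(ℝ, ℂ × ℂ) ∞ P.coord p :=
  P.smooth.contMDiffAt (P.isOpen_chart.mem_nhds hp)

theorem continuousOn_w₁ (P : SurfacePair X S T g h m n) : ContinuousOn P.w₁ P.chart :=
  continuous_fst.comp_continuousOn P.smooth.continuousOn

theorem continuousOn_w₂ (P : SurfacePair X S T g h m n) : ContinuousOn P.w₂ P.chart :=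
  continuous_snd.comp_continuousOn P.smooth.continuousOn

theorem exists_inverse [IsManifold (𝓡 4) ∞ X] (P : SurfacePair X S T g h m n) {q : X}
    (hq : q ∈ P.chart) :
    ∃ G : ℂ × ℂ → X, ContMDiffAt 𝓘(ℝ, ℂ × ℂ) (𝓡 4) ∞ G (P.coord q) ∧ G (P.coord q) = q ∧
      ∀ᶠ y in 𝓝 (P.coord q), G y ∈ P.chart ∧ P.coord (G y) = y := by
  obtain ⟨G, hG, hGq, hev⟩ := (P.contMDiffAt_coord hq).exists_local_inverse (P.immersive q hq)
    (by simp [Complex.finrank_real_complex])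
  refine ⟨G, hG, hGq, ?_⟩
  filter_upwards [hev, hG.continuousAt.preimage_mem_nhds
    (P.isOpen_chart.mem_nhds (hGq.symm ▸ hq))] with y hy hyd
  exact ⟨hyd, hy⟩

theorem isCompact_preimage [IsManifold (𝓡 4) ∞ X] (P : SurfacePair X S T g h m n)
    {C : Set (ℂ × ℂ)} (hC : IsCompact C) (hC3 : ∀ w ∈ C, ‖w.1‖ < 3 ∧ ‖w.2‖ < 3) :
    IsCompact {p | p ∈ P.chart ∧ P.coord p ∈ C} := by
  refine isCompact_inter_preimage_of_exists_inverse (Ψ := P.coord) P.injOn hC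
    (fun w hw => P.image_eq.superset (hC3 w hw)) ?_
  intro q hq _
  obtain ⟨G, hG, -, hev⟩ := P.exists_inverse hq
  exact ⟨G, hG.continuousAt, hev.mono fun y hy _ => hy⟩

theorem isCompact_bidisc [IsManifold (𝓡 4) ∞ X] (P : SurfacePair X S T g h m n) {r s : ℝ}
    (hr : r < 3) (hs : s < 3) : IsCompact {p | p ∈ P.chart ∧ ‖P.w₁ p‖ ≤ r ∧ ‖P.w₂ p‖ ≤ s} := by
  have := P.isCompact_preimage ((isCompact_closedBall (0 : ℂ) r).prod (isCompact_closedBall (0 : ℂ) s))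
    fun w hw => ⟨(mem_closedBall_zero_iff.1 hw.1).trans_lt hr,
      (mem_closedBall_zero_iff.1 hw.2).trans_lt hs⟩
  convert this using 1
  ext p
  simp [coord]

/-- An open neighbourhood of the piece. -/
def thick (P : SurfacePair X S T g h m n) : Set X :=
  -- The constants `4/5` and `5/4` are reciprocal, because gluing inverts the fibre radius: glued
  -- points have fibre radii between them. Moreover `(5/4)² < 2`, so the removed bidisc lies inside
  -- the ball.
  (({p | p ∈ P.tubeS.dom ∧ ‖P.tubeS.fib p‖ ≤ 4 / 5} ∪ {p | p ∈ P.chart ∧ ‖P.w₂ p‖ ≤ 4 / 5}) ∪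
    ({p | p ∈ P.tubeT.dom ∧ ‖P.tubeT.fib p‖ ≤ 4 / 5} ∪ {p | p ∈ P.chart ∧ ‖P.w₁ p‖ ≤ 4 / 5}) ∪
    {p | p ∈ P.chart ∧ ‖P.w₁ p‖ ≤ 5 / 4 ∧ ‖P.w₂ p‖ ≤ 5 / 4})ᶜ

theorem isOpen_thick [IsManifold (𝓡 4) ∞ X] [T2Space X] (P : SurfacePair X S T g h m n) :
    IsOpen P.thick := by
  refine IsClosed.isOpen_compl (self := ((P.tubeS.isClosed_tube (by norm_num) ?_).union
    (P.tubeT.isClosed_tube (by norm_num) ?_)).union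
    (P.isCompact_bidisc (by norm_num) (by norm_num)).isClosed)
  · exact P.isCompact_bidisc (by norm_num) (by norm_num)
  · convert P.isCompact_bidisc (r := 4 / 5) (s := 2) (by norm_num) (by norm_num) using 1
    ext p
    simp only [mem_ofPred_eq, and_comm]

theorem isOpen_ball (P : SurfacePair X S T g h m n) : IsOpen P.ball := by
  have h1 : ContinuousOn (fun p => Real.posLog ‖P.w₁ p‖ ^ 2 + Real.posLog ‖P.w₂ p‖ ^ 2) P.chart :=
    ((Real.continuous_posLog.comp_continuousOn P.continuousOn_w₁.norm).pow 2).add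
      ((Real.continuous_posLog.comp_continuousOn P.continuousOn_w₂.norm).pow 2)
  exact h1.isOpen_inter_preimage P.isOpen_chart isOpen_Iio

theorem isClosed_piece (P : SurfacePair X S T g h m n) : IsClosed P.piece :=
  ((P.isOpen_ball.union (P.tubeS.isOpen_tube P.isOpen_chart P.continuousOn_w₂ 1)).union
    (P.tubeT.isOpen_tube P.isOpen_chart P.continuousOn_w₁ 1)).isClosed_compl

/-- Since `(5/4)² < 2`, both logarithms are at most half of `log 2`. -/
theorem posLog_sq_add_lt {a b : ℝ} (ha : 0 ≤ a) (hb : 0 ≤ b) (ha' : a ≤ 5 / 4) (hb' : b ≤ 5 / 4) :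
    Real.posLog a ^ 2 + Real.posLog b ^ 2 < Real.log 2 ^ 2 := by
  have h2 : 0 < Real.log 2 := Real.log_pos one_lt_two
  have h54 : Real.log (5 / 4) < Real.log 2 / 2 := by
    have : Real.log ((5 / 4) ^ 2) < Real.log 2 := Real.log_lt_log (by norm_num) (by norm_num)
    rw [Real.log_pow] at this
    push_cast at this
    linarith
  have h0 : Real.posLog (5 / 4) = Real.log (5 / 4) :=
    Real.posLog_eq_log (by rw [abs_of_pos] <;> norm_num)
  have h1 : Real.posLog a ≤ Real.log 2 / 2 :=
    ((Real.posLog_le_posLog ha ha').trans_eq h0).trans h54.le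
  have h3 : Real.posLog b ≤ Real.log 2 / 2 :=
    ((Real.posLog_le_posLog hb hb').trans_eq h0).trans h54.le
  have h4 : 0 ≤ Real.posLog a := Real.posLog_nonneg
  have h5 : 0 ≤ Real.posLog b := Real.posLog_nonneg
  nlinarith

theorem piece_subset_thick (P : SurfacePair X S T g h m n) : P.piece ⊆ P.thick := by
  refine compl_subset_compl.2 ?_
  rintro p (((⟨hp, hf⟩ | ⟨hp, hf⟩) | (⟨hp, hf⟩ | ⟨hp, hf⟩)) | ⟨hp, h1, h2⟩)
  · exact Or.inl (Or.inr (Or.inl ⟨hp, by linarith⟩))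
  · exact Or.inl (Or.inr (Or.inr ⟨hp, by linarith⟩))
  · exact Or.inr (Or.inl ⟨hp, by linarith⟩)
  · exact Or.inr (Or.inr ⟨hp, by linarith⟩)
  · exact Or.inl (Or.inl ⟨hp, posLog_sq_add_lt (norm_nonneg _) (norm_nonneg _) h1 h2⟩)

theorem norm_w₂_eq (P : SurfacePair X S T g h m n) {p : X} (hp : p ∈ P.tubeS.dom)
    (hc : p ∈ P.chart) : ‖P.w₂ p‖ = ‖P.tubeS.fib p‖ := P.tubeS.norm_eq hp hc

theorem norm_w₁_eq (P : SurfacePair X S T g h m n) {p : X} (hp : p ∈ P.tubeT.dom)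
    (hc : p ∈ P.chart) : ‖P.w₁ p‖ = ‖P.tubeT.fib p‖ := P.tubeT.norm_eq hp hc

theorem mem_thick_iff (P : SurfacePair X S T g h m n) {p : X} (hp : p ∈ P.chart) :
    p ∈ P.thick ↔ 4 / 5 < ‖P.w₁ p‖ ∧ 4 / 5 < ‖P.w₂ p‖ ∧ (5 / 4 < ‖P.w₁ p‖ ∨ 5 / 4 < ‖P.w₂ p‖) := by
  have h1 : p ∈ P.tubeS.dom → ‖P.w₂ p‖ = ‖P.tubeS.fib p‖ := fun h => P.norm_w₂_eq h hp
  have h2 : p ∈ P.tubeT.dom → ‖P.w₁ p‖ = ‖P.tubeT.fib p‖ := fun h => P.norm_w₁_eq h hp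
  simp only [thick, mem_compl_iff, mem_union, mem_ofPred_eq, hp, true_and]
  by_cases hS : p ∈ P.tubeS.dom <;> by_cases hT : p ∈ P.tubeT.dom <;>
    simp only [hS, hT, ← h1, ← h2, true_and, false_and, false_or, or_self, not_or, not_le,
      not_and_or] <;> tauto

theorem mem_piece_iff (P : SurfacePair X S T g h m n) {p : X} (hp : p ∈ P.chart) :
    p ∈ P.piece ↔ 1 ≤ ‖P.w₁ p‖ ∧ 1 ≤ ‖P.w₂ p‖ ∧
      Real.log 2 ^ 2 ≤ Real.log ‖P.w₁ p‖ ^ 2 + Real.log ‖P.w₂ p‖ ^ 2 := by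
  have h1 : p ∈ P.tubeS.dom → ‖P.w₂ p‖ = ‖P.tubeS.fib p‖ := fun h => P.norm_w₂_eq h hp
  have h2 : p ∈ P.tubeT.dom → ‖P.w₁ p‖ = ‖P.tubeT.fib p‖ := fun h => P.norm_w₁_eq h hp
  have h3 : 1 ≤ ‖P.w₁ p‖ → Real.posLog ‖P.w₁ p‖ = Real.log ‖P.w₁ p‖ := fun h =>
    Real.posLog_eq_log (by rwa [abs_norm])
  have h4 : 1 ≤ ‖P.w₂ p‖ → Real.posLog ‖P.w₂ p‖ = Real.log ‖P.w₂ p‖ := fun h =>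
    Real.posLog_eq_log (by rwa [abs_norm])
  have h5 : p ∈ P.piece ↔ 1 ≤ ‖P.w₁ p‖ ∧ 1 ≤ ‖P.w₂ p‖ ∧
      Real.log 2 ^ 2 ≤ Real.posLog ‖P.w₁ p‖ ^ 2 + Real.posLog ‖P.w₂ p‖ ^ 2 := by
    simp only [piece, ball, nbhdS, nbhdT, mem_compl_iff, mem_union, mem_ofPred_eq, hp, true_and]
    by_cases hS : p ∈ P.tubeS.dom <;> by_cases hT : p ∈ P.tubeT.dom <;>
      simp only [hS, hT, ← h1, ← h2, true_and, false_and, false_or, or_self, not_or, not_lt] <;>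
      tauto
  rw [h5]
  constructor
  · rintro ⟨ha, hb, hc⟩
    exact ⟨ha, hb, by rwa [← h3 ha, ← h4 hb]⟩
  · rintro ⟨ha, hb, hc⟩
    exact ⟨ha, hb, by rwa [h3 ha, h4 hb]⟩

theorem fibS_of_mem_thick (P : SurfacePair X S T g h m n) {p : X} (hp : p ∈ P.thick)
    (hd : p ∈ P.tubeS.dom) : 4 / 5 < ‖P.tubeS.fib p‖ := by
  by_contra! hle
  exact hp (Or.inl (Or.inl (Or.inl ⟨hd, hle⟩)))

theorem fibT_of_mem_thick (P : SurfacePair X S T g h m n) {p : X} (hp : p ∈ P.thick)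
    (hd : p ∈ P.tubeT.dom) : 4 / 5 < ‖P.tubeT.fib p‖ := by
  by_contra! hle
  exact hp (Or.inl (Or.inr (Or.inl ⟨hd, hle⟩)))

theorem fibS_of_mem_piece (P : SurfacePair X S T g h m n) {p : X} (hp : p ∈ P.piece)
    (hd : p ∈ P.tubeS.dom) : 1 ≤ ‖P.tubeS.fib p‖ := by
  by_contra! hle
  exact hp (Or.inl (Or.inr (Or.inl ⟨hd, hle⟩)))

theorem fibT_of_mem_piece (P : SurfacePair X S T g h m n) {p : X} (hp : p ∈ P.piece)
    (hd : p ∈ P.tubeT.dom) : 1 ≤ ‖P.tubeT.fib p‖ := by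
  by_contra! hle
  exact hp (Or.inr (Or.inl ⟨hd, hle⟩))

/-- Outside the chart, the piece is the complement of the two tubes. -/
theorem mem_piece_of_notMem_chart (P : SurfacePair X S T g h m n) {p : X} (hp : p ∉ P.chart)
    (hS : p ∈ P.tubeS.dom → 1 ≤ ‖P.tubeS.fib p‖) (hT : p ∈ P.tubeT.dom → 1 ≤ ‖P.tubeT.fib p‖) :
    p ∈ P.piece := by
  rintro ((⟨h, -⟩ | (⟨h, h'⟩ | ⟨h, -⟩)) | (⟨h, h'⟩ | ⟨h, -⟩))
  · exact hp h
  · exact absurd h' (hS h).not_gt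
  · exact hp h
  · exact absurd h' (hT h).not_gt
  · exact hp h

end SurfacePair
/-! ### Coordinates near the core -/

section Core

open Filter Topology

/-- The angular part of a complex number. -/
noncomputable def unitPart (z : ℂ) : Circle := Circle.exp z.arg

theorem norm_mul_unitPart (z : ℂ) : (‖z‖ : ℂ) * unitPart z = z := by
  rw [unitPart, Circle.coe_exp, Complex.norm_mul_exp_arg_mul_I]

theorem unitPart_ofReal_mul {r : ℝ} (hr : 0 < r) (x : Circle) : unitPart (x * r) = x := by
  rw [unitPart, mul_comm, Complex.arg_real_mul _ hr, Circle.exp_arg]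

theorem unitPart_mul {z w : ℂ} (hz : z ≠ 0) (hw : w ≠ 0) :
    unitPart (z * w) = unitPart z * unitPart w := by
  have h1 : z * w = ((unitPart z * unitPart w : Circle) : ℂ) * ((‖z‖ * ‖w‖ : ℝ) : ℂ) := by
    conv_lhs => rw [← norm_mul_unitPart z, ← norm_mul_unitPart w]
    push_cast
    ring
  rw [h1, unitPart_ofReal_mul (mul_pos (norm_pos_iff.2 hz) (norm_pos_iff.2 hw))]

theorem eq_of_norm_eq_of_unitPart_eq {z w : ℂ} (h : ‖z‖ = ‖w‖) (h' : unitPart z = unitPart w) :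
    z = w := by
  rw [← norm_mul_unitPart z, ← norm_mul_unitPart w, h, h']

/-- Replacing `w` by `w / z` moves the base point to `1`, away from the branch cut; the angular part
at `z` is then restored as a constant. -/
theorem contMDiffAt_unitPart {z : ℂ} (hz : z ≠ 0) :
    ContMDiffAt 𝓘(ℝ, ℂ) (𝓡 1) ∞ unitPart z := by
  have h1 : unitPart =ᶠ[𝓝 z] fun w => Circle.exp ((Complex.log (w / z)).im + z.arg) := by
    filter_upwards [isOpen_ne.mem_nhds hz] with w hw
    rw [Circle.exp_add, Complex.log_im]
    change unitPart w = unitPart (w / z) * unitPart z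
    rw [← unitPart_mul (div_ne_zero hw hz) hz, div_mul_cancel₀ w hz]
  refine ContMDiffAt.congr_of_eventuallyEq ?_ h1
  have h2 : ContDiffAt ℝ ∞ (fun w : ℂ => (Complex.log (w / z)).im + z.arg) z := by
    refine ContDiffAt.add ?_ contDiffAt_const
    have h3 : ContDiffAt ℂ ∞ (fun w : ℂ => Complex.log (w / z)) z := by
      refine (Complex.contDiffAt_log (x := z / z) ?_).comp (f := fun w => w / z) z
        (contDiffAt_id.div_const z)
      simp [hz]
    exact Complex.imCLM.contDiff.contDiffAt.comp z (h3.restrict_scalars ℝ)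
  exact contMDiff_circleExp.contMDiffAt.comp z h2.contMDiffAt

/-- The normalizing factor for logarithmic coordinates. -/
noncomputable def levelConst : ℝ := √2 * Real.log 2

theorem levelConst_pos : 0 < levelConst :=
  mul_pos (by positivity) (Real.log_pos one_lt_two)

theorem levelConst_sq : levelConst ^ 2 = 2 * Real.log 2 ^ 2 := by
  rw [levelConst, mul_pow, Real.sq_sqrt zero_le_two]

/-- Logarithmic coordinates, rotated by an angle of `-π/4` and normalized. -/
noncomputable def level (w : ℂ × ℂ) : ℂ :=
  ⟨(Real.log ‖w.1‖ + Real.log ‖w.2‖) / levelConst, (Real.log ‖w.2‖ - Real.log ‖w.1‖) / levelConst⟩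

/-- The square of the distance to the origin in logarithmic coordinates, normalized. -/
noncomputable def radSq (w : ℂ × ℂ) : ℝ :=
  (Real.log ‖w.1‖ ^ 2 + Real.log ‖w.2‖ ^ 2) / Real.log 2 ^ 2

theorem norm_level_sq (w : ℂ × ℂ) : ‖level w‖ ^ 2 = radSq w := by
  have h2 := (Real.log_pos one_lt_two).ne'
  rw [← Complex.normSq_eq_norm_sq, Complex.normSq_apply, level, radSq]
  dsimp only
  rw [div_mul_div_comm, div_mul_div_comm, ← add_div, ← sq levelConst, levelConst_sq]
  field_simp
  ring

/-- The real part is positive exactly when `|w₁||w₂| > 1`, and `(4/5)·(5/4) = 1`. -/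
theorem level_re_pos {w : ℂ × ℂ} (h1 : 4 / 5 < ‖w.1‖) (h2 : 4 / 5 < ‖w.2‖)
    (h3 : 5 / 4 < ‖w.1‖ ∨ 5 / 4 < ‖w.2‖) : 0 < (level w).re := by
  refine div_pos ?_ levelConst_pos
  rw [← Real.log_mul (by linarith) (by linarith)]
  refine Real.log_pos ?_
  rcases h3 with h3 | h3 <;> nlinarith

theorem radSq_pos {w : ℂ × ℂ} (hw : 0 < (level w).re) : 0 < radSq w := by
  have : level w ≠ 0 := fun h => by simp [h] at hw
  rw [← norm_level_sq]
  positivity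

/-- The map from a neighbourhood of `V_i` to the core. -/
noncomputable def coreMap (N : Matrix (Fin 2) (Fin 2) ℤ) (θ : Circle) (l : ℝ) (w : ℂ × ℂ) :
    (Circle × Circle) × ℂ :=
  -- The second component is `θ` times the principal power of `level w` with exponent `l`. For `l =
  -- 4/k` the quadrant, of angle `π/2`, becomes a sector of angle `2π/k` centred at `θ`.
  (torusAct N (unitPart w.1, unitPart w.2), θ * Complex.exp (l * Complex.log (level w)))

/-- The local inverse of `coreMap`. -/
noncomputable def coreInv (N : Matrix (Fin 2) (Fin 2) ℤ) (θ : Circle) (l : ℝ)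
    (y : (Circle × Circle) × ℂ) : ℂ × ℂ :=
  ((torusAct N.adjugate y.1).1 * ((Real.exp (levelConst *
      ((Complex.exp ((l⁻¹ : ℝ) * Complex.log (y.2 / θ))).re -
        (Complex.exp ((l⁻¹ : ℝ) * Complex.log (y.2 / θ))).im) / 2) : ℝ) : ℂ),
    (torusAct N.adjugate y.1).2 * ((Real.exp (levelConst *
      ((Complex.exp ((l⁻¹ : ℝ) * Complex.log (y.2 / θ))).re +
        (Complex.exp ((l⁻¹ : ℝ) * Complex.log (y.2 / θ))).im) / 2) : ℝ) : ℂ))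

theorem norm_coreMap (N : Matrix (Fin 2) (Fin 2) ℤ) (θ : Circle) (l : ℝ) (w : ℂ × ℂ) :
    ‖(coreMap N θ l w).2‖ = Real.exp (l / 2 * Real.log (radSq w)) := by
  rw [coreMap, norm_mul, Circle.norm_coe, one_mul, Complex.norm_exp, Complex.re_ofReal_mul,
    Complex.log_re, ← norm_level_sq, Real.log_pow]
  congr 1
  push_cast
  ring

theorem norm_coreMap_lt_iff {N : Matrix (Fin 2) (Fin 2) ℤ} {θ : Circle} {l : ℝ} (hl : 0 < l)
    {w : ℂ × ℂ} (hw : 0 < (level w).re) {a : ℝ} (ha : 0 < a) :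
    ‖(coreMap N θ l w).2‖ < Real.exp (l / 2 * Real.log a) ↔ radSq w < a := by
  rw [norm_coreMap N θ l w, Real.exp_lt_exp, mul_lt_mul_iff_right₀ (by linarith),
    Real.log_lt_log_iff (radSq_pos hw) ha]

theorem norm_coreMap_le_iff {N : Matrix (Fin 2) (Fin 2) ℤ} {θ : Circle} {l : ℝ} (hl : 0 < l)
    {w : ℂ × ℂ} (hw : 0 < (level w).re) {a : ℝ} (ha : 0 < a) :
    ‖(coreMap N θ l w).2‖ ≤ Real.exp (l / 2 * Real.log a) ↔ radSq w ≤ a := by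
  rw [norm_coreMap N θ l w, Real.exp_le_exp, mul_le_mul_iff_right₀ (by linarith),
    Real.log_le_log_iff (radSq_pos hw) ha]

theorem norm_coreMap_lt_one_iff {N : Matrix (Fin 2) (Fin 2) ℤ} {θ : Circle} {l : ℝ} (hl : 0 < l)
    {w : ℂ × ℂ} (hw : 0 < (level w).re) : ‖(coreMap N θ l w).2‖ < 1 ↔ radSq w < 1 := by
  simpa using norm_coreMap_lt_iff (N := N) (θ := θ) hl hw one_pos

theorem norm_coreMap_le_one_iff {N : Matrix (Fin 2) (Fin 2) ℤ} {θ : Circle} {l : ℝ} (hl : 0 < l)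
    {w : ℂ × ℂ} (hw : 0 < (level w).re) : ‖(coreMap N θ l w).2‖ ≤ 1 ↔ radSq w ≤ 1 := by
  simpa using norm_coreMap_le_iff (N := N) (θ := θ) hl hw one_pos

theorem norm_coreMap_eq_one_iff {N : Matrix (Fin 2) (Fin 2) ℤ} {θ : Circle} {l : ℝ} (hl : 0 < l)
    {w : ℂ × ℂ} (hw : 0 < (level w).re) : ‖(coreMap N θ l w).2‖ = 1 ↔ radSq w = 1 := by
  have h1 := norm_coreMap_le_one_iff (N := N) (θ := θ) hl hw
  have h2 := norm_coreMap_lt_one_iff (N := N) (θ := θ) hl hw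
  grind

theorem torusAct_adjugate_cancel {N : Matrix (Fin 2) (Fin 2) ℤ} (hN : N.det = 1)
    (x : Circle × Circle) : torusAct N.adjugate (torusAct N x) = x := by
  rw [← torusAct_mul, Matrix.adjugate_mul, hN, one_smul, torusAct_one]

theorem torusAct_cancel_adjugate {N : Matrix (Fin 2) (Fin 2) ℤ} (hN : N.det = 1)
    (x : Circle × Circle) : torusAct N (torusAct N.adjugate x) = x := by
  rw [← torusAct_mul, Matrix.mul_adjugate, hN, one_smul, torusAct_one]

theorem level_coreInv (N : Matrix (Fin 2) (Fin 2) ℤ) (θ : Circle) (l : ℝ)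
    (y : (Circle × Circle) × ℂ) :
    level (coreInv N θ l y) = Complex.exp ((l⁻¹ : ℝ) * Complex.log (y.2 / θ)) := by
  have hC := levelConst_pos.ne'
  rw [level, coreInv]
  dsimp only
  simp only [norm_mul, Circle.norm_coe, one_mul, Complex.norm_real, Real.norm_eq_abs,
    Real.abs_exp, Real.log_exp]
  apply Complex.ext
  · dsimp only; field_simp; ring
  · dsimp only; field_simp; ring

theorem unitPart_coreInv (N : Matrix (Fin 2) (Fin 2) ℤ) (θ : Circle) (l : ℝ)
    (y : (Circle × Circle) × ℂ) :
    (unitPart (coreInv N θ l y).1, unitPart (coreInv N θ l y).2) = torusAct N.adjugate y.1 := by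
  rw [coreInv]
  dsimp only
  rw [unitPart_ofReal_mul (Real.exp_pos _), unitPart_ofReal_mul (Real.exp_pos _)]

theorem coreInv_ne_zero (N : Matrix (Fin 2) (Fin 2) ℤ) (θ : Circle) (l : ℝ)
    (y : (Circle × Circle) × ℂ) : (coreInv N θ l y).1 ≠ 0 ∧ (coreInv N θ l y).2 ≠ 0 :=
  ⟨mul_ne_zero (Circle.coe_ne_zero _) (by exact_mod_cast (Real.exp_pos _).ne'),
    mul_ne_zero (Circle.coe_ne_zero _) (by exact_mod_cast (Real.exp_pos _).ne')⟩

/-- The bound on the argument is what makes the principal logarithm undo the exponential after the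
power `1/l`. -/
theorem coreMap_coreInv {N : Matrix (Fin 2) (Fin 2) ℤ} (hN : N.det = 1) (θ : Circle) {l : ℝ}
    (hl : 0 < l) {y : (Circle × Circle) × ℂ} (hy : y.2 ≠ 0)
    (harg : |(y.2 / θ : ℂ).arg| < l * Real.pi) : coreMap N θ l (coreInv N θ l y) = y := by
  obtain ⟨x, ζ⟩ := y
  have him : ((l⁻¹ : ℝ) * Complex.log (ζ / θ)).im = l⁻¹ * (ζ / θ : ℂ).arg := by
    rw [Complex.im_ofReal_mul, Complex.log_im]
  have habs : |l⁻¹ * (ζ / θ : ℂ).arg| < Real.pi := by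
    rw [abs_mul, abs_of_pos (inv_pos.2 hl), inv_mul_lt_iff₀ hl]
    exact harg
  have h2 : Complex.log (Complex.exp ((l⁻¹ : ℝ) * Complex.log (ζ / θ))) =
      (l⁻¹ : ℝ) * Complex.log (ζ / θ) :=
    Complex.log_exp (by rw [him]; exact (abs_lt.1 habs).1) (by rw [him]; exact (abs_lt.1 habs).2.le)
  rw [coreMap, unitPart_coreInv, level_coreInv, torusAct_cancel_adjugate hN, h2, ← mul_assoc,
    ← Complex.ofReal_mul, mul_inv_cancel₀ hl.ne', Complex.ofReal_one, one_mul,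
    Complex.exp_log (div_ne_zero hy (Circle.coe_ne_zero _)),
    mul_div_cancel₀ _ (Circle.coe_ne_zero _)]

theorem abs_arg_lt_of_re_pos {z : ℂ} (hz : 0 < z.re) : |z.arg| < Real.pi / 2 :=
  Complex.abs_arg_lt_pi_div_two_iff.2 (Or.inl hz)

theorem coreMap_snd_div (N : Matrix (Fin 2) (Fin 2) ℤ) (θ : Circle) (l : ℝ) (w : ℂ × ℂ) :
    (coreMap N θ l w).2 / θ = Complex.exp (l * Complex.log (level w)) := by
  rw [coreMap, mul_div_cancel_left₀ _ (Circle.coe_ne_zero _)]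

/-- The argument of `level w` is below `π/2` in absolute value, so with `l ≤ 2` the power stays
within the principal branch. -/
theorem log_coreMap_snd_div (N : Matrix (Fin 2) (Fin 2) ℤ) (θ : Circle) {l : ℝ} (hl : 0 < l)
    (hl2 : l ≤ 2) {w : ℂ × ℂ} (hw : 0 < (level w).re) :
    Complex.log ((coreMap N θ l w).2 / θ) = l * Complex.log (level w) := by
  have h := abs_lt.1 (abs_arg_lt_of_re_pos hw)
  rw [coreMap_snd_div]
  refine Complex.log_exp ?_ ?_ <;> rw [Complex.im_ofReal_mul, Complex.log_im] <;> nlinarith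

theorem abs_arg_coreMap_snd_div (N : Matrix (Fin 2) (Fin 2) ℤ) (θ : Circle) {l : ℝ} (hl : 0 < l)
    (hl2 : l ≤ 2) {w : ℂ × ℂ} (hw : 0 < (level w).re) :
    |((coreMap N θ l w).2 / θ).arg| < Real.pi := by
  have h := abs_arg_lt_of_re_pos hw
  rw [← Complex.log_im, log_coreMap_snd_div N θ hl hl2 hw, Complex.im_ofReal_mul, Complex.log_im,
    abs_mul, abs_of_pos hl]
  nlinarith [abs_nonneg (level w).arg]

/-- A point is determined by its level, which gives both absolute values, and by its two angular
parts, which the adjugate recovers because the determinant is `1`. -/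
theorem coreInv_coreMap {N : Matrix (Fin 2) (Fin 2) ℤ} (hN : N.det = 1) (θ : Circle) {l : ℝ}
    (hl : 0 < l) (hl2 : l ≤ 2) {w : ℂ × ℂ} (h1 : w.1 ≠ 0) (h2 : w.2 ≠ 0)
    (hw : 0 < (level w).re) : coreInv N θ l (coreMap N θ l w) = w := by
  have hσ : level w ≠ 0 := fun h => by simp [h] at hw
  have hlev : level (coreInv N θ l (coreMap N θ l w)) = level w := by
    rw [level_coreInv, log_coreMap_snd_div N θ hl hl2 hw, ← mul_assoc, ← Complex.ofReal_mul,
      inv_mul_cancel₀ hl.ne', Complex.ofReal_one, one_mul, Complex.exp_log hσ]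
  have hu := unitPart_coreInv N θ l (coreMap N θ l w)
  have hact : torusAct N.adjugate (coreMap N θ l w).1 = (unitPart w.1, unitPart w.2) :=
    torusAct_adjugate_cancel hN _
  rw [hact] at hu
  obtain ⟨hn1, hn2⟩ := coreInv_ne_zero N θ l (coreMap N θ l w)
  have hre := congrArg Complex.re hlev
  have him := congrArg Complex.im hlev
  simp only [level] at hre him
  rw [div_left_inj' levelConst_pos.ne'] at hre him
  refine Prod.ext (eq_of_norm_eq_of_unitPart_eq ?_ (congrArg Prod.fst hu))
    (eq_of_norm_eq_of_unitPart_eq ?_ (congrArg Prod.snd hu))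
  · exact Real.log_injOn_pos (norm_pos_iff.2 hn1) (norm_pos_iff.2 h1) (by linarith)
  · exact Real.log_injOn_pos (norm_pos_iff.2 hn2) (norm_pos_iff.2 h2) (by linarith)

theorem contMDiffAt_coreMap (N : Matrix (Fin 2) (Fin 2) ℤ) (θ : Circle) (l : ℝ) {w : ℂ × ℂ}
    (h1 : w.1 ≠ 0) (h2 : w.2 ≠ 0) (hw : 0 < (level w).re) :
    ContMDiffAt 𝓘(ℝ, ℂ × ℂ) (((𝓡 1).prod (𝓡 1)).prod 𝓘(ℝ, ℂ)) ∞ (coreMap N θ l) w := by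
  have hu : ContMDiffAt 𝓘(ℝ, ℂ × ℂ) ((𝓡 1).prod (𝓡 1)) ∞
      (fun w : ℂ × ℂ => (unitPart w.1, unitPart w.2)) w :=
    ((contMDiffAt_unitPart h1).comp w contDiff_fst.contMDiff.contMDiffAt).prodMk
      ((contMDiffAt_unitPart h2).comp w contDiff_snd.contMDiff.contMDiffAt)
  have hl1 : ContDiffAt ℝ ∞ (fun w : ℂ × ℂ => Real.log ‖w.1‖) w :=
    ((contDiffAt_norm ℝ h1).comp w contDiffAt_fst).log (norm_ne_zero_iff.2 h1)
  have hl2 : ContDiffAt ℝ ∞ (fun w : ℂ × ℂ => Real.log ‖w.2‖) w :=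
    ((contDiffAt_norm ℝ h2).comp w contDiffAt_snd).log (norm_ne_zero_iff.2 h2)
  have hlev : ContDiffAt ℝ ∞ level w := by
    have h3 : ContDiffAt ℝ ∞ (fun w => Complex.equivRealProdCLM.symm
      ((Real.log ‖w.1‖ + Real.log ‖w.2‖) / levelConst,
        (Real.log ‖w.2‖ - Real.log ‖w.1‖) / levelConst)) w :=
      Complex.equivRealProdCLM.symm.contDiff.contDiffAt.comp w
        (((hl1.add hl2).div_const _).prodMk ((hl2.sub hl1).div_const _))
    refine h3.congr_of_eventuallyEq (.of_forall fun w => ?_)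
    apply Complex.ext <;> simp [level]
  have hζ : ContDiffAt ℝ ∞
      (fun w => (θ : ℂ) * Complex.exp (l * Complex.log (level w))) w := by
    have h4 : ContDiffAt ℂ ∞ (fun z : ℂ => (θ : ℂ) * Complex.exp (l * Complex.log z)) (level w) :=
      contDiffAt_const.mul ((contDiffAt_const.mul
        (Complex.contDiffAt_log (Or.inl hw))).cexp)
    exact (h4.restrict_scalars ℝ).comp w hlev
  exact ((contMDiff_torusAct N).contMDiffAt.comp w hu).prodMk hζ.contMDiffAt

theorem contMDiff_coe_circle : ContMDiff (𝓡 1) 𝓘(ℝ, ℂ) ∞ (fun z : Circle => (z : ℂ)) := by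
  have : Fact (Module.finrank ℝ ℂ = 1 + 1) := finrank_real_complex_fact'
  exact contMDiff_coe_sphere

theorem contMDiffAt_coreInv (N : Matrix (Fin 2) (Fin 2) ℤ) (θ : Circle) (l : ℝ)
    {y : (Circle × Circle) × ℂ} (hy : y.2 / θ ∈ Complex.slitPlane) :
    ContMDiffAt (((𝓡 1).prod (𝓡 1)).prod 𝓘(ℝ, ℂ)) 𝓘(ℝ, ℂ × ℂ) ∞ (coreInv N θ l) y := by
  have hx : ContMDiffAt (((𝓡 1).prod (𝓡 1)).prod 𝓘(ℝ, ℂ)) ((𝓡 1).prod (𝓡 1)) ∞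
      (fun y : (Circle × Circle) × ℂ => torusAct N.adjugate y.1) y :=
    (contMDiff_torusAct _).contMDiffAt.comp y contMDiffAt_fst
  have hx1 := contMDiff_coe_circle.contMDiffAt.comp y (contMDiffAt_fst.comp y hx)
  have hx2 := contMDiff_coe_circle.contMDiffAt.comp y (contMDiffAt_snd.comp y hx)
  have hσ : ContDiffAt ℝ ∞ (fun ζ : ℂ => Complex.exp ((l⁻¹ : ℝ) * Complex.log (ζ / θ))) y.2 := by
    have h4 : ContDiffAt ℂ ∞ (fun ζ : ℂ => Complex.exp ((l⁻¹ : ℝ) * Complex.log (ζ / θ))) y.2 :=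
      (contDiffAt_const.mul
        ((Complex.contDiffAt_log hy).comp y.2 (contDiffAt_id.div_const (θ : ℂ)))).cexp
    exact h4.restrict_scalars ℝ
  have hre := Complex.reCLM.contDiff.contDiffAt.comp y.2 hσ
  have him := Complex.imCLM.contDiff.contDiffAt.comp y.2 hσ
  have hmul : ContDiff ℝ ∞ fun p : ℂ × ℂ => p.1 * p.2 := contDiff_mul
  have hr1 := Complex.ofRealCLM.contDiff.contDiffAt.comp y.2
    (((contDiffAt_const (c := levelConst)).mul (hre.sub him)).div_const 2).exp
  have hr2 := Complex.ofRealCLM.contDiff.contDiffAt.comp y.2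
    (((contDiffAt_const (c := levelConst)).mul (hre.add him)).div_const 2).exp
  have hs1 : ContMDiffAt (((𝓡 1).prod (𝓡 1)).prod 𝓘(ℝ, ℂ)) 𝓘(ℝ, ℂ) ∞ _ y :=
    hr1.contMDiffAt.comp y contMDiffAt_snd
  have hs2 : ContMDiffAt (((𝓡 1).prod (𝓡 1)).prod 𝓘(ℝ, ℂ)) 𝓘(ℝ, ℂ) ∞ _ y :=
    hr2.contMDiffAt.comp y contMDiffAt_snd
  exact (hmul.contMDiff.contMDiffAt.comp y (hx1.prodMk_space hs1)).prodMk_space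
    (hmul.contMDiff.contMDiffAt.comp y (hx2.prodMk_space hs2))

end Core
/-! ### Cyclic arrangement of the sectors around the core -/

section Sectors

/-- The hypotheses are the effect of a face gluing on absolute values: `(log|w₁|, log|w₂|)` becomes
`(log|w₂|, -log|w₁|)`, a rotation by `-π/2`. -/
theorem level_rotate {w w' : ℂ × ℂ} (hs : Real.log ‖w'.1‖ = Real.log ‖w.2‖)
    (ht : Real.log ‖w'.2‖ = -Real.log ‖w.1‖) : level w' = -Complex.I * level w := by
  rw [level, level, hs, ht]
  apply Complex.ext
  · simp; ring
  · simp; ring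

theorem log_norm_eq_of_level_rotate {w w' : ℂ × ℂ} (h : level w' = -Complex.I * level w) :
    Real.log ‖w'.1‖ = Real.log ‖w.2‖ ∧ Real.log ‖w'.2‖ = -Real.log ‖w.1‖ := by
  have hre := congrArg Complex.re h
  have him := congrArg Complex.im h
  simp only [level, neg_mul, Complex.neg_re, Complex.mul_re, Complex.I_re, zero_mul, Complex.I_im,
    one_mul, zero_sub, neg_neg, Complex.neg_im, Complex.mul_im, zero_add] at hre him
  rw [← neg_div, div_left_inj' levelConst_pos.ne'] at him
  rw [div_left_inj' levelConst_pos.ne'] at hre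
  constructor <;> linarith

theorem log_norm_eq_of_level_eq {w w' : ℂ × ℂ} (h : level w' = level w) :
    Real.log ‖w'.1‖ = Real.log ‖w.1‖ ∧ Real.log ‖w'.2‖ = Real.log ‖w.2‖ := by
  have hre := congrArg Complex.re h
  have him := congrArg Complex.im h
  simp only [level] at hre him
  rw [div_left_inj' levelConst_pos.ne'] at him hre
  constructor <;> linarith

/-- A number in the right half plane rotated by `-π/2` has argument in `(-π, 0)`, so no branch is
crossed. -/
theorem log_neg_I_mul {z : ℂ} (hz : 0 < z.re) :
    Complex.log (-Complex.I * z) = Complex.log z - (Real.pi / 2 : ℝ) * Complex.I := by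
  have h := abs_lt.1 (abs_arg_lt_of_re_pos hz)
  have hz0 : z ≠ 0 := fun h => by simp [h] at hz
  have him : (Complex.log z - (Real.pi / 2 : ℝ) * Complex.I).im = z.arg - Real.pi / 2 := by
    rw [Complex.sub_im, Complex.log_im, Complex.im_ofReal_mul, Complex.I_im, mul_one]
  rw [← Complex.log_exp (x := Complex.log z - (Real.pi / 2 : ℝ) * Complex.I)
    (by rw [him]; linarith) (by rw [him]; linarith [Real.pi_pos]), Complex.exp_sub,
    Complex.exp_log hz0]
  congr 1
  push_cast
  rw [Complex.exp_pi_div_two_mul_I, div_eq_mul_inv, Complex.inv_I]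
  ring

variable {k : ℕ} [NeZero k]

/-- The rotation by `-i` becomes the factor `exp (-2πi/k)` under the power `4/k`, and the passage
from the root of unity at `i` to that at `i + 1` cancels it. -/
theorem coreMap_succ {N N' : Matrix (Fin 2) (Fin 2) ℤ} (i : ZMod k) {w w' : ℂ × ℂ}
    (h : level w' = -Complex.I * level w) (hw : 0 < (level w).re)
    (hu : torusAct N' (unitPart w'.1, unitPart w'.2) = torusAct N (unitPart w.1, unitPart w.2)) :
    coreMap N' (ZMod.toCircle (i + 1)) (4 / k) w' = coreMap N (ZMod.toCircle i) (4 / k) w := by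
  have hk : (k : ℂ) ≠ 0 := by exact_mod_cast NeZero.ne k
  have h1 : ((ZMod.toCircle (1 : ZMod k) : Circle) : ℂ) =
      Complex.exp (2 * Real.pi * Complex.I / k) := by
    have := ZMod.toCircle_intCast (N := k) 1
    simpa using this
  rw [coreMap, coreMap, hu, h, log_neg_I_mul hw, AddChar.map_add_eq_mul, Circle.coe_mul, h1,
    mul_sub, Complex.exp_sub, mul_assoc]
  have h2 : Complex.exp (((4 / k : ℝ) : ℂ) * ((Real.pi / 2 : ℝ) * Complex.I)) =
      Complex.exp (2 * Real.pi * Complex.I / k) := by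
    congr 1
    push_cast
    field_simp
    ring
  rw [h2, mul_div_cancel₀ _ (Complex.exp_ne_zero _)]

/-- Comparing logarithms, the arguments of the two levels differ by `M · π/2` for an integer `M`
congruent to `j - i` modulo `k`. Both lie in `(-π/2, π/2)`, so `M` is `0`, `1` or `-1`: points with
the same image are equal or related by one face gluing. -/
theorem level_of_coreMap_eq {N N' : Matrix (Fin 2) (Fin 2) ℤ} {i j : ZMod k} {w w' : ℂ × ℂ}
    (hw : 0 < (level w).re) (hw' : 0 < (level w').re)
    (h : (coreMap N (ZMod.toCircle i) (4 / k) w).2 = (coreMap N' (ZMod.toCircle j) (4 / k) w').2) :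
    (j = i ∧ level w' = level w) ∨ (j = i + 1 ∧ level w' = -Complex.I * level w) ∨
      (i = j + 1 ∧ level w = -Complex.I * level w') := by
  have hk : (k : ℝ) ≠ 0 := by exact_mod_cast NeZero.ne k
  have hkC : (k : ℂ) ≠ 0 := by exact_mod_cast hk
  have hσ : level w ≠ 0 := fun h => by simp [h] at hw
  have hσ' : level w' ≠ 0 := fun h => by simp [h] at hw'
  have hi : ((i.val : ℤ) : ZMod k) = i := by simp
  have hj : ((j.val : ℤ) : ZMod k) = j := by simp
  set a : ℤ := (i.val : ℤ)
  set b : ℤ := (j.val : ℤ)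
  rw [← hi, ← hj] at h
  simp only [coreMap, ZMod.toCircle_intCast, ← Complex.exp_add] at h
  obtain ⟨n, hn⟩ := Complex.exp_eq_exp_iff_exists_int.1 h
  have hlog : Complex.log (level w) = Complex.log (level w') +
      ((b - a + n * k : ℤ) : ℝ) * (Real.pi / 2 : ℝ) * Complex.I := by
    push_cast at hn ⊢
    field_simp at hn
    linear_combination (1 / 4) * hn
  have harg : (level w).arg = (level w').arg + ((b - a + n * k : ℤ) : ℝ) * (Real.pi / 2) := by
    have := congrArg Complex.im hlog
    rwa [Complex.add_im, Complex.log_im, Complex.log_im, ← Complex.ofReal_mul,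
      Complex.im_ofReal_mul, Complex.I_im, mul_one] at this
  have hA := abs_lt.1 (abs_arg_lt_of_re_pos hw)
  have hA' := abs_lt.1 (abs_arg_lt_of_re_pos hw')
  have hpi := Real.pi_pos
  have hcast : ((b - a + n * k : ℤ) : ZMod k) = j - i := by
    push_cast
    rw [hi, hj]
    simp
  set M : ℤ := b - a + n * k with hM
  have hM2 : (M : ℝ) < 2 := by nlinarith
  have hM2' : (-2 : ℝ) < M := by nlinarith
  have hM3 : M < 2 := by exact_mod_cast hM2
  have hM3' : -2 < M := by exact_mod_cast hM2'
  have hexp := congrArg Complex.exp hlog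
  rw [Complex.exp_log hσ, Complex.exp_add, Complex.exp_log hσ'] at hexp
  obtain hM | hM | hM : M = 0 ∨ M = 1 ∨ M = -1 := by lia
  · left
    rw [hM] at hcast hexp
    refine ⟨?_, by simpa using hexp.symm⟩
    rw [Int.cast_zero] at hcast
    exact sub_eq_zero.1 hcast.symm
  · right; left
    rw [hM] at hcast hexp
    rw [Int.cast_one] at hcast
    push_cast at hexp
    rw [one_mul, Complex.exp_pi_div_two_mul_I] at hexp
    refine ⟨by rw [hcast]; ring, ?_⟩
    rw [hexp]
    linear_combination level w' * Complex.I_mul_I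
  · right; right
    rw [hM] at hcast hexp
    push_cast at hexp hcast
    rw [neg_mul, neg_mul, Complex.exp_neg, one_mul, Complex.exp_pi_div_two_mul_I,
      Complex.inv_I] at hexp
    refine ⟨by linear_combination hcast, ?_⟩
    rw [hexp]
    ring

/-- The index is the rounding of `k · arg z / 2π`: the nearest `k`-th root of unity is at angular
distance at most `π/k`. -/
theorem exists_abs_arg_div_toCircle_le {z : ℂ} (hz : z ≠ 0) :
    ∃ i : ZMod k, |(z / (ZMod.toCircle i : ℂ)).arg| ≤ Real.pi / k := by
  have hk : (k : ℝ) ≠ 0 := by exact_mod_cast NeZero.ne k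
  have hk0 : (0 : ℝ) < k := by exact_mod_cast NeZero.pos k
  have hk1 : (1 : ℝ) ≤ k := by exact_mod_cast NeZero.one_le
  have hpi := Real.pi_pos
  set x : ℝ := k * z.arg / (2 * Real.pi) with hx
  set r : ℝ := z.arg - 2 * Real.pi * (round x : ℝ) / k with hr
  have hrx : r = 2 * Real.pi / k * (x - round x) := by
    rw [hr, hx]; field_simp
  have hrabs : |r| ≤ Real.pi / k := by
    have h1 := abs_sub_round x
    rw [hrx, abs_mul, abs_of_pos (by positivity)]
    calc 2 * Real.pi / k * |x - round x| ≤ 2 * Real.pi / k * (1 / 2) := by gcongr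
      _ = Real.pi / k := by ring
  refine ⟨((round x : ℤ) : ZMod k), ?_⟩
  have hc : z / (ZMod.toCircle ((round x : ℤ) : ZMod k) : ℂ) = (‖z‖ : ℝ) * (Circle.exp r : ℂ) := by
    rw [ZMod.toCircle_intCast, div_eq_iff (Complex.exp_ne_zero _), Circle.coe_exp, mul_assoc,
      ← Complex.exp_add]
    conv_lhs => rw [← Complex.norm_mul_exp_arg_mul_I z]
    congr 2
    rw [hr]
    push_cast
    ring
  have hpik : Real.pi / k ≤ Real.pi := div_le_self hpi.le hk1
  rw [hc, Complex.arg_real_mul _ (norm_pos_iff.2 hz)]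
  -- The angle `-π/k` is treated separately: for `k = 1` it equals `-π`, which is not a value of the
  -- principal argument.
  rcases eq_or_lt_of_le (neg_le_of_abs_le hrabs) with h | h
  · by_cases hk2 : k = 1
    · exact (Complex.abs_arg_le_pi _).trans_eq (by simp [hk2])
    · have : Real.pi / k < Real.pi := div_lt_self hpi (by
        exact_mod_cast (by have := NeZero.pos k; lia : 1 < k))
      rw [Circle.arg_exp (by linarith) (by linarith [le_of_abs_le hrabs])]
      exact hrabs
  · rw [Circle.arg_exp (by linarith) (by linarith [le_of_abs_le hrabs])]
    exact hrabs

/-- With respect to the nearest root of unity the argument is at most `π/k`, hence at most `π/4`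
after the power `k/4`. This is the closed quadrant in rotated logarithmic coordinates, so both
absolute values are at least `1`. -/
theorem exists_coreMap_eq {N : ZMod k → Matrix (Fin 2) (Fin 2) ℤ} (hN : ∀ i, (N i).det = 1)
    {y : (Circle × Circle) × ℂ} (hy : y.2 ≠ 0) :
    ∃ (i : ZMod k) (w : ℂ × ℂ), coreMap (N i) (ZMod.toCircle i) (4 / k) w = y ∧
      1 ≤ ‖w.1‖ ∧ 1 ≤ ‖w.2‖ ∧ 0 < (level w).re := by
  have hk0 : (0 : ℝ) < k := by exact_mod_cast NeZero.pos k
  have hpi := Real.pi_pos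
  obtain ⟨i, hi⟩ := exists_abs_arg_div_toCircle_le (k := k) hy
  have hlt : |(y.2 / (ZMod.toCircle i : ℂ)).arg| < 4 / k * Real.pi := by
    refine hi.trans_lt ?_
    rw [div_mul_eq_mul_div]
    gcongr
    linarith
  refine ⟨i, coreInv (N i) (ZMod.toCircle i) (4 / k) y,
    coreMap_coreInv (hN i) _ (by positivity) hy hlt, ?_⟩
  set w := coreInv (N i) (ZMod.toCircle i) (4 / k) y with hw
  have hlev := level_coreInv (N i) (ZMod.toCircle i) (4 / k) y
  rw [← hw] at hlev
  obtain ⟨hw1, hw2⟩ : w.1 ≠ 0 ∧ w.2 ≠ 0 := coreInv_ne_zero _ _ _ _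
  set φ := (((4 / k : ℝ)⁻¹ : ℝ) * Complex.log (y.2 / (ZMod.toCircle i : ℂ))).im with hφ
  have hφ4 : |φ| ≤ Real.pi / 4 := by
    rw [hφ, Complex.im_ofReal_mul, Complex.log_im, abs_mul, abs_of_pos (by positivity), inv_div]
    calc (k : ℝ) / 4 * |(y.2 / (ZMod.toCircle i : ℂ)).arg| ≤ k / 4 * (Real.pi / k) := by gcongr
      _ = Real.pi / 4 := by field_simp
  have hcos : √2 / 2 ≤ Real.cos φ := by
    rw [← Real.cos_pi_div_four, ← Real.cos_abs φ]
    exact Real.cos_le_cos_of_nonneg_of_le_pi (abs_nonneg _) (by linarith) hφ4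
  have hsin : |Real.sin φ| ≤ √2 / 2 := by
    have h4 := abs_le.1 hφ4
    rw [← Real.sin_pi_div_four, abs_le, ← Real.sin_neg]
    exact ⟨Real.sin_le_sin_of_le_of_le_pi_div_two (by linarith) (by linarith) (by linarith),
      Real.sin_le_sin_of_le_of_le_pi_div_two (by linarith) (by linarith) (by linarith)⟩
  have hcos0 : 0 < Real.cos φ := lt_of_lt_of_le (by positivity) hcos
  set E := Real.exp (((4 / k : ℝ)⁻¹ : ℝ) * Complex.log (y.2 / (ZMod.toCircle i : ℂ))).re
  have hE : 0 < E := Real.exp_pos _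
  have hre : (level w).re = E * Real.cos φ := by rw [hlev, Complex.exp_re]
  have him : (level w).im = E * Real.sin φ := by rw [hlev, Complex.exp_im]
  have hsc := abs_le.1 (hsin.trans hcos)
  have h1 : (level w).im ≤ (level w).re := by
    rw [hre, him]; exact mul_le_mul_of_nonneg_left hsc.2 hE.le
  have h2 : -(level w).im ≤ (level w).re := by
    rw [hre, him, ← mul_neg]; exact mul_le_mul_of_nonneg_left (by linarith) hE.le
  rw [level] at h1 h2
  dsimp only at h1 h2
  rw [div_le_div_iff_of_pos_right levelConst_pos] at h1
  rw [← neg_div, div_le_div_iff_of_pos_right levelConst_pos] at h2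
  refine ⟨?_, ?_, by rw [hre]; positivity⟩
  · exact (Real.log_nonneg_iff (norm_pos_iff.2 hw1)).1 (by linarith)
  · exact (Real.log_nonneg_iff (norm_pos_iff.2 hw2)).1 (by linarith)

end Sectors
/-! ### Matching the faces of consecutive pieces -/

section UnitPart

theorem unitPart_circle_mul (x : Circle) {z : ℂ} (hz : z ≠ 0) : unitPart (x * z) = x * unitPart z := by
  have h : (x : ℂ) * z = ((x * unitPart z : Circle) : ℂ) * ((‖z‖ : ℝ) : ℂ) := by
    conv_lhs => rw [← norm_mul_unitPart z]
    push_cast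
    ring
  rw [h, unitPart_ofReal_mul (norm_pos_iff.2 hz)]

theorem unitPart_one : unitPart 1 = 1 := by simp [unitPart]

theorem unitPart_inv {z : ℂ} (hz : z ≠ 0) : unitPart z⁻¹ = (unitPart z)⁻¹ := by
  rw [eq_inv_iff_mul_eq_one, ← unitPart_mul (inv_ne_zero hz) hz, inv_mul_cancel₀ hz, unitPart_one]

theorem unitPart_conj {z : ℂ} (hz : z ≠ 0) :
    unitPart ((starRingEnd ℂ) z) = (unitPart z)⁻¹ := by
  have h : (starRingEnd ℂ) z * z = ((1 : Circle) : ℂ) * ((Complex.normSq z : ℝ) : ℂ) := by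
    rw [mul_comm, Complex.mul_conj, Circle.coe_one, one_mul]
  rw [eq_inv_iff_mul_eq_one, ← unitPart_mul ((map_ne_zero _).2 hz) hz, h,
    unitPart_ofReal_mul (Complex.normSq_pos.2 hz)]

theorem coe_unitPart {z : ℂ} (hz : z ≠ 0) : (unitPart z : ℂ) = z / (‖z‖ : ℂ) := by
  have h : (‖z‖ : ℂ) ≠ 0 := by exact_mod_cast norm_ne_zero_iff.2 hz
  rw [eq_div_iff h, mul_comm, norm_mul_unitPart]

theorem unitPart_clutching {z w : ℂ} (hz : z ≠ 0) (hw : w ≠ 0) (e : ℤ) :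
    unitPart ((z / (‖z‖ : ℂ)) ^ e * w) = unitPart z ^ e * unitPart w := by
  rw [← coe_unitPart hz, ← Circle.coe_zpow, unitPart_circle_mul _ hw]

end UnitPart

section FaceMap

/-- The gluing map of the tubular neighbourhoods, exchanging the inside and the outside. -/
noncomputable def faceMap (b : Bool) (y : (ℝ × ℂ) × ℂ) : (ℝ × ℂ) × ℂ :=
  -- On the unit circle `z⁻¹` is the conjugate of `z` and the inverse of the conjugate is `z`, so
  -- the two prescribed gluings are recovered there.
  if b then (y.1, y.2⁻¹) else (reflect y.1, ((starRingEnd ℂ) y.2)⁻¹)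

theorem faceMap_faceMap (b : Bool) (y : (ℝ × ℂ) × ℂ) : faceMap b (faceMap b y) = y := by
  cases b <;> simp [faceMap, reflect]

theorem norm_faceMap_snd (b : Bool) (y : (ℝ × ℂ) × ℂ) : ‖(faceMap b y).2‖ = ‖y.2‖⁻¹ := by
  cases b <;> simp [faceMap]

theorem faceMap_fst_fst (b : Bool) (y : (ℝ × ℂ) × ℂ) : (faceMap b y).1.1 = y.1.1 := by
  cases b <;> simp [faceMap, reflect]

theorem norm_faceMap_fst_snd (b : Bool) (y : (ℝ × ℂ) × ℂ) : ‖(faceMap b y).1.2‖ = ‖y.1.2‖ := by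
  cases b <;> simp [faceMap, reflect]

theorem faceMap_fst_mem_openPunctured {b : Bool} {y : (ℝ × ℂ) × ℂ} {g : ℕ}
    (h : y.1 ∈ openPunctured g) : (faceMap b y).1 ∈ openPunctured g := by
  cases b
  · exact reflect_mem_openPunctured h
  · exact h

theorem contDiffAt_faceMap (b : Bool) {y : (ℝ × ℂ) × ℂ} (hy : y.2 ≠ 0) :
    ContDiffAt ℝ ∞ (faceMap b) y := by
  cases b
  · have h1 : ContDiffAt ℝ ∞ (fun y : (ℝ × ℂ) × ℂ =>
        ((y.1.1, Complex.conjCLE y.1.2), (Complex.conjCLE y.2)⁻¹)) y := by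
      have hc : ContDiff ℝ ∞ Complex.conjCLE := Complex.conjCLE.contDiff
      refine ContDiffAt.prodMk (ContDiff.contDiffAt ?_) (ContDiffAt.inv ?_ ?_)
      · exact (contDiff_fst.comp contDiff_fst).prodMk (hc.comp (contDiff_snd.comp contDiff_fst))
      · exact (hc.comp contDiff_snd).contDiffAt
      · simpa using hy
    exact h1
  · have h1 : ContDiffAt ℝ ∞ (fun y : (ℝ × ℂ) × ℂ => (y.1, y.2⁻¹)) y :=
      contDiffAt_fst.prodMk (contDiffAt_snd.inv hy)
    exact h1

end FaceMap

section FaceMatch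

open Filter Topology

variable {X : Type*} [TopologicalSpace X] [ChartedSpace (EuclideanSpace ℝ (Fin 4)) X]
  {S T : Set X} {g h : ℕ} {m n : ℤ}
  {X' : Type*} [TopologicalSpace X'] [ChartedSpace (EuclideanSpace ℝ (Fin 4)) X']
  {S' T' : Set X'} {g' h' : ℕ} {m' n' : ℤ}

/-- The relation between the tubular neighbourhoods of `T` and `S'` given by `faceMap`. -/
structure FaceMatch (b : Bool) (P : SurfacePair X S T g h m n)
    (P' : SurfacePair X' S' T' g' h' m' n') (p : X) (q : X') : Prop where
  memT : p ∈ P.tubeT.dom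
  memS : q ∈ P'.tubeS.dom
  ne : P.tubeT.fib p ≠ 0
  eq : P'.tubeS.emb q = faceMap b (P.tubeT.emb p)

namespace FaceMatch

variable {b : Bool} {P : SurfacePair X S T g h m n} {P' : SurfacePair X' S' T' g' h' m' n'}
  {p p₁ : X} {q q₁ : X'}

theorem eq_symm (H : FaceMatch b P P' p q) : P.tubeT.emb p = faceMap b (P'.tubeS.emb q) := by
  rw [H.eq, faceMap_faceMap]

theorem norm_mul_norm (H : FaceMatch b P P' p q) : ‖P.tubeT.fib p‖ * ‖P'.tubeS.fib q‖ = 1 := by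
  have : ‖P'.tubeS.fib q‖ = ‖P.tubeT.fib p‖⁻¹ := by
    rw [show P'.tubeS.fib q = (P'.tubeS.emb q).2 from rfl, H.eq, norm_faceMap_snd]
    rfl
  rw [this, mul_inv_cancel₀ (norm_ne_zero_iff.2 H.ne)]

theorem ne' (H : FaceMatch b P P' p q) : P'.tubeS.fib q ≠ 0 := by
  intro h0
  have := H.norm_mul_norm
  simp [h0] at this

theorem right_unique (H : FaceMatch b P P' p q) (H₁ : FaceMatch b P P' p q₁) : q = q₁ :=
  P'.tubeS.injOn H.memS H₁.memS (H.eq.trans H₁.eq.symm)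

theorem left_unique (H : FaceMatch b P P' p q) (H₁ : FaceMatch b P P' p₁ q) : p = p₁ :=
  P.tubeT.injOn H.memT H₁.memT (H.eq_symm.trans H₁.eq_symm.symm)

/-- The bound `1/3` ensures that the inverted radius is less than `3`, where the other tube is
defined. -/
theorem exists_right (hg : h = g') (b : Bool) (P : SurfacePair X S T g h m n)
    (P' : SurfacePair X' S' T' g' h' m' n') (hp : p ∈ P.tubeT.dom) (hf : 1 / 3 < ‖P.tubeT.fib p‖) :
    ∃ q, FaceMatch b P P' p q := by
  subst hg
  have h0 : 0 < ‖P.tubeT.fib p‖ := by linarith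
  obtain ⟨q, hq, h1, h2⟩ := P'.tubeS.exists_mem
    (faceMap_fst_mem_openPunctured (b := b) (y := P.tubeT.emb p) (P.tubeT.emb_mem hp).1)
    (z := (faceMap b (P.tubeT.emb p)).2) (by
      rw [norm_faceMap_snd]
      change ‖P.tubeT.fib p‖⁻¹ < 3
      rw [inv_lt_comm₀ h0 (by norm_num)]
      rwa [one_div] at hf)
  exact ⟨q, hp, hq, norm_pos_iff.1 h0, Prod.ext h1 h2⟩

theorem exists_left (hg : h = g') (b : Bool) (P : SurfacePair X S T g h m n)
    (P' : SurfacePair X' S' T' g' h' m' n') (hq : q ∈ P'.tubeS.dom)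
    (hf : 1 / 3 < ‖P'.tubeS.fib q‖) : ∃ p, FaceMatch b P P' p q := by
  subst hg
  have h0 : 0 < ‖P'.tubeS.fib q‖ := by linarith
  obtain ⟨p, hp, h1, h2⟩ := P.tubeT.exists_mem
    (faceMap_fst_mem_openPunctured (b := b) (y := P'.tubeS.emb q) (P'.tubeS.emb_mem hq).1)
    (z := (faceMap b (P'.tubeS.emb q)).2) (by
      rw [norm_faceMap_snd]
      change ‖P'.tubeS.fib q‖⁻¹ < 3
      rw [inv_lt_comm₀ h0 (by norm_num)]
      rwa [one_div] at hf)
  have he : P.tubeT.emb p = faceMap b (P'.tubeS.emb q) := Prod.ext h1 h2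
  refine ⟨p, hp, hq, ?_, by rw [he, faceMap_faceMap]⟩
  rw [h2, ← norm_pos_iff, norm_faceMap_snd]
  exact inv_pos.2 h0

theorem base_fst (H : FaceMatch b P P' p q) : (P'.tubeS.base q).1 = (P.tubeT.base p).1 := by
  rw [show P'.tubeS.base q = (P'.tubeS.emb q).1 from rfl, H.eq, faceMap_fst_fst]
  rfl

theorem norm_base_snd (H : FaceMatch b P P' p q) :
    ‖(P'.tubeS.base q).2‖ = ‖(P.tubeT.base p).2‖ := by
  rw [show P'.tubeS.base q = (P'.tubeS.emb q).1 from rfl, H.eq, norm_faceMap_fst_snd]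
  rfl

theorem mem_chart_iff (H : FaceMatch b P P' p q) : p ∈ P.chart ↔ q ∈ P'.chart := by
  rw [P.tubeT.mem_chart_iff p H.memT, P'.tubeS.mem_chart_iff q H.memS, H.base_fst, H.norm_base_snd]

/-- Each clutching function twists the fibre by a power of the base angle. The gluing map turns
their composite into a single twist, with exponent the sum of the two Euler numbers. -/
theorem coords (H : FaceMatch b P P' p q) (hp : p ∈ P.chart) :
    ‖P'.w₁ q‖ = ‖P.w₂ p‖ ∧ ‖P'.w₂ q‖ = ‖P.w₁ p‖⁻¹ ∧
    (unitPart (P'.w₁ q), unitPart (P'.w₂ q)) =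
      torusStep (n + m') b (unitPart (P.w₁ p), unitPart (P.w₂ p)) := by
  have hq := H.mem_chart_iff.1 hp
  have hbp : (P.tubeT.emb p).1.2 = P.w₂ p := P.tubeT.base_eq p ⟨H.memT, hp⟩
  have hbq : (P'.tubeS.emb q).1.2 = P'.w₁ q := P'.tubeS.base_eq q ⟨H.memS, hq⟩
  have hcp := P.tubeT.clutching p ⟨H.memT, hp⟩
  have hcq := P'.tubeS.clutching q ⟨H.memS, hq⟩
  have hp2 : P.w₂ p ≠ 0 := by
    have := (P.tubeT.mem_dom_iff p hp).1 H.memT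
    exact norm_pos_iff.1 (by linarith)
  have hq1 : P'.w₁ q ≠ 0 := by
    have := (P'.tubeS.mem_dom_iff q hq).1 H.memS
    exact norm_pos_iff.1 (by linarith)
  have hup := unitPart_clutching hp2 H.ne n
  rw [← hcp] at hup
  have huq := unitPart_clutching hq1 H.ne' m'
  rw [← hcq] at huq
  have hfe : P'.tubeS.fib q = (faceMap b (P.tubeT.emb p)).2 := congrArg Prod.snd H.eq
  have hbe : P'.w₁ q = (faceMap b (P.tubeT.emb p)).1.2 := by rw [← hbq, H.eq]
  refine ⟨?_, ?_, ?_⟩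
  · rw [← hbp, ← hbq, H.eq, norm_faceMap_fst_snd]
  · rw [P'.norm_w₂_eq H.memS hq, P.norm_w₁_eq H.memT hp]
    exact eq_inv_of_mul_eq_one_right H.norm_mul_norm
  · rw [huq, hup]
    cases b
    · have h1 : P'.w₁ q = (starRingEnd ℂ) (P.w₂ p) := by rw [hbe, ← hbp]; rfl
      have h2 : P'.tubeS.fib q = ((starRingEnd ℂ) (P.tubeT.fib p))⁻¹ := hfe
      rw [h1, h2, unitPart_conj hp2, unitPart_inv ((map_ne_zero _).2 H.ne), unitPart_conj H.ne,
        inv_inv]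
      simp only [torusStep, Bool.false_eq_true, if_false, Prod.mk.injEq, true_and]
      rw [neg_add, zpow_add, inv_zpow', mul_mul_mul_comm, ← zpow_add, add_neg_cancel, zpow_zero,
        one_mul, mul_comm]
    · have h1 : P'.w₁ q = P.w₂ p := by rw [hbe, ← hbp]; rfl
      have h2 : P'.tubeS.fib q = (P.tubeT.fib p)⁻¹ := hfe
      rw [h1, h2, unitPart_inv H.ne]
      simp only [torusStep, if_true, Prod.mk.injEq, true_and]
      rw [zpow_add, mul_inv, mul_mul_mul_comm, inv_mul_cancel, one_mul, mul_comm]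

/-- In the thickened pieces the reciprocal relation forces `|w₁| < 5/4`, so `|w₂| > 5/4` and `p`
lies in the tube. Its partner there has the same coordinates as `q`, hence is `q`. -/
theorem of_coords (hg : h = g') (hp : p ∈ P.thick) (hpc : p ∈ P.chart) (hq : q ∈ P'.thick) (hqc : q ∈ P'.chart)
    (h1 : ‖P'.w₁ q‖ = ‖P.w₂ p‖) (h2 : ‖P'.w₂ q‖ = ‖P.w₁ p‖⁻¹)
    (h3 : (unitPart (P'.w₁ q), unitPart (P'.w₂ q)) =
      torusStep (n + m') b (unitPart (P.w₁ p), unitPart (P.w₂ p))) : FaceMatch b P P' p q := by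
  obtain ⟨ha, hb, hab⟩ := (P.mem_thick_iff hpc).1 hp
  obtain ⟨hc, hd, hcd⟩ := (P'.mem_thick_iff hqc).1 hq
  have h5 : ‖P.w₁ p‖ < 5 / 4 := by
    rw [h2, lt_inv_comm₀ (by norm_num) (by linarith)] at hd
    norm_num at hd
    exact hd
  have h6 : 5 / 4 < ‖P.w₂ p‖ := hab.resolve_left h5.not_gt
  have hpd : p ∈ P.tubeT.dom := (P.tubeT.mem_dom_iff p hpc).2 (by linarith)
  obtain ⟨q₀, H⟩ := exists_right hg b P P' hpd (by rw [← P.norm_w₁_eq hpd hpc]; linarith)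
  obtain ⟨e1, e2, e3⟩ := H.coords hpc
  have hq0 := H.mem_chart_iff.1 hpc
  have : q₀ = q := by
    refine P'.injOn hq0 hqc (Prod.ext ?_ ?_)
    · exact eq_of_norm_eq_of_unitPart_eq (e1.trans h1.symm)
        (congrArg Prod.fst (e3.trans h3.symm))
    · exact eq_of_norm_eq_of_unitPart_eq (e2.trans h2.symm)
        (congrArg Prod.snd (e3.trans h3.symm))
  exact this ▸ H

theorem exists_lift_right [IsManifold (𝓡 4) ∞ X'] (hg : h = g') (H : FaceMatch b P P' p q) :
    ∃ φ : X → X', ContMDiffAt (𝓡 4) (𝓡 4) ∞ φ p ∧ φ p = q ∧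
      ∀ᶠ x in 𝓝 p, FaceMatch b P P' x (φ x) := by
  subst hg
  obtain ⟨G, hG, hGq, hev⟩ := P'.tubeS.exists_inverse H.memS
  have h1 : ContMDiffAt (𝓡 4) 𝓘(ℝ, (ℝ × ℂ) × ℂ) ∞ (fun x => faceMap b (P.tubeT.emb x)) p :=
    (contDiffAt_faceMap b (y := P.tubeT.emb p) H.ne).contMDiffAt.comp p
      (P.tubeT.contMDiffAt_emb H.memT)
  rw [H.eq] at hG hGq hev
  refine ⟨fun x => G (faceMap b (P.tubeT.emb x)), hG.comp p h1, hGq, ?_⟩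
  have hne : ∀ᶠ x in 𝓝 p, P.tubeT.fib x ≠ 0 :=
    (P.tubeT.continuousOn_fib.continuousAt (P.tubeT.isOpen_dom.mem_nhds H.memT)).eventually_ne H.ne
  filter_upwards [h1.continuousAt.eventually hev, P.tubeT.isOpen_dom.mem_nhds H.memT, hne]
    with x hx hxd hxne
  obtain ⟨h2, h3⟩ := hx (faceMap_fst_mem_openPunctured (P.tubeT.emb_mem hxd).1).1
  exact ⟨hxd, h2, hxne, h3⟩

theorem exists_lift_left [IsManifold (𝓡 4) ∞ X] (hg : h = g') (H : FaceMatch b P P' p q) :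
    ∃ φ : X' → X, ContMDiffAt (𝓡 4) (𝓡 4) ∞ φ q ∧ φ q = p ∧
      ∀ᶠ x in 𝓝 q, FaceMatch b P P' (φ x) x := by
  subst hg
  obtain ⟨G, hG, hGq, hev⟩ := P.tubeT.exists_inverse H.memT
  have h1 : ContMDiffAt (𝓡 4) 𝓘(ℝ, (ℝ × ℂ) × ℂ) ∞ (fun x => faceMap b (P'.tubeS.emb x)) q :=
    (contDiffAt_faceMap b (y := P'.tubeS.emb q) H.ne').contMDiffAt.comp q
      (P'.tubeS.contMDiffAt_emb H.memS)
  rw [H.eq_symm] at hG hGq hev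
  refine ⟨fun x => G (faceMap b (P'.tubeS.emb x)), hG.comp q h1, hGq, ?_⟩
  have hne : ∀ᶠ x in 𝓝 q, P'.tubeS.fib x ≠ 0 :=
    (P'.tubeS.continuousOn_fib.continuousAt
      (P'.tubeS.isOpen_dom.mem_nhds H.memS)).eventually_ne H.ne'
  filter_upwards [h1.continuousAt.eventually hev, P'.tubeS.isOpen_dom.mem_nhds H.memS, hne]
    with x hx hxd hxne
  obtain ⟨h2, h3⟩ := hx (faceMap_fst_mem_openPunctured (P'.tubeS.emb_mem hxd).1).1
  refine ⟨h2, hxd, ?_, by rw [h3, faceMap_faceMap]⟩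
  intro h0
  have h4 : (faceMap b (P'.tubeS.emb x)).2 = 0 := (congrArg Prod.snd h3).symm.trans h0
  have h5 := norm_faceMap_snd b (P'.tubeS.emb x)
  rw [h4, norm_zero, eq_comm, inv_eq_zero, norm_eq_zero] at h5
  exact hxne h5

/-- The two radii have product `1` and both exceed `4/5`. -/
theorem norm_fib_lt (H : FaceMatch b P P' p q) (hp : p ∈ P.thick) (hq : q ∈ P'.thick) :
    ‖P.tubeT.fib p‖ < 5 / 4 ∧ ‖P'.tubeS.fib q‖ < 5 / 4 := by
  have h1 := P.fibT_of_mem_thick hp H.memT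
  have h2 := P'.fibS_of_mem_thick hq H.memS
  have h3 := H.norm_mul_norm
  constructor <;> nlinarith

end FaceMatch

/-- A compact set containing all points of the thickened piece matched with another piece. -/
def SurfacePair.collarT (P : SurfacePair X S T g h m n) : Set X :=
  {p | p ∈ P.tubeT.dom ∧ ¬ ((P.tubeT.base p).1 < 0 ∧ ‖(P.tubeT.base p).2‖ < 5 / 4) ∧
    P.tubeT.fib p ∈ {z | 4 / 5 ≤ ‖z‖ ∧ ‖z‖ ≤ 5 / 4}}

/-- A compact set containing all points of the thickened piece matched with another piece. -/
def SurfacePair.collarS (P : SurfacePair X S T g h m n) : Set X :=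
  {p | p ∈ P.tubeS.dom ∧ ¬ ((P.tubeS.base p).1 < 0 ∧ ‖(P.tubeS.base p).2‖ < 5 / 4) ∧
    P.tubeS.fib p ∈ {z | 4 / 5 ≤ ‖z‖ ∧ ‖z‖ ≤ 5 / 4}}

theorem isCompact_annulus {r s : ℝ} : IsCompact {z : ℂ | r ≤ ‖z‖ ∧ ‖z‖ ≤ s} :=
  (isCompact_closedBall (0 : ℂ) s).of_isClosed_subset
    ((isClosed_le continuous_const continuous_norm).inter
      (isClosed_le continuous_norm continuous_const)) fun z hz => by simpa using hz.2

theorem SurfacePair.isCompact_collarT [IsManifold (𝓡 4) ∞ X] (P : SurfacePair X S T g h m n) :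
    IsCompact P.collarT :=
  P.tubeT.isCompact_preimage (by norm_num) isCompact_annulus
    fun z hz => lt_of_le_of_lt hz.2 (by norm_num)

theorem SurfacePair.isCompact_collarS [IsManifold (𝓡 4) ∞ X] (P : SurfacePair X S T g h m n) :
    IsCompact P.collarS :=
  P.tubeS.isCompact_preimage (by norm_num) isCompact_annulus
    fun z hz => lt_of_le_of_lt hz.2 (by norm_num)

namespace FaceMatch

variable {b : Bool} {P : SurfacePair X S T g h m n} {P' : SurfacePair X' S' T' g' h' m' n'}
  {p : X} {q : X'}

/-- If the base point were within `5/4` of the puncture centre, both chart coordinates would be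
smaller than `5/4` in absolute value, and this bidisc has been removed. -/
theorem mem_collar (H : FaceMatch b P P' p q) (hp : p ∈ P.thick) (hq : q ∈ P'.thick) :
    p ∈ P.collarT ∧ q ∈ P'.collarS := by
  obtain ⟨h1, h2⟩ := H.norm_fib_lt hp hq
  have h3 : ¬ ((P.tubeT.base p).1 < 0 ∧ ‖(P.tubeT.base p).2‖ < 5 / 4) := by
    rintro ⟨h4, h5⟩
    have hc := (P.tubeT.mem_chart_iff p H.memT).2 ⟨h4, by linarith⟩
    rw [P.tubeT.base_eq p ⟨H.memT, hc⟩] at h5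
    rw [← P.norm_w₁_eq H.memT hc] at h1
    rcases ((P.mem_thick_iff hc).1 hp).2.2 with h | h <;> linarith
  refine ⟨⟨H.memT, h3, (P.fibT_of_mem_thick hp H.memT).le, h1.le⟩,
    ⟨H.memS, ?_, (P'.fibS_of_mem_thick hq H.memS).le, h2.le⟩⟩
  rwa [H.base_fst, H.norm_base_snd]

/-- Matched pairs in the thickened pieces stay in a product of compact collars. Their limits
therefore remain in the tubes, where the gluing equation passes to the limit. -/
theorem of_frequently [IsManifold (𝓡 4) ∞ X] [T2Space X] [IsManifold (𝓡 4) ∞ X'] [T2Space X']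
    (hf : ∃ᶠ x in 𝓝 p ×ˢ 𝓝 q, x.1 ∈ P.thick ∧ x.2 ∈ P'.thick ∧ FaceMatch b P P' x.1 x.2) :
    FaceMatch b P P' p q := by
  have h1 : ∃ᶠ x in 𝓝 (p, q), x ∈ P.collarT ×ˢ P'.collarS ∧
      P'.tubeS.emb x.2 = faceMap b (P.tubeT.emb x.1) := by
    rw [nhds_prod_eq]
    exact hf.mono fun x hx => ⟨hx.2.2.mem_collar hx.1 hx.2.1, hx.2.2.eq⟩
  have hcl : IsClosed (P.collarT ×ˢ P'.collarS) :=
    P.isCompact_collarT.isClosed.prod P'.isCompact_collarS.isClosed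
  have hmem : (p, q) ∈ P.collarT ×ˢ P'.collarS :=
    isClosed_iff_frequently.1 hcl _ (h1.mono fun x hx => hx.1)
  obtain ⟨hp, hq⟩ := hmem
  have hne : P.tubeT.fib p ≠ 0 := norm_pos_iff.1 (lt_of_lt_of_le (by norm_num) hp.2.2.1)
  refine ⟨hp.1, hq.1, hne, ?_⟩
  have hc1 : ContinuousAt (fun x : X × X' => P'.tubeS.emb x.2) (p, q) :=
    (P'.tubeS.contMDiffAt_emb hq.1).continuousAt.comp continuousAt_snd
  have hc2 : ContinuousAt (fun x : X × X' => faceMap b (P.tubeT.emb x.1)) (p, q) :=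
    ContinuousAt.comp (g := faceMap b) (f := fun x : X × X' => P.tubeT.emb x.1)
      (contDiffAt_faceMap b (y := P.tubeT.emb p) hne).continuousAt
      (ContinuousAt.comp (P.tubeT.contMDiffAt_emb hp.1).continuousAt continuousAt_fst)
  exact tendsto_nhds_unique_of_frequently_eq hc1 hc2 (h1.mono fun x hx => hx.2)

end FaceMatch

end FaceMatch
/-! ### The points of the sum -/

section SumData

open Filter Topology

variable {k : ℕ} {X : ZMod k → Type*} [∀ i, TopologicalSpace (X i)]
  [∀ i, ChartedSpace (EuclideanSpace ℝ (Fin 4)) (X i)]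
  {S T : ∀ i, Set (X i)} {gS gT : ZMod k → ℕ} {m n : ZMod k → ℤ}

/-- Compatible gluings of consecutive pieces: the bases `N i` of the torus at the `i`-th piece are
related by the gluing maps. -/
structure SumData (P : ∀ i, SurfacePair (X i) (S i) (T i) (gS i) (gT i) (m i) (n i)) where
  flip : ZMod k → Bool
  N : ZMod k → Matrix (Fin 2) (Fin 2) ℤ
  genus_eq : ∀ i, gT i = gS (i + 1)
  det_eq : ∀ i, (N i).det = 1
  transport : ∀ i x, torusAct (N (i + 1)) (torusStep (n i + m (i + 1)) (flip i) x) =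
    torusAct (N i) x

theorem SurfacePair.level_coord_pos {X : Type*} [TopologicalSpace X]
    [ChartedSpace (EuclideanSpace ℝ (Fin 4)) X] {S T : Set X} {g h : ℕ} {m n : ℤ}
    (P : SurfacePair X S T g h m n) {p : X} (hp : p ∈ P.thick) (hc : p ∈ P.chart) :
    0 < (level (P.coord p)).re := by
  obtain ⟨h1, h2, h3⟩ := (P.mem_thick_iff hc).1 hp
  exact level_re_pos h1 h2 h3

theorem SurfacePair.coord_ne_zero {X : Type*} [TopologicalSpace X]
    [ChartedSpace (EuclideanSpace ℝ (Fin 4)) X] {S T : Set X} {g h : ℕ} {m n : ℤ}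
    (P : SurfacePair X S T g h m n) {p : X} (hp : p ∈ P.thick) (hc : p ∈ P.chart) :
    (P.coord p).1 ≠ 0 ∧ (P.coord p).2 ≠ 0 := by
  obtain ⟨h1, h2, -⟩ := (P.mem_thick_iff hc).1 hp
  exact ⟨norm_pos_iff.1 (lt_trans (by norm_num) h1), norm_pos_iff.1 (lt_trans (by norm_num) h2)⟩

/-- The open disc around which the pieces are arranged has this radius. -/
noncomputable def coreRadius (k : ℕ) : ℝ :=
  -- This is `(log 3 / log 2) ^ (4/k)`. It corresponds to the circle of radius `log 3` in
  -- logarithmic coordinates; inside it, the part in the quadrant lies in the chart of radius `3`.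
  Real.exp (4 / k / 2 * Real.log (Real.log 3 ^ 2 / Real.log 2 ^ 2))

theorem one_lt_log_three_div : 1 < Real.log 3 ^ 2 / Real.log 2 ^ 2 := by
  have h1 : 0 < Real.log 2 := Real.log_pos one_lt_two
  have h2 : Real.log 2 < Real.log 3 := Real.log_lt_log (by norm_num) (by norm_num)
  rw [one_lt_div (by positivity)]
  gcongr

namespace SumData

variable {P : ∀ i, SurfacePair (X i) (S i) (T i) (gS i) (gT i) (m i) (n i)}

section

variable [NeZero k]

theorem four_div_pos (k : ℕ) [NeZero k] : (0 : ℝ) < 4 / k := by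
  have : (0 : ℝ) < k := by exact_mod_cast NeZero.pos k
  positivity

theorem four_div_le (k : ℕ) [Fact (1 < k)] : (4 / k : ℝ) ≤ 2 := by
  have : (2 : ℝ) ≤ k := by exact_mod_cast (Fact.out : 1 < k)
  rw [div_le_iff₀ (by linarith)]
  linarith

theorem one_lt_coreRadius (k : ℕ) [NeZero k] : 1 < coreRadius k := by
  rw [coreRadius, Real.one_lt_exp_iff]
  exact mul_pos (half_pos (four_div_pos k)) (Real.log_pos one_lt_log_three_div)

/-- The coordinates of the core on the part of a piece where it is attached. -/
noncomputable def coreCoord (D : SumData P) (i : ZMod k) (p : X i) : (Circle × Circle) × ℂ :=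
  coreMap (D.N i) (ZMod.toCircle i) (4 / k) ((P i).coord p)

/-- Points of consecutive pieces which are identified. -/
inductive Face (D : SumData P) :
    (Σ i, X i) ⊕ ((Circle × Circle) × ℂ) → (Σ i, X i) ⊕ ((Circle × Circle) × ℂ) → Prop
  | mk (i : ZMod k) (p : X i) (q : X (i + 1)) (hp : p ∈ (P i).thick) (hq : q ∈ (P (i + 1)).thick)
      (H : FaceMatch (D.flip i) (P i) (P (i + 1)) p q) : Face D (.inl ⟨i, p⟩) (.inl ⟨i + 1, q⟩)

/-- Points having a given image in the core. -/
inductive Core (D : SumData P) :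
    (Σ i, X i) ⊕ ((Circle × Circle) × ℂ) → (Circle × Circle) × ℂ → Prop
  | piece (i : ZMod k) (p : X i) (hp : p ∈ (P i).thick) (hc : p ∈ (P i).chart) :
      Core D (.inl ⟨i, p⟩) (D.coreCoord i p)
  | core (d : (Circle × Circle) × ℂ) : Core D (.inr d) d

/-- The rotation of the level is absorbed by the root of unity, and the change of angles by the
compatibility `transport` of the matrices. -/
theorem coreCoord_eq_of_faceMatch (D : SumData P) {i : ZMod k} {p : X i} {q : X (i + 1)}
    (hp : p ∈ (P i).thick) (hc : p ∈ (P i).chart)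
    (H : FaceMatch (D.flip i) (P i) (P (i + 1)) p q) : D.coreCoord (i + 1) q = D.coreCoord i p := by
  obtain ⟨h1, h2, h3⟩ := H.coords hc
  refine coreMap_succ i (level_rotate ?_ ?_) ((P i).level_coord_pos hp hc) ?_
  · exact congrArg Real.log h1
  · exact (congrArg Real.log h2).trans (Real.log_inv _)
  · exact (congrArg _ h3).trans (D.transport i _)

theorem faceMatch_of_coreCoord_eq (D : SumData P) {i : ZMod k} {p : X i} {q : X (i + 1)}
    (hp : p ∈ (P i).thick) (hc : p ∈ (P i).chart) (hq : q ∈ (P (i + 1)).thick)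
    (hqc : q ∈ (P (i + 1)).chart) (h : D.coreCoord i p = D.coreCoord (i + 1) q)
    (hl : level ((P (i + 1)).coord q) = -Complex.I * level ((P i).coord p)) :
    FaceMatch (D.flip i) (P i) (P (i + 1)) p q := by
  obtain ⟨h1, h2⟩ := log_norm_eq_of_level_rotate hl
  obtain ⟨hp1, hp2⟩ := (P i).coord_ne_zero hp hc
  obtain ⟨hq1, hq2⟩ := (P (i + 1)).coord_ne_zero hq hqc
  refine FaceMatch.of_coords (D.genus_eq i) hp hc hq hqc ?_ ?_ ?_
  · exact Real.log_injOn_pos (norm_pos_iff.2 hq1) (norm_pos_iff.2 hp2) h1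
  · rw [← Real.log_inv] at h2
    exact Real.log_injOn_pos (norm_pos_iff.2 hq2) (inv_pos.2 (norm_pos_iff.2 hp1)) h2
  · have h3 := congrArg Prod.fst h
    have h4 := D.transport i (unitPart ((P i).w₁ p), unitPart ((P i).w₂ p))
    have h5 := congrArg (torusAct (D.N (i + 1)).adjugate) (h4.trans h3)
    rw [torusAct_adjugate_cancel (D.det_eq _)] at h5
    exact (h5.trans (torusAct_adjugate_cancel (D.det_eq (i + 1)) _)).symm

/-- Attaching the core thus identifies no points of the pieces beyond those already identified by
faces. -/
theorem eq_or_face_of_coreCoord_eq (D : SumData P) {i j : ZMod k} {p : X i} {q : X j}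
    (hp : p ∈ (P i).thick) (hc : p ∈ (P i).chart) (hq : q ∈ (P j).thick)
    (hqc : q ∈ (P j).chart) (h : D.coreCoord i p = D.coreCoord j q) :
    (⟨i, p⟩ : Σ i, X i) = ⟨j, q⟩ ∨ D.Face (.inl ⟨i, p⟩) (.inl ⟨j, q⟩) ∨
      D.Face (.inl ⟨j, q⟩) (.inl ⟨i, p⟩) := by
  rcases level_of_coreMap_eq ((P i).level_coord_pos hp hc) ((P j).level_coord_pos hq hqc)
    (congrArg Prod.snd h) with ⟨rfl, hl⟩ | ⟨rfl, hl⟩ | ⟨rfl, hl⟩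
  · left
    obtain ⟨h1, h2⟩ := log_norm_eq_of_level_eq hl
    obtain ⟨hp1, hp2⟩ := (P j).coord_ne_zero hp hc
    obtain ⟨hq1, hq2⟩ := (P j).coord_ne_zero hq hqc
    have h3 := congrArg (fun x => torusAct (D.N j).adjugate x.1) h
    have h4 := (torusAct_adjugate_cancel (D.det_eq j) _).symm.trans
      (h3.trans (torusAct_adjugate_cancel (D.det_eq j) _))
    congr 1
    refine (P j).injOn hc hqc (Prod.ext ?_ ?_)
    · exact eq_of_norm_eq_of_unitPart_eq
        (Real.log_injOn_pos (norm_pos_iff.2 hp1) (norm_pos_iff.2 hq1) h1.symm)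
        (congrArg Prod.fst h4)
    · exact eq_of_norm_eq_of_unitPart_eq
        (Real.log_injOn_pos (norm_pos_iff.2 hp2) (norm_pos_iff.2 hq2) h2.symm)
        (congrArg Prod.snd h4)
  · exact Or.inr (Or.inl ⟨i, p, q, hp, hq, D.faceMatch_of_coreCoord_eq hp hc hq hqc h hl⟩)
  · exact Or.inr (Or.inr ⟨j, q, p, hq, hp, D.faceMatch_of_coreCoord_eq hq hqc hp hc h.symm hl⟩)

variable {D : SumData P} {x y z : (Σ i, X i) ⊕ ((Circle × Circle) × ℂ)}
  {d e : (Circle × Circle) × ℂ}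

theorem Core.unique (h : D.Core x d) (h' : D.Core x e) : d = e := by
  cases h <;> cases h' <;> rfl

theorem Face.core_iff (h : D.Face x y) : D.Core x d ↔ D.Core y d := by
  obtain ⟨i, p, q, hp, hq, H⟩ := h
  constructor
  · intro hd
    cases hd with
    | piece _ _ _ hc =>
      rw [← D.coreCoord_eq_of_faceMatch hp hc H]
      exact .piece _ _ hq (H.mem_chart_iff.1 hc)
  · intro hd
    cases hd with
    | piece _ _ _ hc =>
      rw [D.coreCoord_eq_of_faceMatch hp (H.mem_chart_iff.2 hc) H]
      exact .piece _ _ hp (H.mem_chart_iff.2 hc)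

omit [NeZero k] in
theorem Face.right_unique (h : D.Face x y) (h' : D.Face x z) : y = z := by
  obtain ⟨i, p, q, hp, hq, H⟩ := h
  cases h' with
  | mk _ _ q' _ _ H' => rw [H.right_unique H']

omit [NeZero k] in
theorem faceMatch_of_face {i j : ZMod k} {p : X i} {q : X j}
    (h : D.Face (.inl ⟨i, p⟩) (.inl ⟨j, q⟩)) : ∃ h : i + 1 = j, p ∈ (P i).thick ∧ q ∈ (P j).thick ∧
      FaceMatch (D.flip i) (P i) (P (i + 1)) p (h ▸ q) := by
  generalize hy : (Sum.inl ⟨j, q⟩ : (Σ i, X i) ⊕ ((Circle × Circle) × ℂ)) = y at h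
  cases h with
  | mk _ _ q' hp hq H =>
    cases hy
    exact ⟨rfl, hp, hq, H⟩

omit [NeZero k] in
theorem Face.left_unique (h : D.Face x z) (h' : D.Face y z) : x = y := by
  obtain ⟨i, p, q, hp, hq, H⟩ := h
  cases y with
  | inr d => cases h'
  | inl y =>
    obtain ⟨j, p'⟩ := y
    obtain ⟨hji, -, -, H'⟩ := faceMatch_of_face h'
    obtain rfl : j = i := add_right_cancel hji
    rw [H.left_unique H']

-- A point glued along both its `S`-face and its `T`-face would lie in both tubes, hence in the
-- chart, with both coordinates below `5/4` in absolute value. That bidisc is not part of the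
-- thickened piece, so face gluings never compose.
omit [NeZero k] in
theorem Face.not_face (h : D.Face x y) (h' : D.Face y z) : False := by
  obtain ⟨i, p, q, hp, hq, H⟩ := h
  cases h' with
  | mk _ _ r _ hr H' =>
    have hc := (P (i + 1)).inter_subset ⟨H.memS, H'.memT⟩
    have h1 := (H.norm_fib_lt hp hq).2
    have h2 := (H'.norm_fib_lt hq hr).1
    rw [← (P (i + 1)).norm_w₂_eq H.memS hc] at h1
    rw [← (P (i + 1)).norm_w₁_eq H'.memT hc] at h2
    rcases (((P (i + 1)).mem_thick_iff hc).1 hq).2.2 with h | h <;> linarith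

variable (D) in
/-- Points to be identified in the sum. -/
def Rel (x y : (Σ i, X i) ⊕ ((Circle × Circle) × ℂ)) : Prop :=
  x = y ∨ (∃ d, D.Core x d ∧ D.Core y d) ∨ D.Face x y ∨ D.Face y x

theorem Rel.symm (h : D.Rel x y) : D.Rel y x := by
  rcases h with rfl | ⟨d, h1, h2⟩ | h | h
  · exact Or.inl rfl
  · exact Or.inr (Or.inl ⟨d, h2, h1⟩)
  · exact Or.inr (Or.inr (Or.inr h))
  · exact Or.inr (Or.inr (Or.inl h))

/-- Core coordinates are invariant under face gluings, and two successive face gluings can only be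
inverse to each other. -/
theorem Rel.trans (h : D.Rel x y) (h' : D.Rel y z) : D.Rel x z := by
  rcases h with rfl | ⟨d, h1, h2⟩ | h | h
  · exact h'
  · rcases h' with rfl | ⟨e, h3, h4⟩ | h' | h'
    · exact Or.inr (Or.inl ⟨d, h1, h2⟩)
    · exact Or.inr (Or.inl ⟨d, h1, h2.unique h3 ▸ h4⟩)
    · exact Or.inr (Or.inl ⟨d, h1, h'.core_iff.1 h2⟩)
    · exact Or.inr (Or.inl ⟨d, h1, h'.core_iff.2 h2⟩)
  · rcases h' with rfl | ⟨e, h3, h4⟩ | h' | h'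
    · exact Or.inr (Or.inr (Or.inl h))
    · exact Or.inr (Or.inl ⟨e, h.core_iff.2 h3, h4⟩)
    · exact (h.not_face h').elim
    · exact Or.inl (h.left_unique h')
  · rcases h' with rfl | ⟨e, h3, h4⟩ | h' | h'
    · exact Or.inr (Or.inr (Or.inr h))
    · exact Or.inr (Or.inl ⟨e, h.core_iff.1 h3, h4⟩)
    · exact Or.inl (h.right_unique h')
    · exact (h'.not_face h).elim

variable (P) in
/-- The points of the open sets from which the sum is glued. -/
def Good : Set ((Σ i, X i) ⊕ ((Circle × Circle) × ℂ)) :=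
  {x | Sum.elim (fun p => p.2 ∈ (P p.1).thick) (fun d => ‖d.2‖ < coreRadius k) x}

variable (D) in
/-- The equivalence relation defining the sum. -/
def setoid : Setoid (Good P) where
  r x y := D.Rel x y
  iseqv := ⟨fun _ => Or.inl rfl, Rel.symm, Rel.trans⟩

variable (D) in
/-- The underlying set of the sum. -/
def Space : Type _ := Quotient D.setoid

open Classical in
variable (D) in
/-- The map to the sum, with an arbitrary value outside the open sets being glued. -/
noncomputable def proj (x : (Σ i, X i) ⊕ ((Circle × Circle) × ℂ)) : D.Space :=
  Quotient.mk D.setoid (if h : x ∈ Good P then ⟨x, h⟩ else ⟨.inr (1, 0), by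
    change ‖(0 : ℂ)‖ < _
    rw [norm_zero]
    exact one_pos.trans (one_lt_coreRadius k)⟩)

theorem proj_eq_iff (hx : x ∈ Good P) (hy : y ∈ Good P) : D.proj x = D.proj y ↔ D.Rel x y := by
  rw [proj, proj, dif_pos hx, dif_pos hy]
  exact Quotient.eq (r := D.setoid)

theorem exists_proj_eq (s : D.Space) : ∃ x ∈ Good P, D.proj x = s := by
  obtain ⟨x, rfl⟩ := Quotient.exists_rep s
  refine ⟨x, x.2, ?_⟩
  rw [proj, dif_pos x.2]

theorem proj_inr_eq_iff (hd : ‖d.2‖ < coreRadius k) (he : ‖e.2‖ < coreRadius k) :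
    D.proj (.inr d) = D.proj (.inr e) ↔ d = e := by
  rw [proj_eq_iff hd he]
  constructor
  · rintro (h | ⟨d, h1, h2⟩ | h | h)
    · exact Sum.inr_injective h
    · cases h1; cases h2; rfl
    · cases h
    · cases h
  · rintro rfl
    exact Or.inl rfl

theorem proj_inl_eq_inr_iff {i : ZMod k} {p : X i} (hp : p ∈ (P i).thick)
    (hd : ‖d.2‖ < coreRadius k) :
    D.proj (.inl ⟨i, p⟩) = D.proj (.inr d) ↔ p ∈ (P i).chart ∧ D.coreCoord i p = d := by
  rw [proj_eq_iff hp hd]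
  constructor
  · rintro (h | ⟨d, h1, h2⟩ | h | h)
    · cases h
    · cases h2
      cases h1 with
      | piece _ _ _ hc => exact ⟨hc, rfl⟩
    · cases h
    · cases h
  · rintro ⟨hc, rfl⟩
    exact Or.inr (Or.inl ⟨_, .piece i p hp hc, .core _⟩)

theorem proj_inl_eq_inl_iff {i j : ZMod k} {p : X i} {q : X j} (hp : p ∈ (P i).thick)
    (hq : q ∈ (P j).thick) : D.proj (.inl ⟨i, p⟩) = D.proj (.inl ⟨j, q⟩) ↔
      (⟨i, p⟩ : Σ i, X i) = ⟨j, q⟩ ∨ D.Face (.inl ⟨i, p⟩) (.inl ⟨j, q⟩) ∨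
      D.Face (.inl ⟨j, q⟩) (.inl ⟨i, p⟩) := by
  rw [proj_eq_iff hp hq]
  constructor
  · rintro (h | ⟨d, h1, h2⟩ | h)
    · exact Or.inl (Sum.inl_injective h)
    · cases h1 with
      | piece _ _ _ hc =>
        generalize hd : D.coreCoord i p = d at h2
        cases h2 with
        | piece _ _ _ hc' => exact D.eq_or_face_of_coreCoord_eq hp hc hq hc' hd
    · exact Or.inr h
  · rintro (h | h)
    · exact Or.inl (congrArg _ h)
    · exact Or.inr (Or.inr h)

theorem proj_inl_injOn [Fact (1 < k)] (i : ZMod k) :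
    InjOn (fun p : X i => D.proj (.inl ⟨i, p⟩)) (P i).thick := by
  intro p hp q hq h
  have hi : i + 1 ≠ i := by
    intro h
    exact one_ne_zero (add_eq_left.1 h)
  rcases (proj_inl_eq_inl_iff hp hq).1 h with h | h | h
  · exact eq_of_heq (Sigma.mk.inj h).2
  · exact absurd (faceMatch_of_face h).1 hi
  · exact absurd (faceMatch_of_face h).1 hi

end

end SumData

end SumData
/-! ### The sum as a manifold -/

section Assembly

open Filter Topology

variable {k : ℕ} [NeZero k] [Fact (1 < k)] {X : ZMod k → Type u} [∀ i, TopologicalSpace (X i)]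
  [∀ i, ChartedSpace (EuclideanSpace ℝ (Fin 4)) (X i)]
  {S T : ∀ i, Set (X i)} {gS gT : ZMod k → ℕ} {m n : ZMod k → ℤ}
  {P : ∀ i, SurfacePair (X i) (S i) (T i) (gS i) (gT i) (m i) (n i)}

namespace SumData

omit [Fact (1 < k)] in
theorem contMDiffAt_coreCoord (D : SumData P) {i : ZMod k} {p : X i} (hp : p ∈ (P i).thick)
    (hc : p ∈ (P i).chart) :
    ContMDiffAt (𝓡 4) (((𝓡 1).prod (𝓡 1)).prod 𝓘(ℝ, ℂ)) ∞ (D.coreCoord i) p := by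
  obtain ⟨h1, h2⟩ := (P i).coord_ne_zero hp hc
  exact (contMDiffAt_coreMap _ _ _ h1 h2 ((P i).level_coord_pos hp hc)).comp p
    ((P i).contMDiffAt_coord hc)

/-- The inverse is `coreInv` followed by the local inverse of the chart. The argument bounds are
strict at the point in question, so they persist nearby and keep the principal branch valid. -/
theorem exists_coreCoord_inverse [∀ i, IsManifold (𝓡 4) ∞ (X i)] [∀ i, T2Space (X i)]
    (D : SumData P) {i : ZMod k} {p : X i} (hp : p ∈ (P i).thick) (hc : p ∈ (P i).chart) :
    ∃ φ : (Circle × Circle) × ℂ → X i,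
      ContMDiffAt (((𝓡 1).prod (𝓡 1)).prod 𝓘(ℝ, ℂ)) (𝓡 4) ∞ φ (D.coreCoord i p) ∧
      φ (D.coreCoord i p) = p ∧
      ∀ᶠ y in 𝓝 (D.coreCoord i p), φ y ∈ (P i).thick ∧ φ y ∈ (P i).chart ∧
        D.coreCoord i (φ y) = y := by
  obtain ⟨h1, h2⟩ := (P i).coord_ne_zero hp hc
  have hw := (P i).level_coord_pos hp hc
  set y₀ := D.coreCoord i p with hy₀
  have hinv : coreInv (D.N i) (ZMod.toCircle i) (4 / k) y₀ = (P i).coord p :=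
    coreInv_coreMap (D.det_eq i) _ (four_div_pos k) (four_div_le k) h1 h2 hw
  have hne : y₀.2 ≠ 0 := mul_ne_zero (Circle.coe_ne_zero _) (Complex.exp_ne_zero _)
  have harg := abs_arg_coreMap_snd_div (D.N i) (ZMod.toCircle i) (four_div_pos k)
    (four_div_le k) hw
  have harg' : |(y₀.2 / (ZMod.toCircle i : ℂ)).arg| < 4 / k * Real.pi := by
    rw [← Complex.log_im, hy₀, coreCoord,
      log_coreMap_snd_div _ _ (four_div_pos k) (four_div_le k) hw, Complex.im_ofReal_mul,
      Complex.log_im, abs_mul, abs_of_pos (four_div_pos k)]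
    have := abs_arg_lt_of_re_pos hw
    have := Real.pi_pos
    exact mul_lt_mul_of_pos_left (by linarith) (four_div_pos k)
  have hslit : y₀.2 / (ZMod.toCircle i : ℂ) ∈ Complex.slitPlane := by
    refine Complex.mem_slitPlane_iff_arg.2
      ⟨fun h => ?_, div_ne_zero hne (Circle.coe_ne_zero _)⟩
    rw [hy₀, coreCoord] at h
    rw [h, abs_of_pos Real.pi_pos] at harg
    exact lt_irrefl _ harg
  obtain ⟨G, hG, hGp, hev⟩ := (P i).exists_inverse hc
  have hcI := contMDiffAt_coreInv (D.N i) (ZMod.toCircle i) (4 / k) hslit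
  rw [← hinv] at hG hGp hev
  refine ⟨fun y => G (coreInv (D.N i) (ZMod.toCircle i) (4 / k) y), hG.comp y₀ hcI, hGp, ?_⟩
  have hthick : ∀ᶠ y in 𝓝 y₀, G (coreInv (D.N i) (ZMod.toCircle i) (4 / k) y) ∈ (P i).thick :=
    (hG.comp y₀ hcI).continuousAt.preimage_mem_nhds
      ((P i).isOpen_thick.mem_nhds (by rw [Function.comp_apply, hGp]; exact hp))
  have hdiv : ContinuousAt (fun y : (Circle × Circle) × ℂ => y.2 / (ZMod.toCircle i : ℂ)) y₀ :=
    continuousAt_snd.div_const _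
  have hargev : ∀ᶠ y in 𝓝 y₀, |(y.2 / (ZMod.toCircle i : ℂ)).arg| < 4 / k * Real.pi :=
    ((Complex.continuousAt_arg hslit).comp
      (f := fun y : (Circle × Circle) × ℂ => y.2 / (ZMod.toCircle i : ℂ)) hdiv).abs.eventually
        (gt_mem_nhds harg')
  filter_upwards [hcI.continuousAt.eventually hev, hthick, hargev,
    continuousAt_snd.eventually_ne hne] with y hy hyt hya hyn
  refine ⟨hyt, hy.1, ?_⟩
  rw [coreCoord, hy.2, coreMap_coreInv (D.det_eq i) _ (four_div_pos k) hyn hya]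

/-- The model vector space of the core and that of the pieces have the same dimension. -/
noncomputable def coreModelEquiv : ((EuclideanSpace ℝ (Fin 1) × EuclideanSpace ℝ (Fin 1)) × ℂ) ≃L[ℝ]
    EuclideanSpace ℝ (Fin 4) :=
  ContinuousLinearEquiv.ofFinrankEq (by simp [Complex.finrank_real_complex])

end SumData

/-- The manifolds from which the sum is glued. -/
def SumPart (X : ZMod k → Type u) : Option (ZMod k) → Type u
  | none => ULift.{u} ((Circle × Circle) × ℂ)
  | some i => X i

instance (a : Option (ZMod k)) : TopologicalSpace (SumPart X a) :=
  match a with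
  | none => inferInstanceAs (TopologicalSpace (ULift.{u} ((Circle × Circle) × ℂ)))
  | some i => inferInstanceAs (TopologicalSpace (X i))

noncomputable instance (a : Option (ZMod k)) :
    ChartedSpace (EuclideanSpace ℝ (Fin 4)) (SumPart X a) :=
  match a with
  | none => (remodel (((𝓡 1).prod (𝓡 1)).prod 𝓘(ℝ, ℂ)) SumData.coreModelEquiv :
      ChartedSpace (EuclideanSpace ℝ (Fin 4)) (ULift.{u} ((Circle × Circle) × ℂ)))
  | some i => inferInstanceAs (ChartedSpace (EuclideanSpace ℝ (Fin 4)) (X i))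

instance [∀ i, IsManifold (𝓡 4) ∞ (X i)] (a : Option (ZMod k)) :
    IsManifold (𝓡 4) ∞ (SumPart X a) :=
  match a with
  | none => isManifold_remodel.{u} (((𝓡 1).prod (𝓡 1)).prod 𝓘(ℝ, ℂ)) SumData.coreModelEquiv
  | some i => inferInstanceAs (IsManifold (𝓡 4) ∞ (X i))

namespace SumData

omit [NeZero k] [Fact (1 < k)] in
theorem contMDiff_corePart_up : ContMDiff (M' := SumPart X none)
    (((𝓡 1).prod (𝓡 1)).prod 𝓘(ℝ, ℂ)) (𝓡 4) ∞ ULift.up :=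
  contMDiff_remodel_up.{u} (((𝓡 1).prod (𝓡 1)).prod 𝓘(ℝ, ℂ)) coreModelEquiv

omit [NeZero k] [Fact (1 < k)] in
theorem contMDiff_corePart_down : ContMDiff (M := SumPart X none)
    (𝓡 4) (((𝓡 1).prod (𝓡 1)).prod 𝓘(ℝ, ℂ)) ∞ ULift.down :=
  contMDiff_remodel_down.{u} (((𝓡 1).prod (𝓡 1)).prod 𝓘(ℝ, ℂ)) coreModelEquiv

/-- The parametrizations of the sum. -/
noncomputable def param (D : SumData P) : ∀ a, SumPart X a → D.Space
  | none, d => D.proj (.inr (ULift.down d))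
  | some i, p => D.proj (.inl ⟨i, p⟩)

/-- The domains of the parametrizations of the sum. -/
def dom (P : ∀ i, SurfacePair (X i) (S i) (T i) (gS i) (gT i) (m i) (n i)) :
    ∀ a, Set (SumPart X a)
  | none => {d | ‖(ULift.down d).2‖ < coreRadius k}
  | some i => (P i).thick

variable [∀ i, IsManifold (𝓡 4) ∞ (X i)] [∀ i, T2Space (X i)]

omit [Fact (1 < k)] in
theorem compat_of_face (D : SumData P) {i j : ZMod k} {p : X i} {q : X j}
    (h : D.Face (.inl ⟨i, p⟩) (.inl ⟨j, q⟩)) :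
    (∃ φ : X i → X j, ContMDiffAt (𝓡 4) (𝓡 4) ∞ φ p ∧ φ p = q ∧
      ∀ᶠ x in 𝓝 p, D.proj (.inl ⟨j, φ x⟩) = D.proj (.inl ⟨i, x⟩)) ∧
    ∃ φ : X j → X i, ContMDiffAt (𝓡 4) (𝓡 4) ∞ φ q ∧ φ q = p ∧
      ∀ᶠ x in 𝓝 q, D.proj (.inl ⟨i, φ x⟩) = D.proj (.inl ⟨j, x⟩) := by
  obtain ⟨rfl, hp, hq, H⟩ := faceMatch_of_face h
  constructor
  · obtain ⟨φ, hφ, hφp, hev⟩ := H.exists_lift_right (D.genus_eq i)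
    refine ⟨φ, hφ, hφp, ?_⟩
    filter_upwards [hev, (P i).isOpen_thick.mem_nhds hp, hφ.continuousAt.preimage_mem_nhds
      ((P (i + 1)).isOpen_thick.mem_nhds (hφp ▸ hq))] with x hx hxp hxq
    exact (proj_inl_eq_inl_iff hxq hxp).2 (Or.inr (Or.inr ⟨i, x, φ x, hxp, hxq, hx⟩))
  · obtain ⟨φ, hφ, hφp, hev⟩ := H.exists_lift_left (D.genus_eq i)
    refine ⟨φ, hφ, hφp, ?_⟩
    filter_upwards [hev, (P (i + 1)).isOpen_thick.mem_nhds hq, hφ.continuousAt.preimage_mem_nhds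
      ((P i).isOpen_thick.mem_nhds (hφp ▸ hp))] with x hx hxq hxp
    exact (proj_inl_eq_inl_iff hxp hxq).2 (Or.inr (Or.inl ⟨i, φ x, x, hxp, hxq, hx⟩))

/-- The sum as a gluing of manifolds. -/
noncomputable def gluing (D : SumData P) :
    SmoothGluing (EuclideanSpace ℝ (Fin 4)) (SumPart X) D.Space where
  toFun := D.param
  dom := dom P
  isOpen_dom
    | none => (isOpen_Iio (a := coreRadius k)).preimage
        ((continuous_snd.comp continuous_uliftDown).norm :
          Continuous fun d : ULift.{u} ((Circle × Circle) × ℂ) => ‖d.down.2‖)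
    | some i => (P i).isOpen_thick
  injOn
    | none => fun _ hx _ hy h => ULift.down_injective ((proj_inr_eq_iff hx hy).1 h)
    | some i => proj_inl_injOn i
  cover s := by
    obtain ⟨x | d, hx, rfl⟩ := exists_proj_eq s
    · exact ⟨some x.1, x.2, hx, rfl⟩
    · exact ⟨none, ULift.up d, hx, rfl⟩
  compat
    | none, none => fun d hd e he h =>
        ⟨id, contMDiffAt_id, ULift.down_injective ((proj_inr_eq_iff hd he).1 h),
          .of_forall fun _ => rfl⟩
    | none, some i => fun d hd p hp h => by
        obtain ⟨hc, hpd⟩ := (proj_inl_eq_inr_iff hp hd).1 h.symm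
        obtain ⟨φ, hφ, hφp, hev⟩ := D.exists_coreCoord_inverse hp hc
        rw [hpd] at hφ hφp hev
        have hdown := (contMDiff_corePart_down (X := X)).contMDiffAt (x := d)
        refine ⟨fun x => φ (ULift.down x), hφ.comp d hdown, hφp, ?_⟩
        filter_upwards [hdown.continuousAt.eventually hev,
          ((isOpen_Iio (a := coreRadius k)).preimage
            (continuous_snd.comp (contMDiff_corePart_down (X := X)).continuous).norm).mem_nhds hd]
          with x hx hxd
        exact (proj_inl_eq_inr_iff hx.1 hxd).2 ⟨hx.2.1, hx.2.2⟩
    | some i, none => fun p hp d hd h => by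
        obtain ⟨hc, hpd⟩ := (proj_inl_eq_inr_iff hp hd).1 h
        have hcc := D.contMDiffAt_coreCoord hp hc
        refine ⟨fun x => ULift.up (D.coreCoord i x),
          (contMDiff_corePart_up (X := X)).contMDiffAt.comp p hcc,
          ULift.down_injective hpd, ?_⟩
        filter_upwards [(P i).isOpen_thick.mem_nhds hp, (P i).isOpen_chart.mem_nhds hc,
          (continuousAt_snd.comp hcc.continuousAt).norm.eventually_lt continuousAt_const
            (show ‖(D.coreCoord i p).2‖ < coreRadius k by rw [hpd]; exact hd)] with x hx hxc hxd
        exact ((proj_inl_eq_inr_iff hx hxd).2 ⟨hxc, rfl⟩).symm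
    | some i, some j => fun p hp q hq h => by
        rcases (proj_inl_eq_inl_iff hp hq).1 h with h | h | h
        · cases h
          exact ⟨id, contMDiffAt_id, rfl, .of_forall fun _ => rfl⟩
        · exact (D.compat_of_face h).1
        · exact (D.compat_of_face h).2

end SumData

end Assembly
/-! ### The pieces and the core cover the sum -/

namespace SurfacePair

variable {X : Type*} [TopologicalSpace X] [ChartedSpace (EuclideanSpace ℝ (Fin 4)) X]
  {S T : Set X} {g h : ℕ} {m n : ℤ}

theorem mem_piece_iff_radSq (P : SurfacePair X S T g h m n) {p : X} (hc : p ∈ P.chart) :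
    p ∈ P.piece ↔ 1 ≤ ‖P.w₁ p‖ ∧ 1 ≤ ‖P.w₂ p‖ ∧ 1 ≤ radSq (P.coord p) := by
  have h2 : 0 < Real.log 2 := Real.log_pos one_lt_two
  rw [P.mem_piece_iff hc, radSq, one_le_div (by positivity)]
  rfl

theorem mem_hopf_iff (P : SurfacePair X S T g h m n) {p : X} :
    p ∈ P.hopf ↔ p ∈ P.chart ∧ 1 ≤ ‖P.w₁ p‖ ∧ 1 ≤ ‖P.w₂ p‖ ∧ radSq (P.coord p) = 1 := by
  have h2 : 0 < Real.log 2 := Real.log_pos one_lt_two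
  rw [radSq, div_eq_one_iff_eq (by positivity)]
  rfl

theorem hopf_subset_piece (P : SurfacePair X S T g h m n) : P.hopf ⊆ P.piece := by
  intro p hp
  obtain ⟨hc, h1, h2, h3⟩ := P.mem_hopf_iff.1 hp
  exact (P.mem_piece_iff_radSq hc).2 ⟨h1, h2, h3.ge⟩

theorem mem_tubeS_of_notMem_piece (P : SurfacePair X S T g h m n) {p : X} (hp : p ∈ P.thick)
    (hc : p ∈ P.chart) (h2 : ‖P.w₂ p‖ < 1) : p ∈ P.tubeS.dom ∧ ‖P.tubeS.fib p‖ < 1 := by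
  have h3 := (P.mem_thick_iff hc).1 hp
  have h4 : p ∈ P.tubeS.dom := by
    refine (P.tubeS.mem_dom_iff p hc).2 ?_
    rcases h3.2.2 with h | h <;> linarith
  exact ⟨h4, P.norm_w₂_eq h4 hc ▸ h2⟩

theorem mem_tubeT_of_notMem_piece (P : SurfacePair X S T g h m n) {p : X} (hp : p ∈ P.thick)
    (hc : p ∈ P.chart) (h1 : ‖P.w₁ p‖ < 1) : p ∈ P.tubeT.dom ∧ ‖P.tubeT.fib p‖ < 1 := by
  have h3 := (P.mem_thick_iff hc).1 hp
  have h4 : p ∈ P.tubeT.dom := by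
    refine (P.tubeT.mem_dom_iff p hc).2 ?_
    rcases h3.2.2 with h | h <;> linarith
  exact ⟨h4, P.norm_w₁_eq h4 hc ▸ h1⟩

/-- The four types of points of the thickened piece. -/
theorem thick_cases (P : SurfacePair X S T g h m n) {p : X} (hp : p ∈ P.thick) :
    p ∈ P.piece ∨ (p ∈ P.chart ∧ radSq (P.coord p) < 1) ∨
      (p ∈ P.tubeS.dom ∧ ‖P.tubeS.fib p‖ < 1) ∨ (p ∈ P.tubeT.dom ∧ ‖P.tubeT.fib p‖ < 1) := by
  by_cases hc : p ∈ P.chart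
  · rcases lt_or_ge ‖P.w₁ p‖ 1 with h1 | h1
    · exact Or.inr (Or.inr (Or.inr (P.mem_tubeT_of_notMem_piece hp hc h1)))
    · rcases lt_or_ge ‖P.w₂ p‖ 1 with h2 | h2
      · exact Or.inr (Or.inr (Or.inl (P.mem_tubeS_of_notMem_piece hp hc h2)))
      · rcases lt_or_ge (radSq (P.coord p)) 1 with h3 | h3
        · exact Or.inr (Or.inl ⟨hc, h3⟩)
        · exact Or.inl ((P.mem_piece_iff_radSq hc).2 ⟨h1, h2, h3⟩)
  · by_contra! h
    exact h.1 (P.mem_piece_of_notMem_chart hc (h.2.2.1 ·) (h.2.2.2 ·))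

end SurfacePair

namespace FaceMatch

variable {X : Type*} [TopologicalSpace X] [ChartedSpace (EuclideanSpace ℝ (Fin 4)) X]
  {S T : Set X} {g h : ℕ} {m n : ℤ}
  {X' : Type*} [TopologicalSpace X'] [ChartedSpace (EuclideanSpace ℝ (Fin 4)) X']
  {S' T' : Set X'} {g' h' : ℕ} {m' n' : ℤ}
  {b : Bool} {P : SurfacePair X S T g h m n} {P' : SurfacePair X' S' T' g' h' m' n'}
  {p : X} {q : X'}

/-- Crossing the `T`-face from inside the tube leads outside the `S`-tube of the next piece. What
could still be missing there is the corner ball, and that part is covered by the core. -/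
theorem right_mem (H : FaceMatch b P P' p q) (hp : p ∈ P.thick) (hf : ‖P.tubeT.fib p‖ < 1) :
    q ∈ P'.thick ∧ (q ∈ P'.piece ∨ (q ∈ P'.chart ∧ radSq (P'.coord q) < 1)) := by
  have h0 := P.fibT_of_mem_thick hp H.memT
  have hmul := H.norm_mul_norm
  have hq1 : 1 < ‖P'.tubeS.fib q‖ := by nlinarith
  by_cases hc : q ∈ P'.chart
  · have hpc := H.mem_chart_iff.2 hc
    have h1 := P.norm_w₁_eq H.memT hpc
    have h2 := P'.norm_w₂_eq H.memS hc
    have h3 := (H.coords hpc).1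
    have h4 : 5 / 4 < ‖P.w₂ p‖ := by
      rcases ((P.mem_thick_iff hpc).1 hp).2.2 with h | h
      · linarith
      · exact h
    refine ⟨(P'.mem_thick_iff hc).2 ⟨by linarith, by linarith, Or.inl (by linarith)⟩, ?_⟩
    rcases lt_or_ge (radSq (P'.coord q)) 1 with h5 | h5
    · exact Or.inr ⟨hc, h5⟩
    · exact Or.inl ((P'.mem_piece_iff_radSq hc).2 ⟨by linarith, by linarith, h5⟩)
  · have : q ∈ P'.piece := P'.mem_piece_of_notMem_chart hc (fun _ => hq1.le)
      fun hT => (hc (P'.inter_subset ⟨H.memS, hT⟩)).elim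
    exact ⟨P'.piece_subset_thick this, Or.inl this⟩

theorem left_mem (H : FaceMatch b P P' p q) (hq : q ∈ P'.thick) (hf : ‖P'.tubeS.fib q‖ < 1) :
    p ∈ P.thick ∧ (p ∈ P.piece ∨ (p ∈ P.chart ∧ radSq (P.coord p) < 1)) := by
  have h0 := P'.fibS_of_mem_thick hq H.memS
  have hmul := H.norm_mul_norm
  have hp1 : 1 < ‖P.tubeT.fib p‖ := by nlinarith
  by_cases hpc : p ∈ P.chart
  · have hc := H.mem_chart_iff.1 hpc
    have h1 := P.norm_w₁_eq H.memT hpc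
    have h2 := P'.norm_w₂_eq H.memS hc
    have h3 := (H.coords hpc).1
    have h4 : 5 / 4 < ‖P'.w₁ q‖ := by
      rcases ((P'.mem_thick_iff hc).1 hq).2.2 with h | h
      · exact h
      · linarith
    refine ⟨(P.mem_thick_iff hpc).2 ⟨by linarith, by linarith, Or.inr (by linarith)⟩, ?_⟩
    rcases lt_or_ge (radSq (P.coord p)) 1 with h5 | h5
    · exact Or.inr ⟨hpc, h5⟩
    · exact Or.inl ((P.mem_piece_iff_radSq hpc).2 ⟨by linarith, by linarith, h5⟩)
  · have : p ∈ P.piece := P.mem_piece_of_notMem_chart hpc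
      (fun hS => (hpc (P.inter_subset ⟨hS, H.memT⟩)).elim) fun _ => hp1.le
    exact ⟨P.piece_subset_thick this, Or.inl this⟩

end FaceMatch

namespace SumData

variable {k : ℕ} [NeZero k] {X : ZMod k → Type*} [∀ i, TopologicalSpace (X i)]
  [∀ i, ChartedSpace (EuclideanSpace ℝ (Fin 4)) (X i)]
  {S T : ∀ i, Set (X i)} {gS gT : ZMod k → ℕ} {m n : ZMod k → ℤ}
  {P : ∀ i, SurfacePair (X i) (S i) (T i) (gS i) (gT i) (m i) (n i)}

theorem exists_core_of_radSq_le (D : SumData P) {i : ZMod k} {p : X i} (hp : p ∈ (P i).thick)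
    (hc : p ∈ (P i).chart) (h : radSq ((P i).coord p) ≤ 1) :
    ∃ d : (Circle × Circle) × ℂ, ‖d.2‖ ≤ 1 ∧ D.proj (.inr d) = D.proj (.inl ⟨i, p⟩) := by
  have h1 : ‖(D.coreCoord i p).2‖ ≤ 1 :=
    (norm_coreMap_le_one_iff (four_div_pos k) ((P i).level_coord_pos hp hc)).2 h
  exact ⟨_, h1, ((proj_inl_eq_inr_iff hp (h1.trans_lt (one_lt_coreRadius k))).2 ⟨hc, rfl⟩).symm⟩

/-- A bound on the distance in the logarithmic plane bounds each logarithm separately. This converts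
a radius in the core into a polydisc in the chart. -/
theorem norm_le_exp_of_radSq_le {w : ℂ × ℂ} {a : ℝ} (h : radSq w ≤ a) :
    ‖w.1‖ ≤ Real.exp (√a * Real.log 2) ∧ ‖w.2‖ ≤ Real.exp (√a * Real.log 2) := by
  have h2 : 0 < Real.log 2 := Real.log_pos one_lt_two
  rw [radSq, div_le_iff₀ (by positivity)] at h
  have ha : 0 ≤ a := by
    by_contra! hlt
    nlinarith [sq_nonneg (Real.log ‖w.1‖), sq_nonneg (Real.log ‖w.2‖), sq_pos_of_pos h2]
  have h3 : (√a * Real.log 2) ^ 2 = a * Real.log 2 ^ 2 := by rw [mul_pow, Real.sq_sqrt ha]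
  have key (x : ℝ) (hx : 0 ≤ x) (hle : Real.log x ^ 2 ≤ a * Real.log 2 ^ 2) :
      x ≤ Real.exp (√a * Real.log 2) := by
    rcases hx.eq_or_lt with rfl | hx
    · exact (Real.exp_pos _).le
    · rw [← Real.log_le_iff_le_exp hx]
      exact (le_abs_self _).trans (abs_le_of_sq_le_sq (h3 ▸ hle) (by positivity))
  exact ⟨key _ (norm_nonneg _) (by nlinarith [sq_nonneg (Real.log ‖w.2‖)]),
    key _ (norm_nonneg _) (by nlinarith [sq_nonneg (Real.log ‖w.1‖)])⟩

theorem exp_sqrt_mul_lt_three {a : ℝ} (ha : a < Real.log 3 ^ 2 / Real.log 2 ^ 2) :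
    Real.exp (√a * Real.log 2) < 3 := by
  have h2 : 0 < Real.log 2 := Real.log_pos one_lt_two
  have h3 : 0 < Real.log 3 := Real.log_pos (by norm_num)
  rw [← Real.lt_log_iff_exp_lt (by norm_num), ← lt_div_iff₀ h2, Real.sqrt_lt' (by positivity),
    div_pow]
  exact ha

/-- Every point of the open core outside the origin of the disc lies in the chart of a piece. -/
theorem exists_chart_of_core (D : SumData P) {d : (Circle × Circle) × ℂ} (hd : 1 ≤ ‖d.2‖)
    (hd' : ‖d.2‖ < coreRadius k) :
    ∃ (i : ZMod k) (p : X i), p ∈ (P i).chart ∧ p ∈ (P i).piece ∧ D.coreCoord i p = d := by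
  obtain ⟨i, w, hw, h1, h2, hpos⟩ := exists_coreMap_eq D.det_eq
    (norm_pos_iff.1 (one_pos.trans_le hd))
  have ha : radSq w < Real.log 3 ^ 2 / Real.log 2 ^ 2 := by
    rw [← hw, coreRadius,
      norm_coreMap_lt_iff (four_div_pos k) hpos (one_pos.trans one_lt_log_three_div)] at hd'
    exact hd'
  have hr : 1 ≤ radSq w := by
    rw [← hw, ← not_lt, norm_coreMap_lt_one_iff (four_div_pos k) hpos, not_lt] at hd
    exact hd
  obtain ⟨hw1, hw2⟩ := norm_le_exp_of_radSq_le (le_refl (radSq w))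
  have h3 := exp_sqrt_mul_lt_three ha
  obtain ⟨p, hc, rfl⟩ := (P i).exists_coord_eq (hw1.trans_lt h3) (hw2.trans_lt h3)
  exact ⟨i, p, hc, ((P i).mem_piece_iff_radSq hc).2 ⟨h1, h2, hr⟩, hw⟩

/-- A point of a thickened piece is in the piece, in the corner ball, or inside one of the tubes; in
the last case its partner across the face is used instead. A point of the open core outside the
closed unit disc lies in a piece. -/
theorem exists_piece_or_core (D : SumData P) (s : D.Space) :
    (∃ (i : ZMod k) (p : X i), p ∈ (P i).piece ∧ D.proj (.inl ⟨i, p⟩) = s) ∨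
      ∃ d : (Circle × Circle) × ℂ, ‖d.2‖ ≤ 1 ∧ D.proj (.inr d) = s := by
  obtain ⟨⟨i, p⟩ | d, hx, rfl⟩ := exists_proj_eq s
  · have hp : p ∈ (P i).thick := hx
    rcases (P i).thick_cases hp with h | ⟨hc, h⟩ | ⟨hS, h⟩ | ⟨hT, h⟩
    · exact Or.inl ⟨i, p, h, rfl⟩
    · exact Or.inr (D.exists_core_of_radSq_le hp hc h.le)
    · obtain ⟨i, rfl⟩ : ∃ j, i = j + 1 := ⟨i - 1, (sub_add_cancel i 1).symm⟩
      obtain ⟨q, H⟩ := FaceMatch.exists_left (D.genus_eq i) (D.flip i) (P i) (P (i + 1)) hS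
        (lt_trans (by norm_num) ((P (i + 1)).fibS_of_mem_thick hp hS))
      obtain ⟨hq, hq'⟩ := H.left_mem hp h
      have heq : D.proj (.inl ⟨i, q⟩) = D.proj (.inl ⟨i + 1, p⟩) :=
        (proj_inl_eq_inl_iff hq hp).2 (Or.inr (Or.inl ⟨i, q, p, hq, hp, H⟩))
      rcases hq' with hq' | ⟨hqc, hq'⟩
      · exact Or.inl ⟨i, q, hq', heq⟩
      · exact Or.inr (heq ▸ D.exists_core_of_radSq_le hq hqc hq'.le)
    · obtain ⟨q, H⟩ := FaceMatch.exists_right (D.genus_eq i) (D.flip i) (P i) (P (i + 1)) hT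
        (lt_trans (by norm_num) ((P i).fibT_of_mem_thick hp hT))
      obtain ⟨hq, hq'⟩ := H.right_mem hp h
      have heq : D.proj (.inl ⟨i + 1, q⟩) = D.proj (.inl ⟨i, p⟩) :=
        (proj_inl_eq_inl_iff hq hp).2 (Or.inr (Or.inr ⟨i, p, q, hp, hq, H⟩))
      rcases hq' with hq' | ⟨hqc, hq'⟩
      · exact Or.inl ⟨i + 1, q, hq', heq⟩
      · exact Or.inr (heq ▸ D.exists_core_of_radSq_le hq hqc hq'.le)
  · have hd : ‖d.2‖ < coreRadius k := hx
    rcases le_total ‖d.2‖ 1 with h | h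
    · exact Or.inr ⟨d, h, rfl⟩
    · obtain ⟨i, p, hc, hp, rfl⟩ := D.exists_chart_of_core h hd
      exact Or.inl ⟨i, p, hp, (proj_inl_eq_inr_iff ((P i).piece_subset_thick hp) hd).2 ⟨hc, rfl⟩⟩

/-! ### The identifications of the pieces -/

-- Points of the pieces have fibre radius at least `1`, and matched radii have product `1`, so both
-- equal `1`. The corner ball has been removed, which then keeps the base point outside the disc of
-- radius `2`.
omit [NeZero k] in
theorem glued_iff_face (D : SumData P) {a b : Σ i, X i} (ha : a.2 ∈ (P a.1).piece)
    (hb : b.2 ∈ (P b.1).piece) : Glued P D.flip a b ↔ D.Face (.inl a) (.inl b) := by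
  constructor
  · intro h
    have key (i : ZMod k) (p : X i) (q : X (i + 1)) (hp : p ∈ (P i).faceT)
        (hq : q ∈ (P (i + 1)).faceS) (hpp : p ∈ (P i).piece) (hqp : q ∈ (P (i + 1)).piece)
        (he : (P (i + 1)).tubeS.emb q = faceMap (D.flip i) ((P i).tubeT.emb p)) :
        D.Face (.inl ⟨i, p⟩) (.inl ⟨i + 1, q⟩) :=
      ⟨i, p, q, (P i).piece_subset_thick hpp, (P (i + 1)).piece_subset_thick hqp, hp.1, hq.1,
        norm_ne_zero_iff.1 (by rw [hp.2.2]; exact one_ne_zero), he⟩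
    cases h with
    | straight i p q hp hq hflip hbase hfib =>
      refine key i p q hp hq ha hb (Prod.ext ?_ ?_)
      · rw [hflip]; exact hbase
      · rw [hflip]
        change (P (i + 1)).tubeS.fib q = ((starRingEnd ℂ) ((P i).tubeT.fib p))⁻¹
        rw [hfib, ← Complex.inv_eq_conj hp.2.2, inv_inv]
    | flipped i p q hp hq hflip hbase hfib =>
      refine key i p q hp hq ha hb (Prod.ext ?_ ?_)
      · rw [hflip]; exact hbase
      · rw [hflip]
        change (P (i + 1)).tubeS.fib q = ((P i).tubeT.fib p)⁻¹
        rw [hfib, Complex.inv_eq_conj hp.2.2]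
  · obtain ⟨i, p⟩ := a
    obtain ⟨j, q⟩ := b
    intro h
    obtain ⟨rfl, -, -, H⟩ := faceMatch_of_face h
    have h1 := (P i).fibT_of_mem_piece ha H.memT
    have h2 := (P (i + 1)).fibS_of_mem_piece hb H.memS
    have h3 := H.norm_mul_norm
    have h4 : ‖(P i).tubeT.fib p‖ = 1 := le_antisymm (by nlinarith) h1
    have h5 : ‖(P (i + 1)).tubeS.fib q‖ = 1 := by rw [h4, one_mul] at h3; exact h3
    have hlog : 0 < Real.log 2 := Real.log_pos one_lt_two
    have hout : ¬ (((P i).tubeT.base p).1 < 0 ∧ ‖((P i).tubeT.base p).2‖ < 2) := by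
      rintro ⟨h6, h7⟩
      have hc := ((P i).tubeT.mem_chart_iff p H.memT).2 ⟨h6, by linarith⟩
      obtain ⟨-, h8, h9⟩ := ((P i).mem_piece_iff hc).1 ha
      rw [(P i).tubeT.base_eq p ⟨H.memT, hc⟩] at h7
      rw [(P i).norm_w₁_eq H.memT hc, h4, Real.log_one] at h9
      have h10 : 0 ≤ Real.log ‖(P i).w₂ p‖ := Real.log_nonneg h8
      have h11 : Real.log ‖(P i).w₂ p‖ < Real.log 2 := Real.log_lt_log (by linarith) h7
      nlinarith
    have hp : p ∈ (P i).faceT := ⟨H.memT, ⟨((P i).tubeT.emb_mem H.memT).1.1, hout⟩, h4⟩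
    have hq : q ∈ (P (i + 1)).faceS := by
      refine ⟨H.memS, ⟨((P (i + 1)).tubeS.emb_mem H.memS).1.1, ?_⟩, h5⟩
      rwa [H.base_fst, H.norm_base_snd]
    have hinv : ((P i).tubeT.fib p)⁻¹ = (starRingEnd ℂ) ((P i).tubeT.fib p) :=
      Complex.inv_eq_conj h4
    have he1 := congrArg Prod.fst H.eq
    have he2 := congrArg Prod.snd H.eq
    cases hf : D.flip i with
    | false =>
      rw [hf] at he1 he2
      refine .straight i p q hp hq hf he1 (he2.trans ?_)
      change ((starRingEnd ℂ) ((P i).tubeT.fib p))⁻¹ = (P i).tubeT.fib p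
      rw [← hinv, inv_inv]
    | true =>
      rw [hf] at he1 he2
      exact .flipped i p q hp hq hf he1 (he2.trans hinv)

theorem proj_piece_eq_iff (D : SumData P) (a b : Σ i, X i) (ha : a.2 ∈ (P a.1).piece)
    (hb : b.2 ∈ (P b.1).piece) :
    D.proj (.inl a) = D.proj (.inl b) ↔ a = b ∨ Glued P D.flip a b ∨ Glued P D.flip b a := by
  rw [D.glued_iff_face ha hb, D.glued_iff_face hb ha]
  exact proj_inl_eq_inl_iff ((P a.1).piece_subset_thick ha) ((P b.1).piece_subset_thick hb)

/-! ### The attachment of the core -/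

theorem disjoint_core_piece (D : SumData P) (i : ZMod k) :
    Disjoint ((fun d => D.proj (.inr d)) '' (univ ×ˢ Metric.ball 0 1))
      ((fun p => D.proj (.inl ⟨i, p⟩)) '' (P i).piece) := by
  rw [Set.disjoint_left]
  rintro _ ⟨d, ⟨-, hd⟩, rfl⟩ ⟨p, hp, h⟩
  rw [mem_ball_zero_iff] at hd
  have hpt := (P i).piece_subset_thick hp
  obtain ⟨hc, rfl⟩ := (proj_inl_eq_inr_iff hpt (hd.trans (one_lt_coreRadius k))).1 h
  have := (norm_coreMap_lt_one_iff (four_div_pos k) ((P i).level_coord_pos hpt hc)).1 hd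
  exact (((P i).mem_piece_iff_radSq hc).1 hp).2.2.not_gt this

theorem norm_coreCoord_eq_one_iff (D : SumData P) {i : ZMod k} {p : X i} (hp : p ∈ (P i).thick)
    (hc : p ∈ (P i).chart) : ‖(D.coreCoord i p).2‖ = 1 ↔ radSq ((P i).coord p) = 1 :=
  norm_coreMap_eq_one_iff (four_div_pos k) ((P i).level_coord_pos hp hc)

theorem image_sphere_core (D : SumData P) :
    (fun d => D.proj (.inr d)) '' (univ ×ˢ Metric.sphere 0 1) =
      ⋃ i, (fun p => D.proj (.inl ⟨i, p⟩)) '' (P i).hopf := by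
  ext s
  simp only [mem_iUnion]
  constructor
  · rintro ⟨d, ⟨-, hd⟩, rfl⟩
    rw [mem_sphere_zero_iff_norm] at hd
    have hd' : ‖d.2‖ < coreRadius k := hd.trans_lt (one_lt_coreRadius k)
    obtain ⟨i, p, hc, hp, rfl⟩ := D.exists_chart_of_core hd.ge hd'
    have hpt := (P i).piece_subset_thick hp
    have h1 := ((P i).mem_piece_iff_radSq hc).1 hp
    exact ⟨i, p, (P i).mem_hopf_iff.2 ⟨hc, h1.1, h1.2.1, (D.norm_coreCoord_eq_one_iff hpt hc).1 hd⟩,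
      (proj_inl_eq_inr_iff hpt hd').2 ⟨hc, rfl⟩⟩
  · rintro ⟨i, p, hp, rfl⟩
    have hpt := (P i).piece_subset_thick ((P i).hopf_subset_piece hp)
    obtain ⟨hc, -, -, h3⟩ := (P i).mem_hopf_iff.1 hp
    have hd := (D.norm_coreCoord_eq_one_iff hpt hc).2 h3
    exact ⟨D.coreCoord i p, ⟨mem_univ _, mem_sphere_zero_iff_norm.2 hd⟩,
      ((proj_inl_eq_inr_iff hpt (hd.trans_lt (one_lt_coreRadius k))).2 ⟨hc, rfl⟩).symm⟩

theorem coreCoord_snd_congr (D : SumData P) {i : ZMod k} {p q : X i}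
    (h1 : ‖(P i).w₁ q‖ = ‖(P i).w₁ p‖) (h2 : ‖(P i).w₂ q‖ = ‖(P i).w₂ p‖) :
    (D.coreCoord i q).2 = (D.coreCoord i p).2 := by
  have : level ((P i).coord q) = level ((P i).coord p) := by
    simp only [level, SurfacePair.coord, h1, h2]
  simp only [coreCoord, coreMap, this]

/-- On `V_i` the value of `|w₁|` determines that of `|w₂|`, hence the level and the disc coordinate.
The remaining two angles sweep out a torus, on which the matrix `N i` acts bijectively. -/
theorem image_torus_core (D : SumData P) {i : ZMod k} {p : X i} (hp : p ∈ (P i).hopf)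
    {t : Circle × Circle} {ζ : ℂ} (hζ : ζ ∈ Metric.sphere (0 : ℂ) 1)
    (h : D.proj (.inr (t, ζ)) = D.proj (.inl ⟨i, p⟩)) :
    (fun s => D.proj (.inr (s, ζ))) '' univ = (fun p => D.proj (.inl ⟨i, p⟩)) ''
      {q | q ∈ (P i).hopf ∧ ‖(P i).w₁ q‖ = ‖(P i).w₁ p‖} := by
  rw [mem_sphere_zero_iff_norm] at hζ
  have hρ : ‖ζ‖ < coreRadius k := hζ.trans_lt (one_lt_coreRadius k)
  have hpt := (P i).piece_subset_thick ((P i).hopf_subset_piece hp)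
  obtain ⟨hc, hpe⟩ := (proj_inl_eq_inr_iff hpt hρ).1 h.symm
  have hsnd : (D.coreCoord i p).2 = ζ := by rw [hpe]
  ext y
  constructor
  · rintro ⟨s, -, rfl⟩
    set u := torusAct (D.N i).adjugate s with hu
    obtain ⟨-, hp1, hp2, hp3⟩ := hp
    obtain ⟨h1, h2⟩ := (P i).coord_mem hc
    have hnorm (x : Circle) (r : ℂ) : ‖(x : ℂ) * (‖r‖ : ℝ)‖ = ‖r‖ := by
      rw [norm_mul, Circle.norm_coe, one_mul, Complex.norm_real, norm_norm]
    obtain ⟨q, hqc, hq⟩ := (P i).exists_coord_eq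
      (w := ((u.1 : ℂ) * (‖(P i).w₁ p‖ : ℝ), (u.2 : ℂ) * (‖(P i).w₂ p‖ : ℝ)))
      ((hnorm _ _).trans_lt h1) ((hnorm _ _).trans_lt h2)
    have hq1 : (P i).w₁ q = (u.1 : ℂ) * (‖(P i).w₁ p‖ : ℝ) := congrArg Prod.fst hq
    have hq2 : (P i).w₂ q = (u.2 : ℂ) * (‖(P i).w₂ p‖ : ℝ) := congrArg Prod.snd hq
    have hn1 : ‖(P i).w₁ q‖ = ‖(P i).w₁ p‖ := by rw [hq1, hnorm]
    have hn2 : ‖(P i).w₂ q‖ = ‖(P i).w₂ p‖ := by rw [hq2, hnorm]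
    have hqh : q ∈ (P i).hopf := ⟨hqc, by rwa [hn1], by rwa [hn2], by rwa [hn1, hn2]⟩
    have hqt := (P i).piece_subset_thick ((P i).hopf_subset_piece hqh)
    refine ⟨q, ⟨hqh, hn1⟩, (proj_inl_eq_inr_iff hqt hρ).2 ⟨hqc, Prod.ext ?_ ?_⟩⟩
    · change torusAct (D.N i) (unitPart ((P i).w₁ q), unitPart ((P i).w₂ q)) = s
      rw [hq1, hq2, unitPart_ofReal_mul (by linarith), unitPart_ofReal_mul (by linarith)]
      exact torusAct_cancel_adjugate (D.det_eq i) s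
    · exact (D.coreCoord_snd_congr hn1 hn2).trans hsnd
  · rintro ⟨q, ⟨hqh, hn1⟩, rfl⟩
    have hqt := (P i).piece_subset_thick ((P i).hopf_subset_piece hqh)
    obtain ⟨hqc, hq1, hq2, hq3⟩ := hqh
    obtain ⟨-, hp1, hp2, hp3⟩ := hp
    have hn2 : ‖(P i).w₂ q‖ = ‖(P i).w₂ p‖ := by
      rw [hn1, ← hp3, add_right_inj, sq_eq_sq₀ (Real.log_nonneg hq2) (Real.log_nonneg hp2)] at hq3
      exact Real.log_injOn_pos (mem_Ioi.2 (by linarith)) (mem_Ioi.2 (by linarith)) hq3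
    have hs := (D.coreCoord_snd_congr hn1 hn2).trans hsnd
    exact ⟨(D.coreCoord i q).1, mem_univ _,
      ((proj_inl_eq_inr_iff (D := D) (d := ((D.coreCoord i q).1, ζ)) hqt hρ).2 ⟨hqc, Prod.ext rfl hs⟩).symm⟩

theorem injOn_proj_core (D : SumData P) :
    InjOn (fun d => D.proj (.inr d)) (univ ×ˢ Metric.closedBall 0 1) := by
  rintro d ⟨-, hd⟩ e ⟨-, he⟩ h
  rw [mem_closedBall_zero_iff] at hd he
  exact (proj_inr_eq_iff (hd.trans_lt (one_lt_coreRadius k))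
    (he.trans_lt (one_lt_coreRadius k))).1 h

end SumData
/-! ### Topology of the sum -/

section SumTopology

open Filter Topology

variable {k : ℕ} [NeZero k] [Fact (1 < k)] {X : ZMod k → Type u} [∀ i, TopologicalSpace (X i)]
  [∀ i, ChartedSpace (EuclideanSpace ℝ (Fin 4)) (X i)]
  [∀ i, IsManifold (𝓡 4) ∞ (X i)] [∀ i, T2Space (X i)]
  {S T : ∀ i, Set (X i)} {gS gT : ZMod k → ℕ} {m n : ZMod k → ℤ}
  {P : ∀ i, SurfacePair (X i) (S i) (T i) (gS i) (gT i) (m i) (n i)}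

/-- A compact subset of the chart, where the core is attached. -/
def SurfacePair.cornerCollar {X : Type*} [TopologicalSpace X]
    [ChartedSpace (EuclideanSpace ℝ (Fin 4)) X] {S T : Set X} {g h : ℕ} {m n : ℤ}
    (P : SurfacePair X S T g h m n) (c : ℝ) : Set X :=
  {p | p ∈ P.chart ∧ P.coord p ∈
    {z : ℂ | 4 / 5 ≤ ‖z‖ ∧ ‖z‖ ≤ c} ×ˢ {z : ℂ | 4 / 5 ≤ ‖z‖ ∧ ‖z‖ ≤ c}}

theorem SurfacePair.isCompact_cornerCollar {X : Type*} [TopologicalSpace X]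
    [ChartedSpace (EuclideanSpace ℝ (Fin 4)) X] [IsManifold (𝓡 4) ∞ X] {S T : Set X} {g h : ℕ}
    {m n : ℤ} (P : SurfacePair X S T g h m n) {c : ℝ} (hc : c < 3) :
    IsCompact (P.cornerCollar c) :=
  P.isCompact_preimage (isCompact_annulus.prod isCompact_annulus)
    fun _ hw => ⟨hw.1.2.trans_lt hc, hw.2.2.trans_lt hc⟩

namespace SumData

-- The strict bound `r < coreRadius k` leaves room for a uniform `c < 3`, so the points concerned
-- stay in a compact part of the chart.
omit [Fact (1 < k)] [∀ i, IsManifold (𝓡 4) ∞ (X i)] [∀ i, T2Space (X i)] in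
theorem exists_mem_cornerCollar (D : SumData P) {r : ℝ} (hr : r < coreRadius k) :
    ∃ c < 3, ∀ (i : ZMod k) (p : X i), p ∈ (P i).thick → p ∈ (P i).chart →
      ‖(D.coreCoord i p).2‖ ≤ r → p ∈ (P i).cornerCollar c := by
  have hl := four_div_pos k
  have hA := one_pos.trans one_lt_log_three_div
  rcases le_or_gt r 0 with h0 | h0
  · refine ⟨0, by norm_num, fun i p _ _ h => ?_⟩
    have : ‖(D.coreCoord i p).2‖ = _ := norm_coreMap _ _ _ _
    rw [this] at h
    exact absurd (h.trans h0) (Real.exp_pos _).not_ge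
  · have hr' : r = Real.exp (4 / k / 2 * Real.log (Real.exp (Real.log r / (4 / k / 2)))) := by
      rw [Real.log_exp, mul_div_cancel₀ _ (half_pos hl).ne', Real.exp_log h0]
    set a := Real.exp (Real.log r / (4 / k / 2)) with ha
    have ha0 : 0 < a := Real.exp_pos _
    have haA : a < Real.log 3 ^ 2 / Real.log 2 ^ 2 := by
      rw [hr', coreRadius, Real.exp_lt_exp, mul_lt_mul_iff_right₀ (half_pos hl),
        Real.log_lt_log_iff ha0 hA] at hr
      exact hr
    refine ⟨Real.exp (√a * Real.log 2), exp_sqrt_mul_lt_three haA, fun i p hp hc h => ?_⟩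
    obtain ⟨h1, h2, -⟩ := ((P i).mem_thick_iff hc).1 hp
    rw [hr'] at h
    have h3 := norm_le_exp_of_radSq_le
      ((norm_coreMap_le_iff hl ((P i).level_coord_pos hp hc) ha0).1 h)
    exact ⟨hc, ⟨h1.le, h3.1⟩, ⟨h2.le, h3.2⟩⟩

omit [Fact (1 < k)] in
theorem proj_eq_of_frequently_face (D : SumData P) {i j : ZMod k} {p : X i} {q : X j}
    (hp : p ∈ (P i).thick) (hq : q ∈ (P j).thick)
    (h : ∃ᶠ x in 𝓝 p ×ˢ 𝓝 q, D.Face (.inl ⟨i, x.1⟩) (.inl ⟨j, x.2⟩)) :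
    D.proj (.inl ⟨i, p⟩) = D.proj (.inl ⟨j, q⟩) := by
  obtain ⟨x, hx⟩ := h.exists
  obtain ⟨rfl, -⟩ := faceMatch_of_face hx
  have h1 : FaceMatch (D.flip i) (P i) (P (i + 1)) p q := by
    refine FaceMatch.of_frequently (h.mono fun x hx => ?_)
    obtain ⟨_, h1, h2, h3⟩ := faceMatch_of_face hx
    exact ⟨h1, h2, h3⟩
  exact (proj_inl_eq_inl_iff hp hq).2 (Or.inr (Or.inl ⟨i, p, q, hp, hq, h1⟩))

omit [Fact (1 < k)] in
theorem proj_inl_eq_inl_of_frequently (D : SumData P) {i j : ZMod k} {p : X i} {q : X j}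
    (hp : p ∈ (P i).thick) (hq : q ∈ (P j).thick)
    (h : ∃ᶠ x in 𝓝 p ×ˢ 𝓝 q, x.1 ∈ (P i).thick ∧ x.2 ∈ (P j).thick ∧
      D.proj (.inl ⟨i, x.1⟩) = D.proj (.inl ⟨j, x.2⟩)) :
    D.proj (.inl ⟨i, p⟩) = D.proj (.inl ⟨j, q⟩) := by
  have h1 := h.mono fun x hx => (proj_inl_eq_inl_iff hx.1 hx.2.1).1 hx.2.2
  rw [frequently_or_distrib, frequently_or_distrib] at h1
  rcases h1 with h1 | h1 | h1
  · obtain ⟨x, hx⟩ := h1.exists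
    obtain rfl : i = j := (Sigma.mk.inj hx).1
    have h2 : ∃ᶠ x in 𝓝 (p, q), x.1 = x.2 := by
      rw [nhds_prod_eq]
      exact h1.mono fun x hx => eq_of_heq (Sigma.mk.inj hx).2
    have : p = q := tendsto_nhds_unique_of_frequently_eq
      (continuousAt_fst (p := (p, q))) continuousAt_snd h2
    rw [this]
  · exact D.proj_eq_of_frequently_face hp hq h1
  · refine (D.proj_eq_of_frequently_face hq hp ?_).symm
    have h2 : Tendsto Prod.swap (𝓝 p ×ˢ 𝓝 q) (𝓝 q ×ˢ 𝓝 p) := tendsto_snd.prodMk tendsto_fst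
    exact h2.frequently h1

-- Near `d` all matched points of the piece lie in one compact corner collar, which is closed. The
-- limit therefore stays in the chart, where `coreCoord` is continuous.
omit [Fact (1 < k)] in
theorem proj_inl_eq_inr_of_frequently (D : SumData P) {i : ZMod k} {p : X i}
    {d : (Circle × Circle) × ℂ} (hp : p ∈ (P i).thick) (hd : ‖d.2‖ < coreRadius k)
    (h : ∃ᶠ x in 𝓝 p ×ˢ 𝓝 d, x.1 ∈ (P i).thick ∧ ‖x.2.2‖ < coreRadius k ∧
      D.proj (.inl ⟨i, x.1⟩) = D.proj (.inr x.2)) :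
    D.proj (.inl ⟨i, p⟩) = D.proj (.inr d) := by
  obtain ⟨r, hdr, hr⟩ := exists_between hd
  obtain ⟨c, hc3, hc⟩ := D.exists_mem_cornerCollar hr
  have hev : ∀ᶠ x in 𝓝 p ×ˢ 𝓝 d, ‖x.2.2‖ < r :=
    tendsto_snd.eventually ((continuousAt_snd.norm).eventually_lt continuousAt_const hdr)
  have h1 : ∃ᶠ x in 𝓝 (p, d), x.1 ∈ (P i).cornerCollar c ∧ D.coreCoord i x.1 = x.2 := by
    rw [nhds_prod_eq]
    refine (h.and_eventually hev).mono fun x ⟨⟨h1, h2, h3⟩, h4⟩ => ?_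
    obtain ⟨h5, h6⟩ := (proj_inl_eq_inr_iff h1 h2).1 h3
    exact ⟨hc i x.1 h1 h5 (by rw [h6]; exact h4.le), h6⟩
  have hpc : p ∈ (P i).cornerCollar c :=
    isClosed_iff_frequently.1 ((P i).isCompact_cornerCollar hc3).isClosed _
      (continuousAt_fst.tendsto.frequently (h1.mono fun x hx => hx.1) :)
  refine (proj_inl_eq_inr_iff hp hd).2 ⟨hpc.1, ?_⟩
  exact tendsto_nhds_unique_of_frequently_eq
    (ContinuousAt.comp (x := (p, d)) (f := Prod.fst) (g := D.coreCoord i)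
      (D.contMDiffAt_coreCoord hp hpc.1).continuousAt continuousAt_fst)
    continuousAt_snd (h1.mono fun x hx => hx.2)

noncomputable instance (D : SumData P) : TopologicalSpace D.Space := D.gluing.topology

noncomputable instance (D : SumData P) : ChartedSpace (EuclideanSpace ℝ (Fin 4)) D.Space :=
  D.gluing.chartedSpace

instance (D : SumData P) : IsManifold (𝓡 4) ∞ D.Space := D.gluing.isManifold

instance (D : SumData P) : T2Space D.Space := by
  refine D.gluing.t2Space ?_
  have hdown := (contMDiff_corePart_down (X := X)).continuous
  rintro (_ | i) (_ | j)
  · intro d hd e he h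
    have h1 : ∃ᶠ x in 𝓝 (d, e), x.1 = x.2 := by
      rw [nhds_prod_eq]
      exact h.mono fun x hx => ULift.down_injective ((proj_inr_eq_iff hx.1 hx.2.1).1 hx.2.2)
    have : T2Space (SumPart X none) :=
      inferInstanceAs (T2Space (ULift.{u} ((Circle × Circle) × ℂ)))
    have : d = e := tendsto_nhds_unique_of_frequently_eq
      (continuousAt_fst (p := (d, e))) continuousAt_snd h1
    rw [this]
  · intro d hd p hp h
    refine (D.proj_inl_eq_inr_of_frequently hp hd ?_).symm
    have h1 : Tendsto (fun x : SumPart X none × X j => (x.2, ULift.down x.1)) (𝓝 d ×ˢ 𝓝 p)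
        (𝓝 p ×ˢ 𝓝 (ULift.down d)) :=
      tendsto_snd.prodMk (hdown.continuousAt.tendsto.comp tendsto_fst)
    exact h1.frequently (h.mono fun x hx => ⟨hx.2.1, hx.1, hx.2.2.symm⟩)
  · intro p hp d hd h
    refine D.proj_inl_eq_inr_of_frequently hp hd ?_
    have h1 : Tendsto (fun x : X i × SumPart X none => (x.1, ULift.down x.2)) (𝓝 p ×ˢ 𝓝 d)
        (𝓝 p ×ˢ 𝓝 (ULift.down d)) :=
      tendsto_fst.prodMk (hdown.continuousAt.tendsto.comp tendsto_snd)
    exact h1.frequently (h.mono fun x hx => hx)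
  · intro p hp q hq h
    exact D.proj_inl_eq_inl_of_frequently hp hq h

theorem continuousOn_proj_inl (D : SumData P) (i : ZMod k) :
    ContinuousOn (fun p : X i => D.proj (.inl ⟨i, p⟩)) (P i).thick :=
  D.gluing.continuousOn (some i)

theorem continuousOn_proj_inr (D : SumData P) :
    ContinuousOn (fun d => D.proj (.inr d)) {d | ‖d.2‖ < coreRadius k} :=
  (D.gluing.continuousOn none).comp (contMDiff_corePart_up (X := X)).continuous.continuousOn
    fun _ hd => hd

theorem isClosed_image_inter (D : SumData P) {i : ZMod k} {C K : Set (X i)} (hC : IsClosed C)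
    (hCt : C ⊆ (P i).thick) (hK : IsCompact K) :
    IsClosed ((fun p => D.proj (.inl ⟨i, p⟩)) '' (C ∩ K)) :=
  ((hK.inter_left hC).image_of_continuousOn
    ((D.continuousOn_proj_inl i).mono (inter_subset_left.trans hCt))).isClosed

/-- The images of closed subsets of the open sets being glued are closed if these are closed in
the pieces. -/
theorem isClosed_image_proj (D : SumData P) {i : ZMod k} {C : Set (X i)} (hC : IsClosed C)
    (hCt : C ⊆ (P i).thick) : IsClosed ((fun p => D.proj (.inl ⟨i, p⟩)) '' C) := by
  have key {Z : Set D.Space} (hZ : IsClosed Z)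
      (hZC : Z ⊆ (fun p => D.proj (.inl ⟨i, p⟩)) '' C) (y : D.Space)
      (h : ∃ᶠ z in 𝓝 y, z ∈ Z) : y ∈ (fun p => D.proj (.inl ⟨i, p⟩)) '' C :=
    hZC (isClosed_iff_frequently.1 hZ y h)
  rw [isClosed_iff_frequently]
  intro y hy
  obtain ⟨⟨j, q⟩ | d, hx, rfl⟩ := exists_proj_eq y
  · have hq : q ∈ (P j).thick := hx
    have hmap := D.gluing.map_nhds_eq (a := some j) (m := q) hq
    rw [show D.proj (.inl ⟨j, q⟩) = D.gluing.toFun (some j) q from rfl, ← hmap,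
      frequently_map] at hy
    -- A point of `C` mapping close to the given one either lies in the same piece near `q`, where
    -- closedness of `C` applies, or has been moved across a face, and then lies in a compact collar
    -- whose image is closed.
    have h1 : ∃ᶠ x in 𝓝 q, (∃ p ∈ C, (⟨j, x⟩ : Σ i, X i) = ⟨i, p⟩) ∨ D.gluing.toFun (some j) x ∈
        (fun p => D.proj (.inl ⟨i, p⟩)) '' (C ∩ ((P i).collarS ∪ (P i).collarT)) := by
      refine (hy.and_eventually ((P j).isOpen_thick.mem_nhds hq)).mono ?_
      rintro x ⟨⟨p, hp, hpx⟩, hx⟩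
      rcases (proj_inl_eq_inl_iff hx (hCt hp)).1 hpx.symm with h | h | h
      · exact Or.inl ⟨p, hp, h⟩
      · obtain ⟨rfl, h1, h2, h3⟩ := faceMatch_of_face h
        exact Or.inr ⟨p, ⟨hp, Or.inl (h3.mem_collar h1 h2).2⟩, hpx⟩
      · obtain ⟨rfl, h1, h2, h3⟩ := faceMatch_of_face h
        exact Or.inr ⟨p, ⟨hp, Or.inr (h3.mem_collar h1 h2).1⟩, hpx⟩
    rcases frequently_or_distrib.1 h1 with h1 | h1
    · obtain ⟨x, p, -, hxp⟩ := h1.exists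
      obtain rfl : j = i := (Sigma.mk.inj hxp).1
      refine ⟨q, isClosed_iff_frequently.1 hC q (h1.mono ?_), rfl⟩
      rintro x ⟨p, hp, hxp⟩
      rw [eq_of_heq (Sigma.mk.inj hxp).2]
      exact hp
    · refine key (D.isClosed_image_inter hC hCt
        ((P i).isCompact_collarS.union (P i).isCompact_collarT)) (image_mono inter_subset_left) _ ?_
      rw [show D.proj (.inl ⟨j, q⟩) = D.gluing.toFun (some j) q from rfl, ← hmap, frequently_map]
      exact h1
  · have hd : ‖d.2‖ < coreRadius k := hx
    have hmap := D.gluing.map_nhds_eq (a := none) (m := ULift.up d) hd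
    -- An intermediate radius confines the relevant points of `C` to a compact corner collar.
    obtain ⟨r, hdr, hr⟩ := exists_between hd
    obtain ⟨c, hc3, hc⟩ := D.exists_mem_cornerCollar hr
    refine key (D.isClosed_image_inter hC hCt ((P i).isCompact_cornerCollar hc3))
      (image_mono inter_subset_left) _ ?_
    rw [show D.proj (.inr d) = D.gluing.toFun none (ULift.up d) from rfl, ← hmap,
      frequently_map] at hy ⊢
    have hev : ∀ᶠ x : SumPart X none in 𝓝 (ULift.up d), ‖(ULift.down x).2‖ < r :=
      (continuous_snd.comp (contMDiff_corePart_down (X := X)).continuous).norm.continuousAt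
        |>.eventually_lt continuousAt_const hdr
    refine (hy.and_eventually hev).mono ?_
    rintro x ⟨⟨p, hp, hpx⟩, hx⟩
    obtain ⟨h1, h2⟩ := (proj_inl_eq_inr_iff (hCt hp) (hx.trans hr)).1 hpx
    exact ⟨p, ⟨hp, hc i p (hCt hp) h1 (by rw [h2]; exact hx.le)⟩, hpx⟩

theorem isClosedEmbedding_proj (D : SumData P) (i : ZMod k) :
    IsClosedEmbedding ((P i).piece.domRestrict fun p => D.proj (.inl ⟨i, p⟩)) := by
  have hsub := (P i).piece_subset_thick
  refine .of_continuous_injective_isClosedMap ?_ ?_ ?_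
  · exact ((D.continuousOn_proj_inl i).mono hsub).domRestrict
  · exact ((proj_inl_injOn i).mono hsub).injective
  · intro C hC
    have h1 := (P i).isClosed_piece.isClosedEmbedding_subtypeVal.isClosedMap C hC
    have h2 := D.isClosed_image_proj h1
      ((Subtype.coe_image_subset _ C).trans hsub)
    rwa [image_image] at h2

omit [Fact (1 < k)] [∀ i, IsManifold (𝓡 4) ∞ (X i)] [∀ i, T2Space (X i)] in
theorem univ_eq_pieces_union_core (D : SumData P) :
    (⋃ i, (fun p => D.proj (.inl ⟨i, p⟩)) '' (P i).piece) ∪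
      (fun d => D.proj (.inr d)) '' (univ ×ˢ Metric.closedBall 0 1) = univ := by
  rw [eq_univ_iff_forall]
  intro s
  rcases D.exists_piece_or_core s with ⟨i, p, hp, hs⟩ | ⟨d, hd, hs⟩
  · exact Or.inl (mem_iUnion.2 ⟨i, p, hp, hs⟩)
  · exact Or.inr ⟨d, ⟨mem_univ _, mem_closedBall_zero_iff.2 hd⟩, hs⟩

theorem isCompact_image_core (D : SumData P) :
    IsCompact ((fun d => D.proj (.inr d)) '' (univ ×ˢ Metric.closedBall 0 1)) :=
  (isCompact_univ.prod (isCompact_closedBall 0 1)).image_of_continuousOn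
    (D.continuousOn_proj_inr.mono fun _ hd =>
      (mem_closedBall_zero_iff.1 hd.2).trans_lt (one_lt_coreRadius k))

theorem compactSpace (D : SumData P) [∀ i, CompactSpace (X i)] : CompactSpace D.Space := by
  rw [← isCompact_univ_iff, ← D.univ_eq_pieces_union_core]
  exact (isCompact_iUnion fun i => (P i).isClosed_piece.isCompact.image_of_continuousOn
    ((D.continuousOn_proj_inl i).mono (P i).piece_subset_thick)).union D.isCompact_image_core

/-- The pieces are closed in σ-compact manifolds and the core is compact, so the sum is σ-compact; a
σ-compact manifold is second countable. -/
theorem secondCountableTopology (D : SumData P) [∀ i, SecondCountableTopology (X i)] :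
    SecondCountableTopology D.Space := by
  have hX (i : ZMod k) : SigmaCompactSpace (X i) := by
    have := ChartedSpace.locallyCompactSpace (EuclideanSpace ℝ (Fin 4)) (X i)
    infer_instance
  have h : IsSigmaCompact (univ : Set D.Space) := by
    rw [← D.univ_eq_pieces_union_core, union_eq_iUnion]
    refine isSigmaCompact_iUnion _ ?_
    rintro (_ | _)
    · exact D.isCompact_image_core.isSigmaCompact
    · exact isSigmaCompact_iUnion _ fun i => IsSigmaCompact.image_of_continuousOn
        (isSigmaCompact_univ.of_isClosed_subset (P i).isClosed_piece (subset_univ _))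
        ((D.continuousOn_proj_inl i).mono (P i).piece_subset_thick)
  have := isSigmaCompact_univ_iff.1 h
  exact ChartedSpace.secondCountable_of_sigmaCompact (EuclideanSpace ℝ (Fin 4)) D.Space

theorem isLocalDiffeomorphAt_proj_inl (D : SumData P) {i : ZMod k} {p : X i}
    (hp : p ∈ (P i).thick) :
    IsLocalDiffeomorphAt (𝓡 4) (𝓡 4) ∞ (fun p : X i => D.proj (.inl ⟨i, p⟩)) p :=
  D.gluing.isLocalDiffeomorphAt (a := some i) hp

variable (X) in
/-- The identification of the core with a manifold modelled on `EuclideanSpace ℝ (Fin 4)`. -/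
noncomputable def corePartDiffeomorph :
    ((Circle × Circle) × ℂ) ≃ₘ^∞⟮((𝓡 1).prod (𝓡 1)).prod 𝓘(ℝ, ℂ), 𝓡 4⟯ SumPart X none where
  toFun := ULift.up
  invFun := ULift.down
  left_inv _ := rfl
  right_inv _ := rfl
  contMDiff_toFun := contMDiff_corePart_up
  contMDiff_invFun := contMDiff_corePart_down

theorem isLocalDiffeomorphAt_proj_inr (D : SumData P) {d : (Circle × Circle) × ℂ}
    (hd : ‖d.2‖ < coreRadius k) :
    IsLocalDiffeomorphAt (((𝓡 1).prod (𝓡 1)).prod 𝓘(ℝ, ℂ)) (𝓡 4) ∞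
      (fun d => D.proj (.inr d)) d :=
  ((corePartDiffeomorph X).isLocalDiffeomorph d).comp (K := 𝓡 4) (g := D.gluing.toFun none)
    (hg := D.gluing.isLocalDiffeomorphAt (a := none) (m := ULift.up d) hd)

theorem isKFoldSum (D : SumData P) :
    IsKFoldSum P D.flip (fun i p => D.proj (.inl ⟨i, p⟩)) fun d => D.proj (.inr d) where
  localDiffeo i p := D.isLocalDiffeomorphAt_proj_inl ((P i).piece_subset_thick p.2)
  closedEmbedding := D.isClosedEmbedding_proj
  eq_iff := D.proj_piece_eq_iff
  localDiffeo_core d := D.isLocalDiffeomorphAt_proj_inr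
    ((mem_closedBall_zero_iff.1 d.2.2).trans_lt (one_lt_coreRadius k))
  injOn_core := D.injOn_proj_core
  core_interior_disjoint := D.disjoint_core_piece
  core_boundary := D.image_sphere_core
  core_fibrewise _ _ hp _ _ hζ h := D.image_torus_core hp hζ h
  cover := D.univ_eq_pieces_union_core

end SumData

end SumTopology

/-! ### The main theorem. -/

theorem mainTheorem9 {k : ℕ} (hk : 2 ≤ k)
    {X : ZMod k → Type u} [∀ i, TopologicalSpace (X i)] [∀ i, T2Space (X i)]
    [∀ i, SecondCountableTopology (X i)]
    [∀ i, ChartedSpace (EuclideanSpace ℝ (Fin 4)) (X i)] [∀ i, IsManifold (𝓡 4) ∞ (X i)]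
    {S T : ∀ i, Set (X i)} {gS gT : ZMod k → ℕ} {m n : ZMod k → ℤ}
    (P : ∀ i, SurfacePair (X i) (S i) (T i) (gS i) (gT i) (m i) (n i))
    (hg : ∀ i, gT i = gS (i + 1))
    (a : ZMod k → ℤ) (ha : ∀ i, a i = n i + m (i + 1))
    (hcf : ∀ i, cyclicCF k a i = ((0 : ℚ) : OnePoint ℚ)) :
    ∃ (Y : Type u) (_ : TopologicalSpace Y) (_ : ChartedSpace (EuclideanSpace ℝ (Fin 4)) Y)
      (flip : ZMod k → Bool) (j : ∀ i, X i → Y) (c : (Circle × Circle) × ℂ → Y),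
      IsManifold (𝓡 4) ∞ Y ∧ T2Space Y ∧ SecondCountableTopology Y ∧
      ((∀ i, CompactSpace (X i)) → CompactSpace Y) ∧
      (∀ i, i ≠ 0 → flip i = false) ∧
      IsKFoldSum P flip j c := by
  have : NeZero k := ⟨by lia⟩
  have : Fact (1 < k) := ⟨hk⟩
  obtain ⟨flip, N, hflip, hN, hT⟩ := exists_torus_transport hk a hcf
  let D : SumData P := ⟨flip, N, hg, hN, fun i x => by rw [← ha]; exact hT i x⟩
  exact ⟨D.Space, inferInstance, inferInstance, flip, _, _, inferInstance, inferInstance,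
    D.secondCountableTopology, fun _ => D.compactSpace, hflip, D.isKFoldSum⟩
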